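/- Let $d,n\ge 0$, let $\xi_1,\dots,\xi_n\in\mathbb Z^d$ (characters of the torus $(\mathbb C^\times)^d$; write $\xi(z)=\sum_k\xi_k z_k$), $b_1,\dots,b_n\in\mathbb C$ and $\zeta\in\mathbb R^d$. For integers $p,q$ let $\delta(p,q)=\min(|p|,|q|)$ if $pq\le 0$ and $\delta(p,q)=0$ otherwise. Let $\mathcal A$ be the quantized abelian Coulomb branch: the free left $\mathbb C[z_1,\dots,z_d]$-module with basis $r^\lambda$, $\lambda\in\mathbb Z^d$, with multiplication determined by $r^\lambda f(z)=f(z+\lambda)r^\lambda$ and $r^\lambda r^\mu=\prod_i A_i(\lambda,\mu)\,r^{\lambda+\mu}$, where $$A_i(\lambda,\mu)=\begin{cases}\prod_{j=1}^{\delta(\xi_i(\lambda),\xi_i(\mu))}\bigl(\xi_i+b_i+\xi_i(\lambda)-j+\tfrac12\bigr),&\xi_i(\lambda)\ge 0\ge\xi_i(\mu),\\ \prod_{j=1}^{\delta(\xi_i(\lambda),\xi_i(\mu))}\bigl(\xi_i+b_i+\xi_i(\lambda)+j-\tfrac12\bigr),&\xi_i(\lambda)\le 0\le\xi_i(\mu),\\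 1,&\text{otherwise.}\end{cases}$$ Assume that $|\operatorname{Re} b_i|<\tfrac12$ for all $i$, and that there is an involution $\sigma$ of $\{1,\dots,n\}$ with $\xi_{\sigma(i)}=\xi_i$ and $b_{\sigma(i)}=-\overline{b_i}$ for all $i$. Let $\rho$ be the antilinear automorphism of $\mathcal A$ with $$\rho(f(z)r^\lambda)=(-1)^{\sum_i\max(\xi_i(\lambda),0)}e^{-\pi\mathrm i\zeta(\lambda)}\,\bar f(-z)\,r^{-\lambda},$$ where $\bar f$ has the complex conjugate coefficients. A linear map $T:\mathcal A\to\mathbb C$ is a positive trace if $T(aa')=T(a'\rho^2(a))$ for all $a,a'\in\mathcal A$ and $T(a\rho(a))>0$ for all $a\ne0$. For a Laurent polynomial $Q$ in $d$ variables with complex coefficients put $$w_Q(x)=e^{2\pi\zeta(x)-\pi\sum_i\xi_i(x)}\,\frac{Q(e^{2\pi x_1},\dots,e^{2\pi x_d})}{\prod_{j=1}^n\bigl(e^{2\pi\xi_j(x)}+e^{2\pi\mathrm i b_j}\bigr)},\qquad x\in\mathbb R^d.$$ If $w_Q$ decays exponentially at infinity, let $T_Q$ be given by $T_Q(R)=\int_{\mathbb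 R^d}R(\mathrm i x)w_Q(x)\,dx$ for $R\in\mathbb C[z_1,\dots,z_d]$ and $T_Q(R\,r^\lambda)=0$ for $\lambda\ne0$. 1. Let $Q$ be a polynomial such that $w_Q$ decays exponentially. Then $T_Q$ is a positive trace if and only if $Q\neq 0$ and $Q(y)\ge0$ for all $y\in\mathbb R^d$. 2. More generally, let $Q$ be a Laurent polynomial such that $w_Q$ decays exponentially. Then $T_Q$ is a positive trace if and only if $Q\ne0$ and $Q(y)\ge 0$ for all $y\in(\mathbb R\setminus\{0\})^d$. 3. Let $\mathcal P=-\bigl(\zeta-\tfrac12\sum_i\xi_i\bigr)+\sum_i[0,1]\xi_i\subset\mathbb R^d$, with interior $\mathcal P^\circ$. The exponentially decaying weights $w_Q$ ($Q$ a Laurent polynomial) for which $T_Q$ is a positive trace form a convex cone (closed under addition and under multiplication by positive reals). The real dimension of its linear span equals the (finite) number of integer points in the convex hull of $\mathcal P^\circ\cap(2\mathbb Z)^d$. -/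

import Mathlib

open scoped ComplexOrder

noncomputable section

namespace AbelianCoulomb

open MvPolynomial

/- Conventions: the torus is `(ℂˣ)^d`, its cocharacter lattice is `ℤ^d`, its Lie algebra is `ℂ^d`, and
`ℂ[𝔱]` is `MvPolynomial (Fin d) ℂ`.  A character is a vector in `ℤ^d`. -/

/-- The integer `ξ(l)` for a character `ξ` and a cocharacter `l`. -/
def pair {d : ℕ} (ξ l : Fin d → ℤ) : ℤ := ∑ k, ξ k * l k

/-- The real number `ξ(x)` for a character `ξ` and a point `x ∈ 𝔱_ℝ = ℝ^d`. -/
def pairReal {d : ℕ} (ξ : Fin d → ℤ) (x : Fin d → ℝ) : ℝ := ∑ k, (ξ k : ℝ) * x k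

/-- A character, viewed as a linear polynomial on `𝔱`. -/
def charPoly {d : ℕ} (ξ : Fin d → ℤ) : MvPolynomial (Fin d) ℂ := ∑ k, C (ξ k : ℂ) * X k

/-- The shift `(S_l f)(z) = f(z + l)`. -/
def shift {d : ℕ} (l : Fin d → ℤ) : MvPolynomial (Fin d) ℂ →ₐ[ℂ] MvPolynomial (Fin d) ℂ :=
  aeval fun k => X k + C (l k : ℂ)

/-- `d(p, q)`: zero if `p` and `q` have the same sign, and `min |p| |q|` otherwise. -/
def signDist (p q : ℤ) : ℕ := if p * q ≤ 0 then min p.natAbs q.natAbs else 0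

/-- The factor attached to one character `ξ` with flavor `b` in the product `r^l r^m`. -/
def structureFactor {d : ℕ} (ξ : Fin d → ℤ) (b : ℂ) (l m : Fin d → ℤ) :
    MvPolynomial (Fin d) ℂ :=
  if 0 ≤ pair ξ l ∧ pair ξ m ≤ 0 then
    ∏ j ∈ Finset.Icc 1 (signDist (pair ξ l) (pair ξ m)),
      (charPoly ξ + C (b + (pair ξ l : ℂ) - (j : ℂ) + 1 / 2))
  else if pair ξ l ≤ 0 ∧ 0 ≤ pair ξ m then
    ∏ j ∈ Finset.Icc 1 (signDist (pair ξ l) (pair ξ m)),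
      (charPoly ξ + C (b + (pair ξ l : ℂ) + (j : ℂ) - 1 / 2))
  else 1

/-- The underlying space of the quantized abelian Coulomb branch: the free left `ℂ[𝔱]`-module on the
basis `r^l`, `l ∈ ℤ^d`.  The element `f r^l` is `Finsupp.single l f`. -/
abbrev Alg (d : ℕ) : Type := (Fin d → ℤ) →₀ MvPolynomial (Fin d) ℂ

/-- The multiplication of the quantized abelian Coulomb branch (at `ħ = 1`) with characters `ξ i` and
flavors `b i`.  It is determined by `r^l f = S_l(f) r^l` for `f ∈ ℂ[𝔱]` and by
`r^l r^m = (∏ i, structureFactor (ξ i) (b i) l m) r^(l+m)`. -/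
def mul {d n : ℕ} (ξ : Fin n → Fin d → ℤ) (b : Fin n → ℂ) (a a' : Alg d) : Alg d :=
  a.sum fun l f => a'.sum fun m g =>
    Finsupp.single (l + m) (f * shift l g * ∏ i, structureFactor (ξ i) (b i) l m)

/-- `f(z) ↦ f̄(-z)`, where `f̄` has the complex conjugate coefficients. -/
def negConj {d : ℕ} (f : MvPolynomial (Fin d) ℂ) : MvPolynomial (Fin d) ℂ :=
  aeval (fun k => -(X k : MvPolynomial (Fin d) ℂ)) (map (starRingEnd ℂ) f)

/-- The unit complex number `c_l = e^{-π i ζ(l)} (-1)^{∑ max(ξ_i(l), 0)}`. -/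
def rhoCoeff {d n : ℕ} (ξ : Fin n → Fin d → ℤ) (ζ : Fin d → ℝ) (l : Fin d → ℤ) : ℂ :=
  Complex.exp (-(Real.pi * Complex.I * ((∑ k, ζ k * (l k : ℝ) : ℝ) : ℂ))) *
    (-1) ^ (∑ i, (pair (ξ i) l).toNat)

/-- The antilinear map `ρ` with `ρ(f(z) r^l) = f̄(-z) c_l r^{-l}`. -/
def rho {d n : ℕ} (ξ : Fin n → Fin d → ℤ) (ζ : Fin d → ℝ) (a : Alg d) : Alg d :=
  a.sum fun l f => Finsupp.single (-l) (C (rhoCoeff ξ ζ l) * negConj f)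

/-- `T` is a `ρ²`-twisted trace. -/
def IsTwistedTrace {d n : ℕ} (ξ : Fin n → Fin d → ℤ) (b : Fin n → ℂ) (ζ : Fin d → ℝ)
    (T : Alg d → ℂ) : Prop :=
  IsLinearMap ℂ T ∧ ∀ a a' : Alg d, T (mul ξ b a a') = T (mul ξ b a' (rho ξ ζ (rho ξ ζ a)))

/-- `T` is a positive trace: a `ρ²`-twisted trace such that `T(a ρ(a))` is real and positive for all
`a ≠ 0`. -/
def IsPositiveTrace {d n : ℕ} (ξ : Fin n → Fin d → ℤ) (b : Fin n → ℂ) (ζ : Fin d → ℝ)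
    (T : Alg d → ℂ) : Prop :=
  IsTwistedTrace ξ b ζ T ∧ ∀ a : Alg d, a ≠ 0 → 0 < T (mul ξ b a (rho ξ ζ a))

/-- The compatibility of flavors with `ρ`: for each character, the flavors attached to it are grouped
into pairs and singletons `{i, σ i}` with `b (σ i) = - conj (b i)`. -/
def FlavorsSelfConjugate {d n : ℕ} (ξ : Fin n → Fin d → ℤ) (b : Fin n → ℂ) : Prop :=
  ∃ σ : Equiv.Perm (Fin n), Function.Involutive σ ∧
    ∀ i, ξ (σ i) = ξ i ∧ b (σ i) = -(starRingEnd ℂ) (b i)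

/-- The weight
`e^{2πζ - π ∑ ξ_i} q(e^{2π x_1}, …, e^{2π x_d}) / ∏ (e^{2π ξ_j} + e^{2π i b_j})` on `𝔱_ℝ = ℝ^d`. -/
def weight {d n : ℕ} (ξ : Fin n → Fin d → ℤ) (b : Fin n → ℂ) (ζ : Fin d → ℝ)
    (q : (Fin d → ℝ) → ℂ) (x : Fin d → ℝ) : ℂ :=
  (Real.exp (2 * Real.pi * (∑ k, ζ k * x k) - Real.pi * ∑ i, pairReal (ξ i) x) : ℂ) *
      q (fun k => Real.exp (2 * Real.pi * x k)) /
    ∏ j, ((Real.exp (2 * Real.pi * pairReal (ξ j) x) : ℂ) +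
      Complex.exp (2 * Real.pi * Complex.I * b j))

/-- Exponential decay at infinity. -/
def ExpDecay {d : ℕ} (w : (Fin d → ℝ) → ℂ) : Prop :=
  ∃ C c : ℝ, 0 < c ∧ ∀ x, ‖w x‖ ≤ C * Real.exp (-c * ‖x‖)

/-- The functional `T(R) = ∫ R(i x) w(x) dx` on `ℂ[𝔱]`, extended by zero to the nonzero weight spaces
`ℂ[𝔱] r^l`, `l ≠ 0`. -/
def integralTrace {d : ℕ} (w : (Fin d → ℝ) → ℂ) (a : Alg d) : ℂ :=
  ∫ x : Fin d → ℝ, eval (fun k => Complex.I * (x k : ℂ)) (a 0) * w x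

/-- The function on real points given by a polynomial with complex coefficients. -/
def polyFun {d : ℕ} (Q : MvPolynomial (Fin d) ℂ) (y : Fin d → ℝ) : ℂ :=
  eval (fun k => (y k : ℂ)) Q

/-- Laurent polynomials in `d` variables with complex coefficients, as finitely supported families of
coefficients. -/
abbrev Laurent (d : ℕ) : Type := (Fin d → ℤ) →₀ ℂ

/-- The value of a Laurent polynomial at a real point with nonzero coordinates. -/
def laurentFun {d : ℕ} (Q : Laurent d) (y : Fin d → ℝ) : ℂ :=
  Q.sum fun a c => c * ∏ k, (y k : ℂ) ^ (a k)

/-- The weights (exponentially decaying functions of the above form, with a Laurent polynomial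
`Q`) whose trace is positive. -/
def positiveWeights {d n : ℕ} (ξ : Fin n → Fin d → ℤ) (b : Fin n → ℂ) (ζ : Fin d → ℝ) :
    Set ((Fin d → ℝ) → ℂ) :=
  {w | (∃ Q : Laurent d, w = weight ξ b ζ (laurentFun Q)) ∧ ExpDecay w ∧
    IsPositiveTrace ξ b ζ (integralTrace w)}

/-- The polytope `𝒫 = -(ζ - ½ ∑ ξ_i) + ∑ [0,1] ξ_i` in `ℝ^d`. -/
def polytope {d n : ℕ} (ξ : Fin n → Fin d → ℤ) (ζ : Fin d → ℝ) : Set (Fin d → ℝ) :=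
  {p | ∃ t : Fin n → ℝ, (∀ i, t i ∈ Set.Icc (0 : ℝ) 1) ∧
    ∀ k, p k = -(ζ k - 1 / 2 * ∑ i, (ξ i k : ℝ)) + ∑ i, t i * (ξ i k : ℝ)}

/-- The points of `(2ℤ)^d` in the interior of `𝒫`. -/
def evenInteriorPoints {d n : ℕ} (ξ : Fin n → Fin d → ℤ) (ζ : Fin d → ℝ) : Set (Fin d → ℝ) :=
  interior (polytope ξ ζ) ∩ {p | ∃ m : Fin d → ℤ, ∀ k, p k = 2 * (m k : ℝ)}

/-- The integer points in the convex hull of `𝒫° ∩ (2ℤ)^d`. -/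
def hullIntegerPoints {d n : ℕ} (ξ : Fin n → Fin d → ℤ) (ζ : Fin d → ℝ) : Set (Fin d → ℤ) :=
  {m | (fun k => (m k : ℝ)) ∈ convexHull ℝ (evenInteriorPoints ξ ζ)}

end AbelianCoulomb

end

/-! The whole proof rests on moving contours. Only the component of `a ρ(a)` along `r^0` matters for
the trace, and it is a sum over `l` of `F · S_l(F̄(-z)) · A(l,-l)` times a phase, where `F` is the
coefficient of `r^l` in `a`. Although `w_Q` has poles, the product `A(l,-l)(ix) w_Q(x)` continues
holomorphically to the closed tube `x + itl`, `0 ≤ t ≤ 1`: the zeros of `A(l,-l)` cancel the poles,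
and what remains is a product of Gamma functions (`gammaKernel`, `eval_pairFactor_mul_weight`) with
uniform exponential decay (`tubeDecay_tubeFun`). So the integral over `ℝ^d` may be translated by
`itl` (`integral_tube_shift`).

Translating by `il` turns the kernel for `l` into the kernel for `-l`, up to the scalar of `ρ²`;
this is the twisted trace identity (`isTwistedTrace_integralTrace`). Translating by `il/2` gives
positivity: `F · S_l(F̄(-z))` becomes `|F(ix - l/2)|²`, each `e^{2πx_k}` becomes `(-1)^{l_k}
e^{2πx_k}`, and the remaining factor `halfDensity` is positive because `σ` pairs each Gamma value
with a conjugate one (`integralTrace_mul_rho`, `halfDensity_pos`). The points `(-1)^l e^{2πx}` fill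
all open orthants, so a nonzero `Q ≥ 0` there gives a positive trace. Conversely, for fixed `l` the
polynomial `F` is arbitrary, and polynomials are dense in `L²(e^{-c‖x‖}dx)`, which forces `Q ≥ 0`
pointwise (`nonneg_of_integral_sq_mul_nonneg`). For polynomial `Q`, continuity extends this to all
of `ℝ^d`.

These arguments need decay of every monomial of `Q`, whereas the hypothesis concerns `w_Q`. Along a
generic ray a single monomial dominates, so no cancellation can hide growth
(`decayExponent_of_expDecay`). The admissible exponents are the integer points of `𝒫°`, by duality
with the support function of `𝒫`.

For the dimension of the span: if `Q ≥ 0` on all orthants, the exponent dominating in a generic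
direction is even in each coordinate, so all exponents of `Q` lie in the convex hull of the even
points of `𝒫°` (`support_subset_hullIntegerPoints`). Conversely, a monomial with exponent in that
hull is bounded by the sum of the even monomials, hence is a difference of two nonnegative Laurent
polynomials (`hullWeight_mem_span`). -/

noncomputable section

namespace AbelianCoulomb

/-! ### The `r^0` component of products and the polynomials `A(l,-l)`. -/

section Algebra

open MvPolynomial

variable {d n : ℕ}

/-- The product `∏ i, A_i(l, -l)`, i.e. `r^l r^(-l)`. -/
def pairFactor (ξ : Fin n → Fin d → ℤ) (b : Fin n → ℂ) (l : Fin d → ℤ) :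
    MvPolynomial (Fin d) ℂ :=
  ∏ i, structureFactor (ξ i) (b i) l (-l)

theorem mul_apply_zero (ξ : Fin n → Fin d → ℤ) (b : Fin n → ℂ) (a a' : Alg d) :
    mul ξ b a a' 0 = a.sum fun l f => f * shift l (a' (-l)) * pairFactor ξ b l := by
  unfold mul
  rw [Finsupp.sum_apply]
  refine Finsupp.sum_congr fun l _ => ?_
  rw [Finsupp.sum_apply, Finsupp.sum, Finset.sum_eq_single (-l)]
  · simp [pairFactor]
  · intro m _ hm
    rw [Finsupp.single_eq_of_ne]
    intro h
    exact hm (eq_neg_of_add_eq_zero_right h.symm)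
  · intro h
    rw [Finsupp.notMem_support_iff.1 h]
    simp

/-- Organised by the second factor, so that both sides of the trace identity become sums over the
support of the same element `a`. -/
theorem mul_apply_zero' (ξ : Fin n → Fin d → ℤ) (b : Fin n → ℂ) (a a' : Alg d) :
    mul ξ b a a' 0 = a'.sum fun m g => a (-m) * shift (-m) g * pairFactor ξ b (-m) := by
  unfold mul
  rw [Finsupp.sum_comm, Finsupp.sum_apply]
  refine Finsupp.sum_congr fun m _ => ?_
  rw [Finsupp.sum_apply, Finsupp.sum, Finset.sum_eq_single (-m)]
  · simp [pairFactor]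
  · intro l _ hm
    rw [Finsupp.single_eq_of_ne]
    intro h
    exact hm (eq_neg_of_add_eq_zero_left h.symm)
  · intro h
    rw [Finsupp.notMem_support_iff.1 h]
    simp

theorem eval_shift (l : Fin d → ℤ) (f : MvPolynomial (Fin d) ℂ) (v : Fin d → ℂ) :
    eval v (shift l f) = eval (fun k => v k + l k) f := by
  have : (aeval v : MvPolynomial (Fin d) ℂ →ₐ[ℂ] ℂ).comp (shift l) =
      aeval (fun k => v k + (l k : ℂ)) := by
    ext k; simp [shift]
  simpa [MvPolynomial.coe_aeval_eq_eval] using DFunLike.congr_fun this f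

theorem eval_negConj (f : MvPolynomial (Fin d) ℂ) (v : Fin d → ℂ) :
    eval v (negConj f) = (starRingEnd ℂ) (eval (fun k => -(starRingEnd ℂ) (v k)) f) := by
  induction f using MvPolynomial.induction_on with
  | C a => simp [negConj]
  | add p q hp hq =>
    simp only [negConj, map_add] at hp hq ⊢
    rw [hp, hq]
  | mul_X p k hp =>
    simp only [negConj, map_mul] at hp ⊢
    rw [hp]; simp

theorem negConj_negConj (f : MvPolynomial (Fin d) ℂ) : negConj (negConj f) = f := by
  refine MvPolynomial.funext fun v => ?_
  simp [eval_negConj]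

theorem negConj_C_mul (c : ℂ) (f : MvPolynomial (Fin d) ℂ) :
    negConj (C c * f) = C ((starRingEnd ℂ) c) * negConj f := by
  simp [negConj]

theorem negConj_zero : negConj (0 : MvPolynomial (Fin d) ℂ) = 0 := by simp [negConj]

theorem rho_apply (ξ : Fin n → Fin d → ℤ) (ζ : Fin d → ℝ) (a : Alg d) (l : Fin d → ℤ) :
    rho ξ ζ a l = C (rhoCoeff ξ ζ (-l)) * negConj (a (-l)) := by
  unfold rho
  rw [Finsupp.sum_apply, Finsupp.sum, Finset.sum_eq_single (-l)]
  · simp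
  · intro m _ hm
    rw [Finsupp.single_eq_of_ne]
    intro h
    exact hm (by rw [h, neg_neg])
  · intro h
    rw [Finsupp.notMem_support_iff.1 h]
    simp [negConj_zero]

/-- The scalar by which `ρ²` acts on `r^l`. -/
def twist (ξ : Fin n → Fin d → ℤ) (ζ : Fin d → ℝ) (l : Fin d → ℤ) : ℂ :=
  rhoCoeff ξ ζ (-l) * (starRingEnd ℂ) (rhoCoeff ξ ζ l)

theorem rho_rho_apply (ξ : Fin n → Fin d → ℤ) (ζ : Fin d → ℝ) (a : Alg d) (l : Fin d → ℤ) :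
    rho ξ ζ (rho ξ ζ a) l = C (twist ξ ζ l) * a l := by
  rw [rho_apply, rho_apply, negConj_C_mul, negConj_negConj, neg_neg, ← mul_assoc, ← C_mul, twist]

theorem pair_neg (ξ l : Fin d → ℤ) : pair ξ (-l) = -pair ξ l := by
  simp [pair]

/-- The complex-linear extension of a character. -/
def pairC (ξ : Fin d → ℤ) (z : Fin d → ℂ) : ℂ := ∑ k, (ξ k : ℂ) * z k

theorem pairC_ofReal (ξ : Fin d → ℤ) (x : Fin d → ℝ) :
    pairC ξ (fun k => (x k : ℂ)) = (pairReal ξ x : ℂ) := by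
  simp [pairC, pairReal]

theorem pairC_int (ξ l : Fin d → ℤ) : pairC ξ (fun k => (l k : ℂ)) = (pair ξ l : ℂ) := by
  simp [pairC, pair]

theorem pairC_add_mul (ξ : Fin d → ℤ) (z z' : Fin d → ℂ) (w : ℂ) :
    pairC ξ (fun k => z k + w * z' k) = pairC ξ z + w * pairC ξ z' := by
  simp only [pairC, mul_add, Finset.sum_add_distrib, Finset.mul_sum]
  congr 1
  exact Finset.sum_congr rfl fun k _ => by ring

theorem pairC_mul (ξ : Fin d → ℤ) (z : Fin d → ℂ) (w : ℂ) :
    pairC ξ (fun k => w * z k) = w * pairC ξ z := by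
  simp only [pairC, Finset.mul_sum]
  exact Finset.sum_congr rfl fun k _ => by ring

theorem eval_charPoly (ξ : Fin d → ℤ) (v : Fin d → ℂ) : eval v (charPoly ξ) = pairC ξ v := by
  simp [charPoly, pairC]

/-- The value of `A(l, -l)` for one character, as a function of `u = ξ(z) + b` and `p = ξ(l)`. -/
def linearFactors (p : ℤ) (u : ℂ) : ℂ :=
  (∏ k ∈ Finset.range p.toNat, (u + 1 / 2 + k)) *
    ∏ k ∈ Finset.range (-p).toNat, (u - 1 / 2 - k)

/-- Here `δ(p,-p) = |p|`, and the substitution `k = |p| - j` turns the factors into half-integer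
steps away from `u`. -/
theorem eval_structureFactor (ξ : Fin d → ℤ) (b : ℂ) (l : Fin d → ℤ) (v : Fin d → ℂ) :
    eval v (structureFactor ξ b l (-l)) = linearFactors (pair ξ l) (pairC ξ v + b) := by
  unfold structureFactor linearFactors signDist
  rw [pair_neg]
  generalize pair ξ l = p
  have hp : p * -p ≤ 0 := by nlinarith [sq_nonneg p]
  rw [if_pos hp, Int.natAbs_neg, min_self]
  rcases le_total 0 p with h | h
  · obtain ⟨q, rfl⟩ := Int.eq_ofNat_of_zero_le h
    rw [if_pos (by omega)]
    have : (-(q : ℤ)).toNat = 0 := by omega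
    simp only [this, Finset.range_zero, Finset.prod_empty, mul_one, map_prod, map_add, eval_charPoly,
      eval_C, Int.natAbs_natCast, Int.toNat_natCast, Int.cast_natCast]
    rw [← Finset.prod_range_reflect, ← Finset.Ico_succ_right_eq_Icc, Finset.prod_Ico_eq_prod_range]
    simp only [Order.succ_eq_add_one, Nat.add_sub_cancel]
    refine Finset.prod_congr rfl fun k hk => ?_
    rw [Finset.mem_range] at hk
    rw [Nat.sub_sub, Nat.cast_sub (by omega)]
    push_cast; ring
  · obtain ⟨q, hq⟩ := Int.eq_ofNat_of_zero_le (neg_nonneg.2 h)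
    obtain rfl : p = -(q : ℤ) := by omega
    by_cases h0 : q = 0
    · subst h0; simp
    rw [if_neg (by omega), if_pos (by omega)]
    have : (-(q : ℤ)).toNat = 0 := by omega
    simp only [this, Finset.range_zero, Finset.prod_empty, one_mul, map_prod, map_add, eval_charPoly,
      eval_C, Int.natAbs_neg, Int.natAbs_natCast, neg_neg, Int.toNat_natCast]
    rw [← Finset.prod_range_reflect, ← Finset.Ico_succ_right_eq_Icc, Finset.prod_Ico_eq_prod_range]
    simp only [Order.succ_eq_add_one, Nat.add_sub_cancel]
    refine Finset.prod_congr rfl fun k hk => ?_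
    rw [Finset.mem_range] at hk
    rw [Nat.sub_sub, Nat.cast_sub (by omega)]
    push_cast; ring

theorem eval_pairFactor (ξ : Fin n → Fin d → ℤ) (b : Fin n → ℂ) (l : Fin d → ℤ)
    (v : Fin d → ℂ) :
    eval v (pairFactor ξ b l) = ∏ i, linearFactors (pair (ξ i) l) (pairC (ξ i) v + b i) := by
  simp [pairFactor, eval_structureFactor, map_prod]

/-! ### The Gamma kernel: holomorphy, decay and positivity. -/

theorem exists_pow_le_exp (N : ℕ) {R ε : ℝ} (hR : 0 ≤ R) (hε : 0 < ε) :
    ∃ C : ℝ, 0 ≤ C ∧ ∀ r : ℝ, 0 ≤ r → (r + R) ^ N ≤ C * Real.exp (ε * r) := by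
  refine ⟨N.factorial / ε ^ N * Real.exp (ε * R), by positivity, fun r hr => ?_⟩
  have h := Real.pow_div_factorial_le_exp (ε * (r + R)) (by positivity) N
  rw [div_le_iff₀ (by positivity), mul_pow] at h
  rw [mul_assoc, ← Real.exp_add, show ε * R + ε * r = ε * (r + R) by ring, div_mul_eq_mul_div,
    le_div_iff₀ (by positivity)]
  linarith

theorem Gamma_add_natCast (v : ℂ) (hv : ∀ k : ℕ, v ≠ -k) (N : ℕ) :
    Complex.Gamma (v + N) = (∏ k ∈ Finset.range N, (v + k)) * Complex.Gamma v := by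
  induction N with
  | zero => simp
  | succ N ih =>
    have h : v + N ≠ 0 := fun h => hv N (eq_neg_of_add_eq_zero_left h)
    rw [Nat.cast_succ, ← add_assoc, Complex.Gamma_add_one _ h, ih, Finset.prod_range_succ]
    ring

/-- The entire replacement for `A(l, -l) / (e^{2πξ} + e^{2πib})` on the tube between `0` and `l`. -/
def gammaKernel (p : ℤ) (u : ℂ) : ℂ :=
  Complex.Gamma (1 / 2 + u + p.toNat) * Complex.Gamma (1 / 2 - u + (-p).toNat)

/-- Writing `p = p⁺ - p⁻`, the shift exchanges the roles of `p⁺` and `p⁻`. This symmetry is the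
source of the trace property. -/
theorem gammaKernel_sub (p : ℤ) (u : ℂ) : gammaKernel p (u - p) = gammaKernel (-p) u := by
  unfold gammaKernel
  have h : (p : ℂ) = (p.toNat : ℂ) - ((-p).toNat : ℂ) := by
    have : (p.toNat : ℤ) - ((-p).toNat : ℤ) = p := by omega
    exact_mod_cast this.symm
  rw [neg_neg, h]
  congr 2 <;> ring

theorem linearFactors_eq (p : ℤ) (u : ℂ) :
    linearFactors p u = (-1) ^ (-p).toNat * ((∏ k ∈ Finset.range p.toNat, (1 / 2 + u + k)) *
      ∏ k ∈ Finset.range (-p).toNat, (1 / 2 - u + k)) := by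
  unfold linearFactors
  have h : ∀ q : ℕ, ∏ k ∈ Finset.range q, (u - 1 / 2 - k) =
      (-1) ^ q * ∏ k ∈ Finset.range q, (1 / 2 - u + k) := by
    intro q
    induction q with
    | zero => simp
    | succ q ih => rw [Finset.prod_range_succ, Finset.prod_range_succ, ih, pow_succ]; ring
  rw [h, mul_left_comm]
  congr 3
  ext k
  ring

/-- The functional equation of Gamma splits off the linear factors, and the reflection formula
evaluates `Γ(1/2+u) Γ(1/2-u)` as `π / cos(πu)`. Nonvanishing of the cosine keeps both arguments away
from the poles. -/
theorem gammaKernel_eq (p : ℤ) (u : ℂ) (hu : Complex.cos (Real.pi * u) ≠ 0) :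
    gammaKernel p u =
      (-1) ^ (-p).toNat * linearFactors p u * (Real.pi / Complex.cos (Real.pi * u)) := by
  have h1 : ∀ k : ℕ, 1 / 2 + u ≠ -k := by
    intro k hk
    refine hu (Complex.cos_eq_zero_iff.2 ⟨-(k + 1 : ℤ), ?_⟩)
    rw [eq_sub_of_add_eq' hk]; push_cast; ring
  have h2 : ∀ k : ℕ, 1 / 2 - u ≠ -k := by
    intro k hk
    refine hu (Complex.cos_eq_zero_iff.2 ⟨(k : ℤ), ?_⟩)
    have : u = 1 / 2 + k := by linear_combination -hk
    rw [this]; push_cast; ring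
  have h3 : Complex.Gamma (1 / 2 + u) * Complex.Gamma (1 / 2 - u) =
      Real.pi / Complex.cos (Real.pi * u) := by
    have h := Complex.Gamma_mul_Gamma_one_sub (1 / 2 + u)
    rw [show 1 - (1 / 2 + u) = 1 / 2 - u by ring] at h
    rw [h]
    congr 1
    rw [show (Real.pi : ℂ) * (1 / 2 + u) = Real.pi * u + Real.pi / 2 by ring,
      Complex.sin_add_pi_div_two]
  unfold gammaKernel
  rw [Gamma_add_natCast _ h1, Gamma_add_natCast _ h2, linearFactors_eq, ← h3]
  have : ((-1 : ℂ) ^ (-p).toNat) * (-1) ^ (-p).toNat = 1 := by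
    rw [← mul_pow]; simp
  linear_combination (-(∏ k ∈ Finset.range p.toNat, (1 / 2 + u + k)) *
      (∏ k ∈ Finset.range (-p).toNat, (1 / 2 - u + k)) * Complex.Gamma (1 / 2 + u) *
      Complex.Gamma (1 / 2 - u)) * this

theorem exp_add_exp_eq_cos (s b : ℂ) :
    Complex.exp (2 * Real.pi * s) + Complex.exp (2 * Real.pi * Complex.I * b) =
      2 * Complex.cos (Real.pi * (Complex.I * s + b)) *
        Complex.exp (Real.pi * s + Real.pi * Complex.I * b) := by
  rw [Complex.two_cos, add_mul, ← Complex.exp_add, ← Complex.exp_add, add_comm]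
  congr 2
  · ring_nf; rw [Complex.I_sq]; ring
  · ring_nf; rw [Complex.I_sq]; ring

theorem cos_pi_mul_ne_zero {u : ℂ} (hu : |u.re| < 1 / 2) : Complex.cos (Real.pi * u) ≠ 0 := by
  rw [Ne, Complex.cos_eq_zero_iff]
  rintro ⟨k, hk⟩
  have h : u = (2 * k + 1) / 2 := by
    have : (Real.pi : ℂ) ≠ 0 := by exact_mod_cast Real.pi_ne_zero
    field_simp at hk
    linear_combination hk / 2
  have h2 : u.re = (2 * k + 1) / 2 := by
    rw [h]
    have : ((2 * k + 1) / 2 : ℂ) = (((2 * k + 1) / 2 : ℝ) : ℂ) := by push_cast; ring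
    rw [this, Complex.ofReal_re]
  rw [h2, abs_lt] at hu
  have h3 : ((2 * k + 1 : ℤ) : ℝ) < 1 := by push_cast; linarith [hu.2]
  have h4 : (-1 : ℝ) < ((2 * k + 1 : ℤ) : ℝ) := by push_cast; linarith [hu.1]
  have h5 : (2 * k + 1 : ℤ) < 1 := by exact_mod_cast h3
  have h6 : (-1 : ℤ) < 2 * k + 1 := by exact_mod_cast h4
  omega

/-- In this strip both Gamma arguments have positive real part. Its width is `1 + |p|`, which leaves
room for a translation by `p`. -/
theorem differentiableAt_gammaKernel {p : ℤ} {u : ℂ} (h1 : -(1 / 2) - (p.toNat : ℝ) < u.re)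
    (h2 : u.re < 1 / 2 + ((-p).toNat : ℝ)) : DifferentiableAt ℂ (gammaKernel p) u := by
  have key : ∀ v : ℂ, 0 < v.re → DifferentiableAt ℂ Complex.Gamma v := by
    intro v hv
    refine Complex.differentiableAt_Gamma v fun m hm => ?_
    rw [hm] at hv
    simp at hv
    linarith [(Nat.cast_nonneg m : (0 : ℝ) ≤ m)]
  unfold gammaKernel
  have e : (1 / 2 : ℂ).re = 1 / 2 := by
    rw [show (1 / 2 : ℂ) = ((1 / 2 : ℝ) : ℂ) by push_cast; rfl, Complex.ofReal_re]
  refine DifferentiableAt.mul ?_ ?_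
  · refine DifferentiableAt.comp (g := Complex.Gamma) u (key _ ?_) (by fun_prop)
    simp only [Complex.add_re, e, Complex.natCast_re]; linarith
  · refine DifferentiableAt.comp (g := Complex.Gamma) u (key _ ?_) (by fun_prop)
    simp only [Complex.add_re, Complex.sub_re, e, Complex.natCast_re]; linarith

/-- The two exponentials in the cosine have moduli `e^{±π Im u}`, and away from the real axis one
dominates the other. -/
theorem exp_le_norm_cos {u : ℂ} (hu : 1 ≤ |u.im|) :
    Real.exp (Real.pi * |u.im|) / 4 ≤ ‖Complex.cos (Real.pi * u)‖ := by
  have h0 : Complex.cos (Real.pi * u) =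
      (Complex.exp (Real.pi * u * Complex.I) - -Complex.exp (-(Real.pi * u) * Complex.I)) / 2 := by
    rw [Complex.cos, sub_neg_eq_add]
  have h1 := abs_norm_sub_norm_le (Complex.exp (Real.pi * u * Complex.I))
    (-Complex.exp (-(Real.pi * u) * Complex.I))
  rw [h0, norm_div, Complex.norm_ofNat]
  rw [norm_neg, Complex.norm_exp, Complex.norm_exp] at h1
  have e1 : (Real.pi * u * Complex.I).re = -(Real.pi * u.im) := by simp
  have e2 : (-(Real.pi * u) * Complex.I).re = Real.pi * u.im := by simp
  rw [e1, e2] at h1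
  have h3 : Real.exp (Real.pi * |u.im|) / 2 ≤
      |Real.exp (-(Real.pi * u.im)) - Real.exp (Real.pi * u.im)| := by
    have h4 : Real.exp (Real.pi * |u.im|) - Real.exp (-(Real.pi * |u.im|)) ≤
        |Real.exp (-(Real.pi * u.im)) - Real.exp (Real.pi * u.im)| := by
      rcases abs_cases u.im with ⟨h, -⟩ | ⟨h, -⟩ <;> rw [h]
      · rw [abs_sub_comm]; exact le_abs_self _
      · rw [mul_neg, neg_neg]; exact le_abs_self _
    have h5 : Real.pi ≤ Real.pi * |u.im| := le_mul_of_one_le_right Real.pi_pos.le hu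
    have h6 : Real.exp (-(Real.pi * |u.im|)) ≤ 1 :=
      Real.exp_le_one_iff.2 (by linarith [Real.pi_pos])
    have h7 := Real.add_one_le_exp (Real.pi * |u.im|)
    linarith [Real.pi_gt_three]
  linarith

theorem norm_linearFactors_le (p : ℤ) (u : ℂ) :
    ‖linearFactors p u‖ ≤ (‖u‖ + 1 / 2 + |(p : ℝ)|) ^ p.natAbs := by
  have hR : 0 ≤ ‖u‖ + 1 / 2 + |(p : ℝ)| := by positivity
  unfold linearFactors
  rw [norm_mul, norm_prod, norm_prod]
  have h : p.natAbs = p.toNat + (-p).toNat := by omega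
  rw [h, pow_add]
  have hk : ∀ q k : ℕ, (q : ℤ) ≤ |p| → k < q → (k : ℝ) ≤ |(p : ℝ)| := by
    intro q k hq hk
    have : (k : ℤ) ≤ |p| := by omega
    exact_mod_cast this
  have e : ‖(1 / 2 : ℂ)‖ = 1 / 2 := by simp
  refine mul_le_mul ?_ ?_ (by positivity) (by positivity)
  · refine (Finset.prod_le_prod (fun _ _ => norm_nonneg _) fun k hk' => ?_).trans_eq
      (by rw [Finset.prod_const, Finset.card_range])
    refine (norm_add₃_le).trans ?_
    rw [e, Complex.norm_natCast]
    have := hk p.toNat k (by rw [Int.toNat_eq_max]; exact max_le (le_abs_self p) (abs_nonneg p))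
      (Finset.mem_range.1 hk')
    linarith
  · refine (Finset.prod_le_prod (fun _ _ => norm_nonneg _) fun k hk' => ?_).trans_eq
      (by rw [Finset.prod_const, Finset.card_range])
    refine (norm_sub_le _ _).trans ((add_le_add_left (norm_sub_le _ _) _).trans ?_)
    rw [e, Complex.norm_natCast]
    have := hk (-p).toNat k
      (by rw [Int.toNat_eq_max]; exact max_le (neg_le_abs p) (abs_nonneg p))
      (Finset.mem_range.1 hk')
    linarith

/-- For `|Im u| ≤ 1` this is compactness. Beyond that, `gammaKernel_eq` presents the kernel as a
polynomial over a cosine, and the loss `ε` in the exponent absorbs the polynomial. -/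
theorem exists_norm_gammaKernel_le (p : ℤ) {α β ε : ℝ} (hα : -(1 / 2) - (p.toNat : ℝ) < α)
    (hβ : β < 1 / 2 + ((-p).toNat : ℝ)) (hε : 0 < ε) :
    ∃ C : ℝ, 0 ≤ C ∧ ∀ u : ℂ, α ≤ u.re → u.re ≤ β →
      ‖gammaKernel p u‖ ≤ C * Real.exp ((ε - Real.pi) * |u.im|) := by
  have hcomp : IsCompact (Set.Icc α β ×ℂ Set.Icc (-1 : ℝ) 1) := isCompact_Icc.reProdIm isCompact_Icc
  obtain ⟨M, hM⟩ := hcomp.exists_bound_of_continuousOn (f := gammaKernel p) fun u hu =>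
    (differentiableAt_gammaKernel (hα.trans_le hu.1.1)
      (lt_of_le_of_lt hu.1.2 hβ)).continuousAt.continuousWithinAt
  obtain ⟨C, hC, hC'⟩ := exists_pow_le_exp p.natAbs
    (R := |α| + |β| + 1 / 2 + |(p : ℝ)|) (by positivity) hε
  have hpi := Real.pi_pos
  refine ⟨|M| * Real.exp Real.pi + C * (4 * Real.pi), by positivity, fun u h1 h2 => ?_⟩
  rw [add_mul]
  by_cases hu : |u.im| ≤ 1
  · have hb := hM u ⟨⟨h1, h2⟩, abs_le.1 hu⟩
    have : 1 ≤ Real.exp Real.pi * Real.exp ((ε - Real.pi) * |u.im|) := by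
      rw [← Real.exp_add]
      apply Real.one_le_exp
      nlinarith [abs_nonneg u.im]
    have h3 : |M| ≤ |M| * Real.exp Real.pi * Real.exp ((ε - Real.pi) * |u.im|) := by
      rw [mul_assoc]; exact le_mul_of_one_le_right (abs_nonneg _) this
    have h4 : 0 ≤ C * (4 * Real.pi) * Real.exp ((ε - Real.pi) * |u.im|) := by positivity
    linarith [le_abs_self M]
  · have hu' : 1 ≤ |u.im| := (not_le.1 hu).le
    have hc := exp_le_norm_cos hu'
    have hpos : 0 < ‖Complex.cos (Real.pi * u)‖ := lt_of_lt_of_le (by positivity) hc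
    rw [gammaKernel_eq p u (norm_pos_iff.1 hpos), norm_mul, norm_mul, norm_pow, norm_neg, norm_one,
      one_pow, one_mul, norm_div, Complex.norm_real, Real.norm_of_nonneg hpi.le]
    have h3 : ‖linearFactors p u‖ ≤ C * Real.exp (ε * |u.im|) := by
      refine (norm_linearFactors_le p u).trans (le_trans ?_ (hC' _ (abs_nonneg _)))
      refine pow_le_pow_left₀ (by positivity) ?_ _
      have hre : |u.re| ≤ |α| + |β| := by
        rw [abs_le]
        constructor
        · linarith [neg_abs_le α, abs_nonneg β]
        · linarith [le_abs_self β, abs_nonneg α]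
      linarith [Complex.norm_le_abs_re_add_abs_im u]
    have h4 : Real.pi / ‖Complex.cos (Real.pi * u)‖ ≤
        4 * Real.pi * Real.exp (-(Real.pi * |u.im|)) := by
      rw [div_le_iff₀ hpos, Real.exp_neg]
      have : 0 < Real.exp (Real.pi * |u.im|) := Real.exp_pos _
      field_simp
      linarith
    calc _ ≤ (C * Real.exp (ε * |u.im|)) * (4 * Real.pi * Real.exp (-(Real.pi * |u.im|))) := by
          gcongr
      _ = C * (4 * Real.pi) * Real.exp ((ε - Real.pi) * |u.im|) := by
          rw [show (ε - Real.pi) * |u.im| = ε * |u.im| + -(Real.pi * |u.im|) by ring, Real.exp_add]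
          ring
      _ ≤ _ := by
          have : 0 ≤ |M| * Real.exp Real.pi * Real.exp ((ε - Real.pi) * |u.im|) := by positivity
          linarith

/-- At the midpoint of the strip both Gamma arguments acquire the same shift `|p|/2`, since `p⁺ -
p/2 = p⁻ + p/2 = |p|/2`. The first Gamma value at `i` is `g i` and the second is the conjugate of `g
(σ i)`, so the product over all `i` is `|∏ g i|²`; it is nonzero because the arguments have positive
real part. -/
theorem prod_gammaKernel_half_pos {b : Fin n → ℂ} (hb : ∀ i, |(b i).re| < 1 / 2)
    {s : Fin n → ℝ} {p : Fin n → ℤ} {σ : Equiv.Perm (Fin n)}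
    (hσ : ∀ i, s (σ i) = s i ∧ p (σ i) = p i ∧ b (σ i) = -(starRingEnd ℂ) (b i)) :
    0 < ∏ i, gammaKernel (p i) (Complex.I * s i - p i / 2 + b i) := by
  set g : Fin n → ℂ := fun i => Complex.Gamma (1 / 2 + |(p i : ℝ)| / 2 + Complex.I * s i + b i)
    with hg
  have habs : ∀ q : ℤ, ((|(q : ℝ)| : ℝ) : ℂ) = (q.toNat : ℂ) + ((-q).toNat : ℂ) ∧
      (q : ℂ) = (q.toNat : ℂ) - ((-q).toNat : ℂ) := by
    intro q
    have h1 : |q| = (q.toNat : ℤ) + ((-q).toNat : ℤ) := by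
      rcases abs_cases q with h | h <;> omega
    have h2 : q = (q.toNat : ℤ) - ((-q).toNat : ℤ) := by omega
    refine ⟨?_, by exact_mod_cast h2⟩
    rw [← Int.cast_abs, h1]; push_cast; rfl
  have h1 : ∀ i, gammaKernel (p i) (Complex.I * s i - p i / 2 + b i) =
      g i * (starRingEnd ℂ) (g (σ i)) := by
    intro i
    obtain ⟨hs, hp, hbσ⟩ := hσ i
    rw [hg]
    simp only
    rw [← Complex.Gamma_conj, hs, hp, hbσ, gammaKernel]
    congr 2
    · rw [(habs (p i)).1, (habs (p i)).2]; ring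
    · simp only [map_add, map_div₀, map_mul, Complex.conj_ofReal, Complex.conj_I, map_neg,
        Complex.conj_conj, map_one, map_ofNat]
      rw [(habs (p i)).1, (habs (p i)).2]; ring
  rw [Finset.prod_congr rfl fun i _ => h1 i, Finset.prod_mul_distrib,
    Equiv.prod_comp σ fun i => (starRingEnd ℂ) (g i), ← map_prod, Complex.mul_conj]
  have : ∏ i, g i ≠ 0 := Finset.prod_ne_zero_iff.2 fun i _ => by
    refine Complex.Gamma_ne_zero_of_re_pos ?_
    have e : (1 / 2 : ℂ).re = 1 / 2 := by
      rw [show (1 / 2 : ℂ) = ((1 / 2 : ℝ) : ℂ) by push_cast; rfl, Complex.ofReal_re]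
    have e2 : ((|(p i : ℝ)| : ℝ) / 2 : ℂ).re = |(p i : ℝ)| / 2 := by
      rw [show ((|(p i : ℝ)| : ℝ) / 2 : ℂ) = ((|(p i : ℝ)| / 2 : ℝ) : ℂ) by push_cast; rfl,
        Complex.ofReal_re]
    simp only [Complex.add_re, e, e2]
    have := abs_lt.1 (hb i)
    simp
    linarith [abs_nonneg (p i : ℝ)]
  exact_mod_cast Complex.normSq_pos.2 this

end Algebra

/-! ### Translating integrals over `ℝ^d` inside a tube. -/

section Analysis

open MvPolynomial MeasureTheory Set

variable {d n : ℕ}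

theorem integrable_exp_neg_norm {c : ℝ} (hc : 0 < c) :
    Integrable fun x : Fin d → ℝ => Real.exp (-c * ‖x‖) := by
  obtain ⟨C, -, hC⟩ := exists_pow_le_exp (d + 1) zero_le_one hc
  have hI : Integrable fun x : Fin d → ℝ => (1 + ‖x‖) ^ (-((d : ℝ) + 1)) :=
    integrable_one_add_norm (by simp)
  refine (hI.const_mul C).mono' (by fun_prop) (Filter.Eventually.of_forall fun x => ?_)
  have h := hC ‖x‖ (norm_nonneg x)
  have hp : 0 < (‖x‖ + 1) ^ (d + 1) := by positivity
  rw [Real.norm_of_nonneg (Real.exp_pos _).le, neg_mul, Real.exp_neg, Real.rpow_neg (by positivity),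
    add_comm 1 ‖x‖]
  have e : (‖x‖ + 1) ^ ((d : ℝ) + 1) = (‖x‖ + 1) ^ (d + 1) := by
    rw [← Real.rpow_natCast]; push_cast; rfl
  rw [e, ← div_eq_mul_inv, inv_le_comm₀ (by positivity) (by
    by_contra h0
    have hC0 : C ≤ 0 := by
      by_contra h1
      exact h0 (div_pos (not_le.1 h1) hp)
    nlinarith [Real.exp_pos (c * ‖x‖)]), inv_div]
  refine (div_le_iff₀' ?_).2 h
  by_contra h1
  nlinarith [Real.exp_pos (c * ‖x‖), not_lt.1 h1]

theorem ExpDecay.integrable {w : (Fin d → ℝ) → ℂ} (hw : ExpDecay w)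
    (hm : AEStronglyMeasurable w volume) : Integrable w := by
  obtain ⟨C, c, hc, h⟩ := hw
  exact ((integrable_exp_neg_norm hc).const_mul C).mono' hm (Filter.Eventually.of_forall h)

/-- The point `x + w l` of the complexification. -/
def tubePoint (l : Fin d → ℤ) (x : Fin d → ℝ) (w : ℂ) : Fin d → ℂ := fun k => x k + w * l k

theorem tubePoint_add (l : Fin d → ℤ) (x : Fin d → ℝ) (s : ℝ) (w : ℂ) :
    tubePoint l x (s + w) = tubePoint l (x + fun k => s * l k) w := by
  ext k; simp [tubePoint]; ring

theorem tubePoint_zero (l : Fin d → ℤ) (x : Fin d → ℝ) :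
    tubePoint l x 0 = fun k => (x k : ℂ) := by
  ext k; simp [tubePoint]

/-- Exponential decay, uniform on the tube between `0` and `l`. -/
def TubeDecay (l : Fin d → ℤ) (Φ : (Fin d → ℂ) → ℂ) : Prop :=
  ∃ C c : ℝ, 0 < c ∧ ∀ x, ∀ t ∈ Icc (0 : ℝ) 1,
    ‖Φ (tubePoint l x (t * Complex.I))‖ ≤ C * Real.exp (-c * ‖x‖)

/-- Holomorphy at every point of the closed tube between `0` and `l`. -/
def TubeHolo (l : Fin d → ℤ) (Φ : (Fin d → ℂ) → ℂ) : Prop :=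
  ∀ x, ∀ t ∈ Icc (0 : ℝ) 1, DifferentiableAt ℂ Φ (tubePoint l x (t * Complex.I))

theorem TubeHolo.differentiableAt {l : Fin d → ℤ} {Φ : (Fin d → ℂ) → ℂ} (h : TubeHolo l Φ)
    (x : Fin d → ℝ) {w : ℂ} (hw : w.im ∈ Icc (0 : ℝ) 1) : DifferentiableAt ℂ Φ (tubePoint l x w) := by
  rw [← Complex.re_add_im w, tubePoint_add]
  exact h _ _ hw

theorem TubeDecay.expDecay {l : Fin d → ℤ} {Φ : (Fin d → ℂ) → ℂ} (hd : TubeDecay l Φ) {t : ℝ}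
    (ht : t ∈ Icc (0 : ℝ) 1) : ExpDecay fun x => Φ (tubePoint l x (t * Complex.I)) := by
  obtain ⟨C, c, hc, h⟩ := hd
  exact ⟨C, c, hc, fun x => h x t ht⟩

theorem TubeHolo.continuous {l : Fin d → ℤ} {Φ : (Fin d → ℂ) → ℂ} (h : TubeHolo l Φ) {t : ℝ}
    (ht : t ∈ Icc (0 : ℝ) 1) : Continuous fun x => Φ (tubePoint l x (t * Complex.I)) := by
  rw [continuous_iff_continuousAt]
  intro x
  refine ContinuousAt.comp (g := Φ) (h x t ht).continuousAt (Continuous.continuousAt ?_)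
  unfold tubePoint
  fun_prop

theorem TubeHolo.integrable {l : Fin d → ℤ} {Φ : (Fin d → ℂ) → ℂ} (h : TubeHolo l Φ)
    (hd : TubeDecay l Φ) {t : ℝ} (ht : t ∈ Icc (0 : ℝ) 1) :
    Integrable fun x => Φ (tubePoint l x (t * Complex.I)) :=
  (TubeDecay.expDecay hd ht).integrable (h.continuous ht).aestronglyMeasurable

theorem integrable_prod_of_decay {g : (Fin d → ℝ) → ℝ → ℂ} {a b C c : ℝ} (hc : 0 < c)
    (hg : ContinuousOn (Function.uncurry g) (univ ×ˢ Icc a b))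
    (hb : ∀ x, ∀ s ∈ Icc a b, ‖g x s‖ ≤ C * Real.exp (-c * ‖x‖)) :
    Integrable (Function.uncurry g) (volume.prod (volume.restrict (Ioc a b))) := by
  have hI : Integrable (fun z : (Fin d → ℝ) × ℝ => C * Real.exp (-c * ‖z.1‖) * 1)
      (volume.prod (volume.restrict (Ioc a b))) :=
    Integrable.mul_prod ((integrable_exp_neg_norm hc).const_mul C) (integrable_const 1)
  have hr : (volume : Measure (Fin d → ℝ)).prod (volume.restrict (Ioc a b)) =
      (volume.prod volume).restrict (univ ×ˢ Ioc a b) := by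
    rw [← Measure.prod_restrict, Measure.restrict_univ]
  have hmeas : MeasurableSet ((univ : Set (Fin d → ℝ)) ×ˢ Ioc a b) :=
    MeasurableSet.univ.prod measurableSet_Ioc
  refine hI.mono' ?_ ?_
  · rw [hr]
    exact (hg.mono (prod_mono le_rfl Ioc_subset_Icc_self)).aestronglyMeasurable hmeas
  · rw [hr]
    filter_upwards [ae_restrict_mem hmeas] with z hz
    rw [mul_one]
    exact hb z.1 z.2 (Ioc_subset_Icc_self hz.2)

/-- Cauchy's theorem is applied on the bounded rectangle `[0,1] × [0,t]` of the complex line `w ↦ x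
+ wl`, and the result is integrated over `x`. The vertical sides differ by the translation `x ↦ x +
l` and cancel; each horizontal side is an average of translates, whose integral is that of the
function itself. No limit of growing contours and no choice of coordinates adapted to `l` is needed.
-/
theorem integral_tube_shift {l : Fin d → ℤ} {Φ : (Fin d → ℂ) → ℂ} (h : TubeHolo l Φ)
    (hd : TubeDecay l Φ) {t : ℝ} (ht : t ∈ Icc (0 : ℝ) 1) :
    ∫ x : Fin d → ℝ, Φ (fun k => (x k : ℂ)) = ∫ x, Φ (tubePoint l x (t * Complex.I)) := by
  obtain ⟨C, c, hc, hb⟩ := id hd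
  have hcont : ∀ (g : ℝ → ℂ) (a b : ℝ), Continuous g → (∀ s ∈ Icc a b, (g s).im ∈ Icc (0 : ℝ) 1) →
      ContinuousOn (Function.uncurry fun x s => Φ (tubePoint l x (g s))) (univ ×ˢ Icc a b) := by
    intro g a b hg him z hz
    refine ContinuousAt.continuousWithinAt ?_
    refine ContinuousAt.comp (g := Φ) (h.differentiableAt z.1 (him z.2 hz.2)).continuousAt
      (Continuous.continuousAt ?_)
    unfold tubePoint
    fun_prop
  have hv : Integrable (Function.uncurry fun x (s : ℝ) => Φ (tubePoint l x (s * Complex.I)))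
      (volume.prod (volume.restrict (Ioc 0 t))) := by
    refine integrable_prod_of_decay (C := C) hc (hcont (fun s => s * Complex.I) 0 t (by fun_prop) fun s hs => ?_)
      fun x s hs => ?_
    · simpa using ⟨hs.1, hs.2.trans ht.2⟩
    · exact hb x s ⟨hs.1, hs.2.trans ht.2⟩
  -- The real displacement `s l` with `0 ≤ s ≤ 1` changes the norm by at most `‖l‖`, which costs the
  -- constant `e^{c‖l‖}`. The absolute value of `C` spares a proof that `C ≥ 0`.
  have hh : ∀ τ ∈ Icc (0 : ℝ) 1,
      Integrable (Function.uncurry fun x (s : ℝ) => Φ (tubePoint l x (s + τ * Complex.I)))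
        (volume.prod (volume.restrict (Ioc 0 1))) := by
    intro τ hτ
    refine integrable_prod_of_decay (C := |C| * Real.exp (c * ‖fun k => (l k : ℝ)‖)) hc
      (hcont (fun s => s + τ * Complex.I) 0 1 (by fun_prop) fun s hs => by simpa using hτ) fun x s hs => ?_
    rw [tubePoint_add]
    refine (hb _ τ hτ).trans ?_
    have h1 : ‖x‖ ≤ ‖x + fun k => s * (l k : ℝ)‖ + ‖fun k => (l k : ℝ)‖ := by
      have h2 : ‖s • fun k => (l k : ℝ)‖ ≤ 1 * ‖fun k => (l k : ℝ)‖ := by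
        rw [norm_smul, Real.norm_of_nonneg hs.1]
        exact mul_le_mul_of_nonneg_right hs.2 (norm_nonneg _)
      have h3 := norm_sub_le (x + s • fun k => (l k : ℝ)) (s • fun k => (l k : ℝ))
      rw [add_sub_cancel_right] at h3
      have h4 : (s • fun k => (l k : ℝ)) = fun k => s * (l k : ℝ) := rfl
      rw [h4] at h2 h3
      linarith
    rw [mul_assoc, ← Real.exp_add]
    refine mul_le_mul (le_abs_self C) (Real.exp_le_exp.2 ?_) (Real.exp_pos _).le (abs_nonneg _)
    nlinarith
  have hH : ∀ τ ∈ Icc (0 : ℝ) 1,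
      ∫ x, ∫ s in (0 : ℝ)..1, Φ (tubePoint l x (s + τ * Complex.I)) =
        ∫ x, Φ (tubePoint l x (τ * Complex.I)) := by
    intro τ hτ
    simp only [intervalIntegral.integral_of_le zero_le_one]
    rw [integral_integral_swap (hh τ hτ)]
    have : ∀ s : ℝ, ∫ x, Φ (tubePoint l x (s + τ * Complex.I)) =
        ∫ x, Φ (tubePoint l x (τ * Complex.I)) := by
      intro s
      simp only [tubePoint_add]
      exact integral_add_right_eq_self (fun x => Φ (tubePoint l x (τ * Complex.I))) _
    simp [this]
  set B : (Fin d → ℝ) → ℂ := fun x => ∫ s in (0 : ℝ)..1, Φ (tubePoint l x (s + (0 : ℝ) * Complex.I))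
    with hB
  set T : (Fin d → ℝ) → ℂ := fun x => ∫ s in (0 : ℝ)..1, Φ (tubePoint l x (s + t * Complex.I))
    with hT
  set V : (Fin d → ℝ) → ℂ := fun x => ∫ s in (0 : ℝ)..t, Φ (tubePoint l x (s * Complex.I)) with hV
  have hBi : Integrable B := by
    have := (hh 0 ⟨le_rfl, zero_le_one⟩).integral_prod_left
    simpa only [hB, intervalIntegral.integral_of_le zero_le_one,
      Function.uncurry_apply_pair] using this
  have hTi : Integrable T := by
    have := (hh t ht).integral_prod_left
    simpa only [hT, intervalIntegral.integral_of_le zero_le_one,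
      Function.uncurry_apply_pair] using this
  have hVi : Integrable V := by
    have := hv.integral_prod_left
    simpa only [hV, intervalIntegral.integral_of_le ht.1, Function.uncurry_apply_pair] using this
  -- Bottom minus top side equals `i` times left minus right side.
  have hrect : ∀ x, B x - T x = Complex.I * (V x - V (x + fun k => (l k : ℝ))) := by
    intro x
    have key := Complex.integral_boundary_rect_eq_zero_of_differentiableOn
      (fun w => Φ (tubePoint l x w)) 0 (1 + t * Complex.I) (by
        intro w hw
        refine DifferentiableAt.differentiableWithinAt ?_
        have hw2 : w.im ∈ Icc (0 : ℝ) 1 := by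
          have := hw.2
          simp only [mem_preimage, Complex.zero_im, Complex.add_im, Complex.one_im, Complex.mul_im,
            Complex.ofReal_re, Complex.I_im, mul_one, Complex.ofReal_im, Complex.I_re, mul_zero,
            add_zero, zero_add, uIcc_of_le ht.1] at this
          exact ⟨this.1, this.2.trans ht.2⟩
        refine DifferentiableAt.comp (g := Φ) w (h.differentiableAt x hw2) ?_
        unfold tubePoint
        fun_prop)
    have hV1 : V (x + fun k => (l k : ℝ)) =
        ∫ s in (0 : ℝ)..t, Φ (tubePoint l x (1 + s * Complex.I)) := by
      rw [hV]
      simp only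
      refine intervalIntegral.integral_congr fun s _ => ?_
      have := tubePoint_add l x 1 (s * Complex.I)
      simp only [Complex.ofReal_one, one_mul] at this
      simp only [this]
    rw [hV1]
    simp only [Complex.zero_re, Complex.zero_im, Complex.add_re, Complex.add_im, Complex.one_re,
      Complex.one_im, Complex.mul_re, Complex.mul_im, Complex.ofReal_re, Complex.ofReal_im,
      Complex.I_re, Complex.I_im, mul_zero, mul_one, zero_mul, sub_zero, add_zero, zero_add,
      Complex.ofReal_one, smul_eq_mul, Complex.ofReal_zero] at key
    rw [hB, hT, hV]
    simp only [Complex.ofReal_zero, zero_mul, add_zero]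
    linear_combination key
  have hVt : ∫ x, V (x + fun k => (l k : ℝ)) = ∫ x, V x := integral_add_right_eq_self V _
  have hsub : ∫ x, (B x - T x) = 0 := by
    simp only [hrect]
    rw [integral_const_mul, integral_sub hVi (hVi.comp_add_right _), hVt, sub_self, mul_zero]
  rw [integral_sub hBi hTi, sub_eq_zero] at hsub
  have h0 := hH 0 ⟨le_rfl, zero_le_one⟩
  rw [hB, hT] at hsub
  simp only at hsub
  rw [h0, hH t ht] at hsub
  simpa [tubePoint_zero] using hsub

/-! ### Moments, density of polynomials, and positivity from squares. -/

theorem exists_norm_eval_le_exp {𝕜 : Type*} [NormedField 𝕜] (p : MvPolynomial (Fin d) 𝕜) :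
    ∀ ε : ℝ, 0 < ε → ∃ C : ℝ, 0 ≤ C ∧ ∀ z : Fin d → 𝕜, ‖eval z p‖ ≤ C * Real.exp (ε * ‖z‖) := by
  induction p using MvPolynomial.induction_on with
  | C a =>
    intro ε hε
    refine ⟨‖a‖, norm_nonneg _, fun z => ?_⟩
    rw [eval_C]
    exact le_mul_of_one_le_right (norm_nonneg _) (Real.one_le_exp (by positivity))
  | add p q hp hq =>
    intro ε hε
    obtain ⟨C, hC, h⟩ := hp ε hε
    obtain ⟨C', hC', h'⟩ := hq ε hε
    refine ⟨C + C', by positivity, fun z => ?_⟩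
    rw [map_add, add_mul]
    exact (norm_add_le _ _).trans (add_le_add (h z) (h' z))
  | mul_X p k hp =>
    intro ε hε
    obtain ⟨C, hC, h⟩ := hp (ε / 2) (by positivity)
    obtain ⟨C', hC', h'⟩ := exists_pow_le_exp 1 le_rfl (half_pos hε)
    refine ⟨C * C', by positivity, fun z => ?_⟩
    have h1 := h' ‖z‖ (norm_nonneg z)
    rw [add_zero, pow_one] at h1
    rw [map_mul, eval_X, norm_mul]
    calc ‖eval z p‖ * ‖z k‖ ≤ (C * Real.exp (ε / 2 * ‖z‖)) * (C' * Real.exp (ε / 2 * ‖z‖)) :=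
          mul_le_mul (h z) ((norm_le_pi_norm z k).trans h1) (norm_nonneg _) (by positivity)
      _ = C * C' * Real.exp (ε * ‖z‖) := by
          rw [show ε * ‖z‖ = ε / 2 * ‖z‖ + ε / 2 * ‖z‖ by ring, Real.exp_add]; ring

section Moments

variable {X : Type*} [MeasurableSpace X] {μ : Measure X} {G : X → ℂ} {Y : X → ℝ} {ε : ℝ}

/-- The series of `e^{iτY}` may be integrated termwise. Of the available `e^{ε|Y|}`, one half
dominates the series and the other half dominates `|Y|^k`. -/
theorem integral_exp_mul_pow_eq_zero_of_small (hε : 0 < ε) (hY : Measurable Y)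
    (hGm : AEStronglyMeasurable G μ) (hG : Integrable (fun x => ‖G x‖ * Real.exp (ε * |Y x|)) μ)
    (h : ∀ k : ℕ, ∫ x, G x * (Y x : ℂ) ^ k ∂μ = 0) {τ : ℝ} (hτ : |τ| ≤ ε / 2) (k : ℕ) :
    ∫ x, G x * Complex.exp (τ * Y x * Complex.I) * (Y x : ℂ) ^ k ∂μ = 0 := by
  obtain ⟨C, hC, hC'⟩ := exists_pow_le_exp k le_rfl (half_pos hε)
  have hsum : ∀ x, HasSum (fun j : ℕ => ‖G x‖ * |Y x| ^ k * ((|τ| * |Y x|) ^ j / j.factorial))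
      (‖G x‖ * |Y x| ^ k * Real.exp (|τ| * |Y x|)) := by
    intro x
    rw [Real.exp_eq_exp_ℝ]
    exact (NormedSpace.expSeries_div_hasSum_exp (|τ| * |Y x|)).mul_left _
  have hexpC : ∀ z : ℂ, HasSum (fun j : ℕ => z ^ j / (j.factorial : ℂ)) (Complex.exp z) := by
    intro z
    rw [Complex.exp_eq_exp_ℂ]
    exact NormedSpace.expSeries_div_hasSum_exp z
  have key := hasSum_integral_of_dominated_convergence (μ := μ)
    (F := fun (j : ℕ) x => G x * (Y x : ℂ) ^ k * ((τ * Y x * Complex.I) ^ j / j.factorial))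
    (f := fun x => G x * Complex.exp (τ * Y x * Complex.I) * (Y x : ℂ) ^ k)
    (fun j x => ‖G x‖ * |Y x| ^ k * ((|τ| * |Y x|) ^ j / j.factorial))
    (fun j => by
      have : Measurable fun x => (Y x : ℂ) ^ k * ((τ * Y x * Complex.I) ^ j / j.factorial) := by
        fun_prop
      refine (hGm.mul this.aestronglyMeasurable).congr (Filter.Eventually.of_forall fun x => ?_)
      simp only [Pi.mul_apply]
      ring)
    (fun j => Filter.Eventually.of_forall fun x => by
      simp [norm_pow])
    (Filter.Eventually.of_forall fun x => (hsum x).summable)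
    (by
      simp only [fun x => (hsum x).tsum_eq]
      refine (hG.const_mul C).mono' ?_ (Filter.Eventually.of_forall fun x => ?_)
      · have : Measurable fun x => |Y x| ^ k * Real.exp (|τ| * |Y x|) := by
          fun_prop
        refine (hGm.norm.mul this.aestronglyMeasurable).congr
          (Filter.Eventually.of_forall fun x => ?_)
        simp only [Pi.mul_apply]
        ring
      · rw [Real.norm_of_nonneg (by positivity)]
        have h1 := hC' |Y x| (abs_nonneg _)
        rw [add_zero] at h1
        calc ‖G x‖ * |Y x| ^ k * Real.exp (|τ| * |Y x|)
            ≤ ‖G x‖ * (C * Real.exp (ε / 2 * |Y x|)) * Real.exp (ε / 2 * |Y x|) := by gcongr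
          _ = C * (‖G x‖ * Real.exp (ε * |Y x|)) := by
              rw [show ε * |Y x| = ε / 2 * |Y x| + ε / 2 * |Y x| by ring, Real.exp_add]; ring)
    (Filter.Eventually.of_forall fun x => by
      rw [mul_right_comm (G x)]
      exact (hexpC _).mul_left _)
  have hz : ∀ j : ℕ, ∫ x, G x * (Y x : ℂ) ^ k * ((τ * Y x * Complex.I) ^ j / j.factorial) ∂μ = 0 := by
    intro j
    have : ∀ x, G x * (Y x : ℂ) ^ k * ((τ * Y x * Complex.I) ^ j / j.factorial) =
        (τ * Complex.I) ^ j / j.factorial * (G x * (Y x : ℂ) ^ (k + j)) := by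
      intro x; rw [pow_add]; ring
    simp only [this]
    rw [integral_const_mul, h, mul_zero]
  simp only [hz] at key
  exact key.unique hasSum_zero

/-- Multiplying `G` by a unimodular exponential preserves the integrability hypothesis with the same
`ε`. Hence the small step repeats, and `N` steps of length `τ/N` reach any `τ`. -/
theorem integral_exp_eq_zero_of_moments (hε : 0 < ε) (hY : Measurable Y)
    (hGm : AEStronglyMeasurable G μ) (hG : Integrable (fun x => ‖G x‖ * Real.exp (ε * |Y x|)) μ)
    (h : ∀ k : ℕ, ∫ x, G x * (Y x : ℂ) ^ k ∂μ = 0) (τ : ℝ) :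
    ∫ x, G x * Complex.exp (τ * Y x * Complex.I) ∂μ = 0 := by
  have hN : ∀ (τ : ℝ), |τ| ≤ ε / 2 → ∀ N k : ℕ,
      ∫ x, G x * Complex.exp (((N * τ : ℝ) : ℂ) * Y x * Complex.I) * (Y x : ℂ) ^ k ∂μ = 0 := by
    intro τ hτ N
    induction N with
    | zero => simpa using h
    | succ N ih =>
      intro k
      have := integral_exp_mul_pow_eq_zero_of_small (μ := μ) (Y := Y)
        (G := fun x => G x * Complex.exp (((N * τ : ℝ) : ℂ) * Y x * Complex.I)) hε hY
        (hGm.mul (by fun_prop)) (by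
          have e : ∀ x, ‖Complex.exp (((N * τ : ℝ) : ℂ) * Y x * Complex.I)‖ = 1 := by
            intro x
            rw [← Complex.ofReal_mul, Complex.norm_exp_ofReal_mul_I]
          simpa only [norm_mul, e, mul_one] using hG) ih hτ k
      rw [← this]
      congr 1
      ext x
      have e : ((((N + 1 : ℕ) : ℝ) * τ : ℝ) : ℂ) * Y x * Complex.I =
          ((N * τ : ℝ) : ℂ) * Y x * Complex.I + τ * Y x * Complex.I := by
        push_cast; ring
      rw [e, Complex.exp_add]
      ring
  obtain ⟨N, hN'⟩ := exists_nat_gt (|τ| / (ε / 2))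
  have hN0 : (0 : ℝ) < N := lt_of_le_of_lt (by positivity) hN'
  have := hN (τ / N) (by
    rw [abs_div, Nat.abs_cast, div_le_iff₀ hN0]
    rw [div_lt_iff₀ (by positivity)] at hN'
    linarith) N 0
  rw [mul_div_cancel₀ _ hN0.ne'] at this
  simpa using this

end Moments

/-- The finite measure `e^{-c‖x‖} dx`. -/
def expMeasure (d : ℕ) (c : ℝ) : Measure (Fin d → ℝ) :=
  volume.withDensity fun x => ((Real.exp (-c * ‖x‖)).toNNReal : ENNReal)

theorem measurable_expDensity (c : ℝ) :
    Measurable fun x : Fin d → ℝ => (Real.exp (-c * ‖x‖)).toNNReal := by fun_prop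

theorem integral_expMeasure {E : Type*} [NormedAddCommGroup E] [NormedSpace ℝ E] (c : ℝ)
    (g : (Fin d → ℝ) → E) :
    ∫ x, g x ∂expMeasure d c = ∫ x, Real.exp (-c * ‖x‖) • g x := by
  unfold expMeasure
  rw [integral_withDensity_eq_integral_smul (measurable_expDensity c)]
  simp [NNReal.smul_def, Real.coe_toNNReal _ (Real.exp_pos _).le]

theorem integrable_expMeasure {E : Type*} [NormedAddCommGroup E] [NormedSpace ℝ E] {c : ℝ}
    {g : (Fin d → ℝ) → E} :
    Integrable g (expMeasure d c) ↔ Integrable fun x => Real.exp (-c * ‖x‖) • g x := by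
  unfold expMeasure
  rw [integrable_withDensity_iff_integrable_smul (measurable_expDensity c)]
  simp [NNReal.smul_def, Real.coe_toNNReal _ (Real.exp_pos _).le]

theorem memLp_two_expMeasure {c C : ℝ} (hc : 0 < c) {g : (Fin d → ℝ) → ℝ} (hg : Continuous g)
    (hb : ∀ x, |g x| ≤ C * Real.exp (c / 4 * ‖x‖)) : MemLp g 2 (expMeasure d c) := by
  rw [memLp_two_iff_integrable_sq hg.aestronglyMeasurable, integrable_expMeasure]
  refine ((integrable_exp_neg_norm (half_pos hc)).const_mul (C ^ 2)).mono'
    (by fun_prop) (Filter.Eventually.of_forall fun x => ?_)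
  rw [smul_eq_mul, Real.norm_of_nonneg (by positivity), ← sq_abs]
  calc Real.exp (-c * ‖x‖) * |g x| ^ 2
      ≤ Real.exp (-c * ‖x‖) * (C * Real.exp (c / 4 * ‖x‖)) ^ 2 := by
        gcongr; exact hb x
    _ = C ^ 2 * Real.exp (-(c / 2) * ‖x‖) := by
        rw [mul_pow, ← Real.exp_nat_mul, mul_left_comm, ← Real.exp_add]
        congr 2; push_cast; ring

theorem isFiniteMeasure_expMeasure {c : ℝ} (hc : 0 < c) : IsFiniteMeasure (expMeasure d c) := by
  have : Integrable (fun _ : Fin d → ℝ => (1 : ℝ)) (expMeasure d c) := by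
    rw [integrable_expMeasure]
    simpa using integrable_exp_neg_norm hc
  exact (integrable_const_iff_isFiniteMeasure one_ne_zero).1 this

theorem dual_apply_eq_sum (f : StrongDual ℝ (Fin d → ℝ)) (p : Fin d → ℝ) :
    f p = ∑ k, p k * f (Pi.single k 1) := by
  conv_lhs => rw [← Finset.univ_sum_single p, map_sum]
  refine Finset.sum_congr rfl fun k _ => ?_
  rw [← smul_eq_mul, ← map_smul]
  congr 1
  ext j
  rcases eq_or_ne j k with rfl | hj
  · simp
  · simp [hj]

/-- The moments along every linear form `L` vanish, hence so does the Fourier transform of `h dν`.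
The positive and negative parts of `h` are then densities of finite measures with the same
characteristic function, so they agree. -/
theorem ae_eq_zero_of_moments {c : ℝ} (hc : 0 < c) {h : (Fin d → ℝ) → ℝ}
    (hh : MemLp h 2 (expMeasure d c))
    (hp : ∀ p : MvPolynomial (Fin d) ℝ, ∫ x, h x * eval x p ∂expMeasure d c = 0) :
    h =ᵐ[expMeasure d c] 0 := by
  have := isFiniteMeasure_expMeasure (d := d) hc
  set ν := expMeasure d c with hν
  have hint : Integrable h ν := hh.integrable one_le_two
  have hchar : ∀ L : StrongDual ℝ (Fin d → ℝ),
      ∫ x, (h x : ℂ) * Complex.exp (L x * Complex.I) ∂ν = 0 := by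
    intro L
    -- With this bound `e^{ε|L|}` lies in `L²(ν)`, so its product with `h` is integrable.
    obtain ⟨ε, hε, hεL⟩ : ∃ ε : ℝ, 0 < ε ∧ ε * ‖L‖ ≤ c / 4 := by
      refine ⟨c / 4 / (‖L‖ + 1), by positivity, ?_⟩
      rw [div_mul_eq_mul_div, div_le_iff₀ (by positivity)]
      nlinarith [norm_nonneg L]
    have hE : MemLp (fun x => Real.exp (ε * |L x|)) 2 ν := by
      refine memLp_two_expMeasure (C := 1) hc (by fun_prop) fun x => ?_
      rw [abs_of_pos (Real.exp_pos _), one_mul]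
      refine Real.exp_le_exp.2 ?_
      have h1 := L.le_opNorm x
      rw [Real.norm_eq_abs] at h1
      calc ε * |L x| ≤ ε * (‖L‖ * ‖x‖) := by gcongr
        _ = ε * ‖L‖ * ‖x‖ := by ring
        _ ≤ _ := by gcongr
    have hpoly : ∃ q : MvPolynomial (Fin d) ℝ, ∀ x, eval x q = L x := by
      refine ⟨∑ k, C (L (Pi.single k 1)) * X k, fun x => ?_⟩
      rw [dual_apply_eq_sum L x]
      simp [mul_comm]
    obtain ⟨q, hq⟩ := hpoly
    have := integral_exp_eq_zero_of_moments (μ := ν) (G := fun x => (h x : ℂ)) (Y := fun x => L x)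
      hε (by fun_prop) (by
        exact (Complex.continuous_ofReal.comp_aestronglyMeasurable hint.aestronglyMeasurable)) (by
        simp only [Complex.norm_real]
        exact hh.norm.integrable_mul hE) (fun k => by
        have h1 := hp (q ^ k)
        have h2 : ∀ x, (h x : ℂ) * ((L x : ℝ) : ℂ) ^ k = ((h x * eval x (q ^ k) : ℝ) : ℂ) := by
          intro x; rw [map_pow, hq]; push_cast; rfl
        simp only [h2]
        rw [integral_complex_ofReal, h1, Complex.ofReal_zero]) 1
    simpa using this
  have hfin : ∀ g : (Fin d → ℝ) → ℝ, Integrable g ν →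
      IsFiniteMeasure (ν.withDensity fun x => ENNReal.ofReal (g x)) := fun g hg =>
    isFiniteMeasure_withDensity_ofReal hg.2
  have := hfin h hint
  have := hfin _ hint.neg
  have hchar' : ∀ (g : (Fin d → ℝ) → ℝ), Integrable g ν → ∀ L : StrongDual ℝ (Fin d → ℝ),
      charFunDual (ν.withDensity fun x => ENNReal.ofReal (g x)) L =
        ∫ x, ((max (g x) 0 : ℝ) : ℂ) * Complex.exp (L x * Complex.I) ∂ν := by
    intro g hg L
    rw [charFunDual_apply, integral_withDensity_eq_integral_toReal_smul₀]
    · refine integral_congr_ae (Filter.Eventually.of_forall fun x => ?_)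
      simp only [ENNReal.toReal_ofReal', Complex.real_smul]
    · exact hg.aemeasurable.ennreal_ofReal
    · exact Filter.Eventually.of_forall fun x => ENNReal.ofReal_lt_top
  have hexp : ∀ (g : (Fin d → ℝ) → ℝ), Integrable g ν → ∀ L : StrongDual ℝ (Fin d → ℝ),
      Integrable (fun x => ((max (g x) 0 : ℝ) : ℂ) * Complex.exp (L x * Complex.I)) ν := by
    intro g hg L
    refine hg.pos_part.ofReal.mul_bdd (c := 1) (by fun_prop)
      (Filter.Eventually.of_forall fun x => ?_)
    rw [Complex.norm_exp_ofReal_mul_I]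
  -- `ENNReal.ofReal` truncates at zero: the two densities are the positive and negative parts of
  -- `h`.
  have heq : (ν.withDensity fun x => ENNReal.ofReal (h x)) =
      ν.withDensity fun x => ENNReal.ofReal ((-h) x) := by
    refine Measure.ext_of_charFunDual (funext fun L => ?_)
    rw [hchar' h hint, hchar' _ hint.neg, ← sub_eq_zero,
      ← integral_sub (hexp h hint L) (hexp _ hint.neg L), ← hchar L]
    refine integral_congr_ae (Filter.Eventually.of_forall fun x => ?_)
    simp only [Pi.neg_apply]
    rw [← sub_mul, ← Complex.ofReal_sub]
    congr 2
    rcases le_total (h x) 0 with h0 | h0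
    · rw [max_eq_right h0, max_eq_left (by linarith)]; ring
    · rw [max_eq_left h0, max_eq_right (by linarith)]; ring
  have hae := (withDensity_eq_iff hint.aemeasurable.ennreal_ofReal
    hint.neg.aemeasurable.ennreal_ofReal (by
      have h1 := hint.2
      rw [hasFiniteIntegral_iff_norm] at h1
      refine (lt_of_le_of_lt (lintegral_mono fun x => ?_) h1).ne
      exact ENNReal.ofReal_le_ofReal (Real.le_norm_self _))).1 heq
  filter_upwards [hae] with x hx
  simp only [Pi.neg_apply] at hx
  rcases le_total (h x) 0 with h0 | h0
  · rw [ENNReal.ofReal_of_nonpos h0] at hx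
    have := ENNReal.ofReal_eq_zero.1 hx.symm
    exact le_antisymm h0 (by simpa using this)
  · rw [ENNReal.ofReal_of_nonpos (by linarith : -h x ≤ 0)] at hx
    exact le_antisymm (ENNReal.ofReal_eq_zero.1 hx) h0

theorem memLp_eval {c : ℝ} (hc : 0 < c) (p : MvPolynomial (Fin d) ℝ) :
    MemLp (fun x => eval x p) 2 (expMeasure d c) := by
  obtain ⟨C, -, hC⟩ := exists_norm_eval_le_exp p (c / 4) (by positivity)
  exact memLp_two_expMeasure hc (MvPolynomial.continuous_eval p) hC

/-- Polynomial functions as elements of `L²(e^{-c‖x‖} dx)`. -/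
def evalLp {c : ℝ} (hc : 0 < c) : MvPolynomial (Fin d) ℝ →ₗ[ℝ] Lp ℝ 2 (expMeasure d c) where
  toFun p := (memLp_eval hc p).toLp _
  map_add' p q := by
    rw [← MemLp.toLp_add]
    congr 1
    ext x
    simp
  map_smul' r p := by
    rw [RingHom.id_apply, ← MemLp.toLp_const_smul]
    congr 1
    ext x
    simp [MvPolynomial.smul_eval]

/-- A vector orthogonal to all polynomials has vanishing moments and is zero by
`ae_eq_zero_of_moments`, so the polynomials are dense in the Hilbert space. -/
theorem exists_polynomial_approx {c : ℝ} (hc : 0 < c) {h : (Fin d → ℝ) → ℝ}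
    (hh : MemLp h 2 (expMeasure d c)) {η : ℝ} (hη : 0 < η) :
    ∃ p : MvPolynomial (Fin d) ℝ, ∫ x, (eval x p - h x) ^ 2 ∂expMeasure d c < η := by
  have hK : (LinearMap.range (evalLp (d := d) hc)).topologicalClosure = ⊤ := by
    rw [Submodule.topologicalClosure_eq_top_iff, Submodule.eq_bot_iff]
    intro f hf
    have h0 : (f : (Fin d → ℝ) → ℝ) =ᵐ[expMeasure d c] 0 := by
      refine ae_eq_zero_of_moments hc (Lp.memLp f) fun p => ?_
      have h1 := (Submodule.mem_orthogonal' _ _).1 hf (evalLp hc p) ⟨p, rfl⟩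
      rw [L2.inner_def] at h1
      rw [← h1]
      refine integral_congr_ae ?_
      filter_upwards [(memLp_eval hc p).coeFn_toLp] with x hx
      change _ = inner ℝ (f x) (((memLp_eval hc p).toLp _ : Lp ℝ 2 (expMeasure d c)) x)
      rw [hx]
      simp [mul_comm]
    exact (Lp.eq_zero_iff_ae_eq_zero).2 h0
  have hmem : hh.toLp h ∈ closure (LinearMap.range (evalLp (d := d) hc) : Set (Lp ℝ 2 _)) := by
    rw [← Submodule.topologicalClosure_coe, hK]
    trivial
  obtain ⟨_, ⟨p, rfl⟩, hp⟩ := Metric.mem_closure_iff.1 hmem (Real.sqrt η) (Real.sqrt_pos.2 hη)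
  refine ⟨p, ?_⟩
  rw [dist_comm, dist_eq_norm] at hp
  change ‖(memLp_eval hc p).toLp _ - hh.toLp h‖ < _ at hp
  rw [← MemLp.toLp_sub] at hp
  have h2 : ‖((memLp_eval hc p).sub hh).toLp _‖ ^ 2 =
      ∫ x, (eval x p - h x) ^ 2 ∂expMeasure d c := by
    rw [← real_inner_self_eq_norm_sq, L2.inner_def]
    refine integral_congr_ae ?_
    filter_upwards [((memLp_eval hc p).sub hh).coeFn_toLp] with x hx
    rw [hx]
    simp [sq]
  rw [← h2]
  calc _ < Real.sqrt η ^ 2 := by gcongr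
    _ = η := Real.sq_sqrt hη.le

/-- Approximating the indicator `h` of `{W < 0}` by polynomials in `L²(e^{-c‖x‖}dx)` passes the
hypothesis to `h`. Then minus the integral of the negative part of `W` is nonnegative, which
continuity forbids unless that part is zero. -/
theorem nonneg_of_integral_sq_mul_nonneg {W : (Fin d → ℝ) → ℝ} (hW : Continuous W) {C c : ℝ}
    (hc : 0 < c) (hdec : ∀ x, |W x| ≤ C * Real.exp (-c * ‖x‖))
    (hpos : ∀ p : MvPolynomial (Fin d) ℝ, 0 ≤ ∫ x, eval x p ^ 2 * W x) (x : Fin d → ℝ) :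
    0 ≤ W x := by
  have := isFiniteMeasure_expMeasure (d := d) hc
  set ν := expMeasure d c with hν
  set V : (Fin d → ℝ) → ℝ := fun x => Real.exp (c * ‖x‖) * W x with hV
  have hVc : Continuous V := by fun_prop
  have hVW : ∀ x, Real.exp (-c * ‖x‖) * V x = W x := by
    intro x
    rw [hV]
    simp only
    rw [← mul_assoc, ← Real.exp_add]
    simp
  have hVb : ∀ x, |V x| ≤ C := by
    intro x
    rw [hV]
    simp only
    rw [abs_mul, abs_of_pos (Real.exp_pos _)]
    calc _ ≤ Real.exp (c * ‖x‖) * (C * Real.exp (-c * ‖x‖)) := by gcongr; exact hdec x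
      _ = C := by rw [mul_left_comm, ← Real.exp_add]; simp
  have hC : 0 ≤ C := (abs_nonneg _).trans (hVb 0)
  have hpos' : ∀ p : MvPolynomial (Fin d) ℝ, 0 ≤ ∫ x, eval x p ^ 2 * V x ∂ν := by
    intro p
    rw [hν, integral_expMeasure]
    refine (hpos p).trans_eq (integral_congr_ae (Filter.Eventually.of_forall fun x => ?_))
    simp only [smul_eq_mul]
    rw [← hVW x]; ring
  set S : Set (Fin d → ℝ) := {x | V x < 0} with hS
  have hSo : IsOpen S := isOpen_lt hVc continuous_const
  set h : (Fin d → ℝ) → ℝ := S.indicator 1 with hh_def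
  have hh : MemLp h 2 ν := memLp_indicator_const 2 hSo.measurableSet 1 (Or.inr (measure_ne_top _ _))
  have hVint : ∀ g : (Fin d → ℝ) → ℝ, Integrable g ν → Integrable (fun x => g x * V x) ν := by
    intro g hg
    exact hg.mul_bdd (c := C) hVc.aestronglyMeasurable (Filter.Eventually.of_forall hVb)
  have hhint := hh.integrable_sq
  have hlim : ∀ δ : ℝ, 0 < δ →
      0 ≤ ∫ x, h x ^ 2 * V x ∂ν + δ * (C * ∫ x, h x ^ 2 ∂ν + 1) := by
    intro δ hδ
    -- With `e = p - h`, the bound `2|he| ≤ δh² + e²/δ` gives an error `C(1 + 1/δ)∫e²`; this `η`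
    -- keeps it below `δ`. The added `1` keeps the denominator positive when `C = 0`.
    obtain ⟨p, hp⟩ := exists_polynomial_approx hc hh
      (η := δ / (C * (1 + 1 / δ) + 1)) (by positivity)
    have hpi := (memLp_eval hc p).integrable_sq
    have hei := ((memLp_eval hc p).sub hh).integrable_sq
    simp only [Pi.sub_apply] at hei
    have hA : Integrable (fun x => δ * C * h x ^ 2 +
        C * (1 + 1 / δ) * (eval x p - h x) ^ 2) ν := (hhint.const_mul _).add (hei.const_mul _)
    have hle : ∫ x, eval x p ^ 2 * V x ∂ν ≤ ∫ x, (h x ^ 2 * V x + (δ * C * h x ^ 2 +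
        C * (1 + 1 / δ) * (eval x p - h x) ^ 2)) ∂ν := by
      refine integral_mono (hVint _ hpi) ((hVint _ hhint).add hA) fun x => ?_
      simp only
      set e := eval x p - h x with he
      have hx : eval x p = h x + e := by rw [he]; ring
      rw [hx]
      have h1 : (2 * (h x * e) + e ^ 2) * V x ≤ |2 * (h x * e) + e ^ 2| * C :=
        (le_abs_self _).trans (by rw [abs_mul]; gcongr; exact hVb x)
      have h2 : |2 * (h x * e) + e ^ 2| ≤ δ * h x ^ 2 + (1 + 1 / δ) * e ^ 2 := by
        have h3 : δ * h x ^ 2 + 1 / δ * e ^ 2 - 2 * (h x * e) = (δ * h x - e) ^ 2 / δ := by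
          field_simp; ring
        have h4 : δ * h x ^ 2 + 1 / δ * e ^ 2 + 2 * (h x * e) = (δ * h x + e) ^ 2 / δ := by
          field_simp; ring
        have h5 : 0 ≤ (δ * h x - e) ^ 2 / δ := by positivity
        have h6 : 0 ≤ (δ * h x + e) ^ 2 / δ := by positivity
        rw [abs_le]
        constructor <;> nlinarith [sq_nonneg e]
      nlinarith
    rw [integral_add (hVint _ hhint) hA,
      integral_add (hhint.const_mul _) (hei.const_mul _), integral_const_mul,
      integral_const_mul] at hle
    rw [lt_div_iff₀ (by positivity)] at hp
    have h7 : 0 ≤ ∫ x, (eval x p - h x) ^ 2 ∂ν := integral_nonneg fun x => sq_nonneg _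
    nlinarith [hpos' p]
  have hneg : 0 ≤ ∫ x, h x ^ 2 * V x ∂ν := by
    have hk : 0 < C * ∫ x, h x ^ 2 ∂ν + 1 := by
      have : 0 ≤ ∫ x, h x ^ 2 ∂ν := integral_nonneg fun x => sq_nonneg _
      positivity
    refine le_of_forall_pos_le_add fun ε hε => ?_
    have := hlim (ε / (C * ∫ x, h x ^ 2 ∂ν + 1)) (by positivity)
    rwa [div_mul_cancel₀ _ hk.ne'] at this
  by_contra hx
  have hxV : x ∈ S := by
    exact mul_neg_of_pos_of_neg (Real.exp_pos _) (not_le.1 hx)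
  rw [hν, integral_expMeasure] at hneg
  have hfun : ∀ y, Real.exp (-c * ‖y‖) • (h y ^ 2 * V y) = -max (-W y) 0 := by
    intro y
    rw [smul_eq_mul, mul_left_comm, hVW]
    by_cases hy : y ∈ S
    · have : W y < 0 := by
        rw [← hVW]; exact mul_neg_of_pos_of_neg (Real.exp_pos _) hy
      rw [hh_def, indicator_of_mem hy, max_eq_left (by linarith)]
      simp
    · have : 0 ≤ W y := by
        rw [← hVW]; exact mul_nonneg (Real.exp_pos _).le (not_lt.1 hy)
      rw [hh_def, indicator_of_notMem hy, max_eq_right (by linarith)]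
      simp
  simp only [hfun] at hneg
  rw [integral_neg] at hneg
  have hcont : Continuous fun y => max (-W y) 0 := by fun_prop
  have hint : Integrable fun y => max (-W y) 0 := by
    refine ((integrable_exp_neg_norm hc).const_mul C).mono' hcont.aestronglyMeasurable
      (Filter.Eventually.of_forall fun y => ?_)
    rw [Real.norm_of_nonneg (le_max_right _ _)]
    refine (max_le ?_ (abs_nonneg (W y))).trans (hdec y)
    exact neg_le_abs _
  have hp : 0 < ∫ y, max (-W y) 0 := by
    rw [integral_pos_iff_support_of_nonneg (f := fun y => max (-W y) 0) (fun y => le_max_right _ _) hint]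
    refine IsOpen.measure_pos volume (hcont.isOpen_support) ⟨x, ?_⟩
    rw [Function.mem_support]
    have : 0 < -W x := by linarith [not_le.1 hx]
    exact (lt_max_of_lt_left this).ne'
  linarith

/-! ### Holomorphic extension of the weight and its values at the shifts `il` and `il/2`. -/

/-- The value of a Laurent polynomial at a complex point. -/
def laurentEval (Q : Laurent d) (y : Fin d → ℂ) : ℂ := Q.sum fun a c => c * ∏ k, y k ^ (a k)

theorem laurentFun_eq_laurentEval (Q : Laurent d) (y : Fin d → ℝ) :
    laurentFun Q y = laurentEval Q fun k => (y k : ℂ) := rfl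

/-- The exponential growth rate of the monomial weight with exponent `m` along `x`. -/
def growth (ξ : Fin n → Fin d → ℤ) (ζ : Fin d → ℝ) (m : Fin d → ℤ) (x : Fin d → ℝ) : ℝ :=
  2 * Real.pi * ∑ k, ((m k : ℝ) + ζ k) * x k - 2 * Real.pi * ∑ i, pairReal (ξ i) x -
    Real.pi * ∑ i, |pairReal (ξ i) x|

/-- The monomial weight with exponent `m` decays exponentially. -/
def DecayExponent (ξ : Fin n → Fin d → ℤ) (ζ : Fin d → ℝ) (m : Fin d → ℤ) : Prop :=
  ∃ c : ℝ, 0 < c ∧ ∀ x, growth ξ ζ m x ≤ -c * ‖x‖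

theorem exists_uniform_decay {ξ : Fin n → Fin d → ℤ} {ζ : Fin d → ℝ} (S : Finset (Fin d → ℤ))
    (hS : ∀ m ∈ S, DecayExponent ξ ζ m) :
    ∃ c : ℝ, 0 < c ∧ ∀ m ∈ S, ∀ x, growth ξ ζ m x ≤ -c * ‖x‖ := by
  classical
  induction S using Finset.induction_on with
  | empty => exact ⟨1, one_pos, by simp⟩
  | insert m S _ ih =>
    obtain ⟨c, hc, h⟩ := ih fun m hm => hS m (Finset.mem_insert_of_mem hm)
    obtain ⟨c', hc', h'⟩ := hS m (Finset.mem_insert_self _ _)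
    refine ⟨min c c', lt_min hc hc', fun m' hm' x => ?_⟩
    rcases Finset.mem_insert.1 hm' with rfl | hm'
    · exact (h' x).trans (by
        have := min_le_right c c'
        nlinarith [norm_nonneg x])
    · exact (h m' hm' x).trans (by
        have := min_le_left c c'
        nlinarith [norm_nonneg x])

/-- The linear form `2π (ζ - ∑ ξ_i)` on the complexification. -/
def linForm (ξ : Fin n → Fin d → ℤ) (ζ : Fin d → ℝ) (z : Fin d → ℂ) : ℂ :=
  2 * Real.pi * (∑ k, (ζ k : ℂ) * z k - ∑ i, pairC (ξ i) z)

/-- The holomorphic extension of `A(l, -l)(ix) w_Q(x)` to the tube between `0` and `l`. -/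
def tubeFun (ξ : Fin n → Fin d → ℤ) (b : Fin n → ℂ) (ζ : Fin d → ℝ) (Q : Laurent d)
    (l : Fin d → ℤ) (z : Fin d → ℂ) : ℂ :=
  Complex.exp (linForm ξ ζ z) * laurentEval Q (fun k => Complex.exp (2 * Real.pi * z k)) *
    ∏ i, ((-1) ^ (-pair (ξ i) l).toNat * (Complex.exp (-(Real.pi * Complex.I * b i)) /
      (2 * Real.pi)) * gammaKernel (pair (ξ i) l) (Complex.I * pairC (ξ i) z + b i))

/-- The denominator `e^{2πξ} + e^{2πib}` is a cosine times `e^{πξ + πib}`. The cosine joins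
`A(l,-l)` in the Gamma kernel, and the exponential changes the linear exponent from `-π∑ξ_i` to the
`-2π∑ξ_i` of `linForm`. -/
theorem eval_pairFactor_mul_weight (ξ : Fin n → Fin d → ℤ) {b : Fin n → ℂ} (ζ : Fin d → ℝ)
    (hb : ∀ i, |(b i).re| < 1 / 2) (Q : Laurent d) (l : Fin d → ℤ) (x : Fin d → ℝ) :
    eval (fun k => Complex.I * (x k : ℂ)) (pairFactor ξ b l) * weight ξ b ζ (laurentFun Q) x =
      tubeFun ξ b ζ Q l fun k => (x k : ℂ) := by
  have hpi : (Real.pi : ℂ) ≠ 0 := by exact_mod_cast Real.pi_ne_zero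
  rw [eval_pairFactor, weight, tubeFun, laurentFun_eq_laurentEval]
  have h1 : ∀ i, (Complex.exp (-(Real.pi * Complex.I * b i)) / (2 * Real.pi)) *
      ((-1) ^ (-pair (ξ i) l).toNat * gammaKernel (pair (ξ i) l)
        (Complex.I * pairC (ξ i) (fun k => (x k : ℂ)) + b i)) =
      linearFactors (pair (ξ i) l) (pairC (ξ i) (fun k => Complex.I * (x k : ℂ)) + b i) *
      Complex.exp (Real.pi * pairReal (ξ i) x) *
      ((Real.exp (2 * Real.pi * pairReal (ξ i) x) : ℂ) +
        Complex.exp (2 * Real.pi * Complex.I * b i))⁻¹ := by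
    intro i
    have hcos : Complex.cos (Real.pi * (Complex.I * (pairReal (ξ i) x : ℂ) + b i)) ≠ 0 :=
      cos_pi_mul_ne_zero (by simpa using hb i)
    rw [pairC_mul, pairC_ofReal, gammaKernel_eq _ _ hcos]
    have e := exp_add_exp_eq_cos (pairReal (ξ i) x : ℂ) (b i)
    have e0 : ((Real.exp (2 * Real.pi * pairReal (ξ i) x) : ℝ) : ℂ) =
        Complex.exp (2 * Real.pi * (pairReal (ξ i) x : ℂ)) := by push_cast; rfl
    rw [e0, e]
    have hs : ((-1 : ℂ) ^ (-pair (ξ i) l).toNat) * (-1) ^ (-pair (ξ i) l).toNat = 1 := by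
      rw [← mul_pow]; simp
    have hexp : Complex.exp (Real.pi * (pairReal (ξ i) x : ℂ) + Real.pi * Complex.I * b i) =
        Complex.exp (Real.pi * (pairReal (ξ i) x : ℂ)) * Complex.exp (Real.pi * Complex.I * b i) :=
      Complex.exp_add _ _
    rw [hexp, Complex.exp_neg]
    have n1 := Complex.exp_ne_zero (Real.pi * (pairReal (ξ i) x : ℂ))
    have n2 := Complex.exp_ne_zero (Real.pi * Complex.I * b i)
    rw [show ∀ a c d : ℂ, a * (a * c * d) = (a * a) * (c * d) by intros; ring, hs, one_mul]
    field_simp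
  have h2 : ∀ i, (-1) ^ (-pair (ξ i) l).toNat * (Complex.exp (-(Real.pi * Complex.I * b i)) /
      (2 * Real.pi)) * gammaKernel (pair (ξ i) l)
        (Complex.I * pairC (ξ i) (fun k => (x k : ℂ)) + b i) =
      linearFactors (pair (ξ i) l) (pairC (ξ i) (fun k => Complex.I * (x k : ℂ)) + b i) *
      Complex.exp (Real.pi * pairReal (ξ i) x) *
      ((Real.exp (2 * Real.pi * pairReal (ξ i) x) : ℂ) +
        Complex.exp (2 * Real.pi * Complex.I * b i))⁻¹ := by
    intro i; rw [← h1]; ring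
  simp only [h2, Finset.prod_mul_distrib, Finset.prod_inv_distrib, ← Complex.exp_sum]
  have h3 : ((Real.exp (2 * Real.pi * (∑ k, ζ k * x k) -
      Real.pi * ∑ i, pairReal (ξ i) x) : ℝ) : ℂ) =
      Complex.exp (linForm ξ ζ fun k => (x k : ℂ)) *
        Complex.exp (∑ i, Real.pi * (pairReal (ξ i) x : ℂ)) := by
    rw [← Complex.exp_add, linForm]
    simp only [pairC_ofReal, ← Finset.mul_sum]
    push_cast
    congr 1; ring
  rw [h3]
  push_cast
  ring

theorem weight_eq_tubeFun (ξ : Fin n → Fin d → ℤ) {b : Fin n → ℂ} (ζ : Fin d → ℝ)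
    (hb : ∀ i, |(b i).re| < 1 / 2) (Q : Laurent d) (x : Fin d → ℝ) :
    weight ξ b ζ (laurentFun Q) x = tubeFun ξ b ζ Q 0 fun k => (x k : ℂ) := by
  rw [← eval_pairFactor_mul_weight ξ ζ hb, eval_pairFactor]
  simp [linearFactors, pair]

theorem exp_pi_mul_int (p : ℤ) :
    Complex.exp (Real.pi * Complex.I * p) = (-1) ^ p.toNat * (-1) ^ (-p).toNat := by
  rw [mul_comm, Complex.exp_int_mul, Complex.exp_pi_mul_I]
  rcases le_total 0 p with h | h
  · obtain ⟨q, rfl⟩ := Int.eq_ofNat_of_zero_le h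
    simp
  · obtain ⟨q, hq⟩ := Int.eq_ofNat_of_zero_le (neg_nonneg.2 h)
    obtain rfl : p = -(q : ℤ) := by omega
    simp [← inv_pow]

theorem neg_one_pow_mul_self (q : ℕ) : (-1 : ℂ) ^ q * (-1) ^ q = 1 := by
  rw [← mul_pow]; simp

theorem linForm_tubePoint (ξ : Fin n → Fin d → ℤ) (ζ : Fin d → ℝ) (l : Fin d → ℤ)
    (x : Fin d → ℝ) (w : ℂ) :
    linForm ξ ζ (tubePoint l x w) = linForm ξ ζ (fun k => (x k : ℂ)) +
      2 * Real.pi * w * ((∑ k, ζ k * (l k : ℝ) : ℝ) : ℂ) -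
      2 * Real.pi * w * ∑ i, (pair (ξ i) l : ℂ) := by
  unfold linForm tubePoint
  simp only [pairC_add_mul, pairC_int, Finset.sum_add_distrib, ← Finset.mul_sum, mul_add]
  push_cast
  have : ∑ k, (ζ k : ℂ) * (w * (l k : ℂ)) = w * ∑ k, (ζ k : ℂ) * (l k : ℂ) := by
    rw [Finset.mul_sum]; exact Finset.sum_congr rfl fun k _ => by ring
  rw [this]
  ring

theorem pairC_tubePoint (ξ : Fin d → ℤ) (l : Fin d → ℤ) (x : Fin d → ℝ) (w : ℂ) :
    pairC ξ (tubePoint l x w) = (pairReal ξ x : ℂ) + w * (pair ξ l : ℂ) := by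
  unfold tubePoint
  rw [pairC_add_mul, pairC_int, pairC_ofReal]

theorem rhoCoeff_eq (ξ : Fin n → Fin d → ℤ) (ζ : Fin d → ℝ) (l : Fin d → ℤ) :
    rhoCoeff ξ ζ l = Complex.exp (-(Real.pi * Complex.I * ((∑ k, ζ k * (l k : ℝ) : ℝ) : ℂ))) *
      ∏ i, (-1) ^ (pair (ξ i) l).toNat := by
  rw [rhoCoeff, Finset.prod_pow_eq_pow_sum]

/-- The Laurent polynomial in `e^{2πz}` is periodic under `il`, the linear form contributes
`e^{2πiζ(l)}`, and `gammaKernel_sub` exchanges `l` and `-l`. The remaining signs complete the scalar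
of `ρ²`. -/
theorem tubeFun_full_shift (ξ : Fin n → Fin d → ℤ) (b : Fin n → ℂ) (ζ : Fin d → ℝ)
    (Q : Laurent d) (l : Fin d → ℤ) (x : Fin d → ℝ) :
    tubeFun ξ b ζ Q l (tubePoint l x ((1 : ℝ) * Complex.I)) =
      twist ξ ζ l * tubeFun ξ b ζ Q (-l) fun k => (x k : ℂ) := by
  have hL : (fun k => Complex.exp (2 * Real.pi * tubePoint l x ((1 : ℝ) * Complex.I) k)) =
      fun k => Complex.exp (2 * Real.pi * (x k : ℂ)) := by
    ext k
    rw [tubePoint, mul_add, Complex.exp_add]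
    rw [show 2 * (Real.pi : ℂ) * (((1 : ℝ) : ℂ) * Complex.I * (l k : ℂ)) =
      (l k : ℂ) * (2 * Real.pi * Complex.I) by push_cast; ring, Complex.exp_int_mul_two_pi_mul_I,
      mul_one]
  have hE : Complex.exp (linForm ξ ζ (tubePoint l x ((1 : ℝ) * Complex.I))) =
      Complex.exp (linForm ξ ζ fun k => (x k : ℂ)) *
        (Complex.exp (Real.pi * Complex.I * ((∑ k, ζ k * (l k : ℝ) : ℝ) : ℂ)) *
          Complex.exp (Real.pi * Complex.I * ((∑ k, ζ k * (l k : ℝ) : ℝ) : ℂ))) := by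
    rw [linForm_tubePoint, Complex.exp_sub, Complex.exp_add]
    have : Complex.exp (2 * Real.pi * (((1 : ℝ) : ℂ) * Complex.I) * ∑ i, (pair (ξ i) l : ℂ)) = 1 := by
      rw [← Int.cast_sum]
      rw [show 2 * (Real.pi : ℂ) * (((1 : ℝ) : ℂ) * Complex.I) * ((∑ i, pair (ξ i) l : ℤ) : ℂ) =
        ((∑ i, pair (ξ i) l : ℤ) : ℂ) * (2 * Real.pi * Complex.I) by push_cast; ring,
        Complex.exp_int_mul_two_pi_mul_I]
    rw [this, div_one, ← Complex.exp_add (Real.pi * Complex.I * _)]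
    congr 2
    push_cast; ring
  have hT : twist ξ ζ l =
      (Complex.exp (Real.pi * Complex.I * ((∑ k, ζ k * (l k : ℝ) : ℝ) : ℂ)) *
          Complex.exp (Real.pi * Complex.I * ((∑ k, ζ k * (l k : ℝ) : ℝ) : ℂ))) *
        ∏ i, ((-1) ^ (pair (ξ i) l).toNat * (-1) ^ (-pair (ξ i) l).toNat) := by
    have h1 : ∑ k, ζ k * (((-l) k : ℤ) : ℝ) = -∑ k, ζ k * (l k : ℝ) := by simp
    rw [twist, rhoCoeff_eq, rhoCoeff_eq, h1]
    simp only [pair_neg, map_mul, map_prod, map_pow, map_neg, map_one, ← Complex.exp_conj,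
      Complex.conj_ofReal, Complex.conj_I, Complex.ofReal_neg, Finset.prod_mul_distrib]
    ring_nf
  unfold tubeFun
  rw [hL, hE, hT]
  have hP : ∀ i, (-1) ^ (-pair (ξ i) l).toNat * (Complex.exp (-(Real.pi * Complex.I * b i)) /
      (2 * Real.pi)) * gammaKernel (pair (ξ i) l)
        (Complex.I * pairC (ξ i) (tubePoint l x ((1 : ℝ) * Complex.I)) + b i) =
      ((-1) ^ (pair (ξ i) l).toNat * (-1) ^ (-pair (ξ i) l).toNat) *
      ((-1) ^ (-pair (ξ i) (-l)).toNat * (Complex.exp (-(Real.pi * Complex.I * b i)) /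
      (2 * Real.pi)) * gammaKernel (pair (ξ i) (-l))
        (Complex.I * pairC (ξ i) (fun k => (x k : ℂ)) + b i)) := by
    intro i
    rw [pairC_tubePoint, pairC_ofReal, pair_neg, neg_neg, ← gammaKernel_sub]
    have e : Complex.I * ((pairReal (ξ i) x : ℂ) + ((1 : ℝ) : ℂ) * Complex.I * (pair (ξ i) l : ℂ)) +
        b i = Complex.I * (pairReal (ξ i) x : ℂ) + b i - (pair (ξ i) l : ℂ) := by
      push_cast; linear_combination (pair (ξ i) l : ℂ) * Complex.I_mul_I
    rw [e]
    have hs := neg_one_pow_mul_self (pair (ξ i) l).toNat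
    linear_combination (-((-1) ^ (-pair (ξ i) l).toNat * (Complex.exp (-(Real.pi * Complex.I * b i)) /
      (2 * Real.pi)) * gammaKernel (pair (ξ i) l)
        (Complex.I * (pairReal (ξ i) x : ℂ) + b i - (pair (ξ i) l : ℂ)))) * hs
  rw [Finset.prod_congr rfl fun i _ => hP i, Finset.prod_mul_distrib]
  ring

/-- The point `((-1)^{l_k} e^{2π x_k})_k`. -/
def signedExp (l : Fin d → ℤ) (x : Fin d → ℝ) (k : Fin d) : ℝ :=
  (-1) ^ (l k) * Real.exp (2 * Real.pi * x k)

theorem signedExp_eq (l : Fin d → ℤ) (x : Fin d → ℝ) (k : Fin d) :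
    (signedExp l x k : ℂ) =
      Complex.exp (2 * Real.pi * tubePoint l x (((1 / 2 : ℝ) : ℂ) * Complex.I) k) := by
  rw [tubePoint, mul_add, Complex.exp_add, signedExp,
    show 2 * (Real.pi : ℂ) * (((1 / 2 : ℝ) : ℂ) * Complex.I * (l k : ℂ)) =
      (l k : ℂ) * (Real.pi * Complex.I) by push_cast; ring,
    Complex.exp_int_mul, Complex.exp_pi_mul_I]
  push_cast
  ring

/-- The density that multiplies `|f(ix - l/2)|² Q((-1)^l e^{2πx})` in `T(f r^l ρ(f r^l))`. -/
def halfDensity (ξ : Fin n → Fin d → ℤ) (b : Fin n → ℂ) (ζ : Fin d → ℝ) (l : Fin d → ℤ)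
    (x : Fin d → ℝ) : ℂ :=
  Complex.exp (linForm ξ ζ fun k => (x k : ℂ)) *
    ∏ i, ((Complex.exp (-(Real.pi * Complex.I * b i)) / (2 * Real.pi)) *
      gammaKernel (pair (ξ i) l)
        (Complex.I * (pairReal (ξ i) x : ℂ) - (pair (ξ i) l : ℂ) / 2 + b i))

/-- This explains the coefficient in `ρ`: its phase `e^{-πiζ(l)}` cancels the one produced by half
the translation, and all signs from the `ξ_i` occur twice. Only the signs inside `Q` survive. -/
theorem rhoCoeff_mul_tubeFun_half (ξ : Fin n → Fin d → ℤ) (b : Fin n → ℂ) (ζ : Fin d → ℝ)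
    (Q : Laurent d) (l : Fin d → ℤ) (x : Fin d → ℝ) :
    rhoCoeff ξ ζ l * tubeFun ξ b ζ Q l (tubePoint l x (((1 / 2 : ℝ) : ℂ) * Complex.I)) =
      laurentFun Q (signedExp l x) * halfDensity ξ b ζ l x := by
  unfold tubeFun halfDensity
  simp only [← signedExp_eq]
  rw [laurentFun_eq_laurentEval, rhoCoeff_eq]
  have hE : Complex.exp (linForm ξ ζ (tubePoint l x (((1 / 2 : ℝ) : ℂ) * Complex.I))) =
      Complex.exp (linForm ξ ζ fun k => (x k : ℂ)) *
        Complex.exp (Real.pi * Complex.I * ((∑ k, ζ k * (l k : ℝ) : ℝ) : ℂ)) *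
        ∏ i, ((-1) ^ (pair (ξ i) l).toNat * (-1) ^ (-pair (ξ i) l).toNat) := by
    rw [linForm_tubePoint, Complex.exp_sub, Complex.exp_add, div_eq_mul_inv]
    congr 1
    · congr 2
      push_cast; ring
    · rw [← Complex.exp_neg, ← mul_neg, ← Finset.sum_neg_distrib, Finset.mul_sum, Complex.exp_sum]
      refine Finset.prod_congr rfl fun i _ => ?_
      have := exp_pi_mul_int (-pair (ξ i) l)
      rw [neg_neg] at this
      rw [mul_comm, mul_comm ((-1) ^ _), ← this]
      congr 1
      push_cast; ring
  have hP : ∀ i, (-1) ^ (-pair (ξ i) l).toNat * (Complex.exp (-(Real.pi * Complex.I * b i)) /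
      (2 * Real.pi)) * gammaKernel (pair (ξ i) l)
        (Complex.I * pairC (ξ i) (tubePoint l x (((1 / 2 : ℝ) : ℂ) * Complex.I)) + b i) =
      (-1) ^ (-pair (ξ i) l).toNat * ((Complex.exp (-(Real.pi * Complex.I * b i)) /
      (2 * Real.pi)) * gammaKernel (pair (ξ i) l)
        (Complex.I * (pairReal (ξ i) x : ℂ) - (pair (ξ i) l : ℂ) / 2 + b i)) := by
    intro i
    rw [pairC_tubePoint, mul_assoc]
    congr 4
    push_cast; linear_combination (pair (ξ i) l : ℂ) / 2 * Complex.I_mul_I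
  rw [hE, Finset.prod_congr rfl fun i _ => hP i, Finset.prod_mul_distrib (f := fun i =>
    (-1) ^ (-pair (ξ i) l).toNat), Finset.prod_mul_distrib, Complex.exp_neg]
  have h1 : (∏ i, (-1 : ℂ) ^ (pair (ξ i) l).toNat) * ∏ i, (-1) ^ (pair (ξ i) l).toNat = 1 := by
    rw [← Finset.prod_mul_distrib]
    exact Finset.prod_eq_one fun i _ => neg_one_pow_mul_self _
  have h2 : (∏ i, (-1 : ℂ) ^ (-pair (ξ i) l).toNat) * ∏ i, (-1) ^ (-pair (ξ i) l).toNat = 1 := by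
    rw [← Finset.prod_mul_distrib]
    exact Finset.prod_eq_one fun i _ => neg_one_pow_mul_self _
  have h3 := Complex.exp_ne_zero (Real.pi * Complex.I * ((∑ k, ζ k * (l k : ℝ) : ℝ) : ℂ))
  generalize Complex.exp (Real.pi * Complex.I * ((∑ k, ζ k * (l k : ℝ) : ℝ) : ℂ)) = E at *
  generalize (∏ i, (-1 : ℂ) ^ (pair (ξ i) l).toNat) = P1 at *
  generalize (∏ i, (-1 : ℂ) ^ (-pair (ξ i) l).toNat) = P2 at *
  generalize (∏ i, (Complex.exp (-(Real.pi * Complex.I * b i)) /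
      (2 * Real.pi)) * gammaKernel (pair (ξ i) l)
        (Complex.I * (pairReal (ξ i) x : ℂ) - (pair (ξ i) l : ℂ) / 2 + b i)) = R
  generalize Complex.exp (linForm ξ ζ fun k => (x k : ℂ)) = A
  generalize laurentEval Q (fun k => (signedExp l x k : ℂ)) = L
  calc E⁻¹ * P1 * (A * E * (P1 * P2) * L * (P2 * R))
      = (E⁻¹ * E) * (P1 * P1) * (P2 * P2) * (L * (A * R)) := by ring
    _ = L * (A * R) := by rw [h1, h2, inv_mul_cancel₀ h3]; ring

theorem halfDensity_pos {ξ : Fin n → Fin d → ℤ} {b : Fin n → ℂ} (ζ : Fin d → ℝ)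
    (hb : ∀ i, |(b i).re| < 1 / 2) (hρ : FlavorsSelfConjugate ξ b) (l : Fin d → ℤ)
    (x : Fin d → ℝ) : 0 < halfDensity ξ b ζ l x := by
  obtain ⟨σ, -, hσ⟩ := hρ
  unfold halfDensity
  rw [Finset.prod_mul_distrib]
  have h1 : 0 < Complex.exp (linForm ξ ζ fun k => (x k : ℂ)) := by
    have : linForm ξ ζ (fun k => (x k : ℂ)) =
        ((2 * Real.pi * (∑ k, ζ k * x k - ∑ i, pairReal (ξ i) x) : ℝ) : ℂ) := by
      unfold linForm
      simp only [pairC_ofReal]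
      push_cast; rfl
    rw [this, ← Complex.ofReal_exp]
    exact_mod_cast Real.exp_pos _
  have h2 : 0 < ∏ i, (Complex.exp (-(Real.pi * Complex.I * b i)) / (2 * Real.pi)) := by
    rw [Finset.prod_div_distrib, ← Complex.exp_sum]
    -- By the involution `∑ b_i` is purely imaginary, so the constants `e^{-πi b_i}` have a positive
    -- product although they need not be positive one by one.
    have hsum : (starRingEnd ℂ) (∑ i, b i) = -∑ i, b i := by
      rw [map_sum, ← Finset.sum_neg_distrib, ← Equiv.sum_comp σ fun i => -b i]
      exact Finset.sum_congr rfl fun i _ => by rw [(hσ i).2, neg_neg]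
    have hre : (∑ i, b i).re = 0 := by
      have := congrArg Complex.re hsum
      rw [Complex.conj_re, Complex.neg_re] at this
      linarith
    have e : ∑ i, -(Real.pi * Complex.I * b i) = ((Real.pi * (∑ i, b i).im : ℝ) : ℂ) := by
      rw [Finset.sum_neg_distrib, ← Finset.mul_sum]
      conv_lhs => rw [← Complex.re_add_im (∑ i, b i), hre]
      push_cast
      linear_combination (-(Real.pi * ((∑ i, b i).im : ℂ))) * Complex.I_mul_I
    rw [e, ← Complex.ofReal_exp, Finset.prod_const]
    have : (0 : ℝ) < Real.exp (Real.pi * (∑ i, b i).im) / (2 * Real.pi) ^ (Finset.univ : Finset (Fin n)).card := by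
      have := Real.pi_pos
      positivity
    exact_mod_cast this
  have h3 := prod_gammaKernel_half_pos hb (s := fun i => pairReal (ξ i) x)
    (p := fun i => pair (ξ i) l) (σ := σ)
    fun i => ⟨by rw [(hσ i).1], by rw [(hσ i).1], (hσ i).2⟩
  exact mul_pos h1 (mul_pos h2 h3)

theorem re_kernelArg (p : ℤ) (s t : ℝ) (b : ℂ) :
    (Complex.I * ((s : ℂ) + (t * Complex.I) * (p : ℂ)) + b).re = -(t * p) + b.re ∧
    (Complex.I * ((s : ℂ) + (t * Complex.I) * (p : ℂ)) + b).im = s + b.im := by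
  simp

/-- Since `-tp` stays in `[-p⁺, p⁻]`, the condition `|Re b| < 1/2` keeps the kernel argument
strictly inside its strip of holomorphy, uniformly in `t`. -/
theorem kernelArg_bounds (p : ℤ) {t : ℝ} (ht : t ∈ Icc (0 : ℝ) 1) (β : ℝ) :
    -|β| - (p.toNat : ℝ) ≤ -(t * p) + β ∧ -(t * p) + β ≤ |β| + ((-p).toNat : ℝ) := by
  have h1 : (p : ℝ) = (p.toNat : ℝ) - ((-p).toNat : ℝ) := by
    have : p = (p.toNat : ℤ) - ((-p).toNat : ℤ) := by omega
    exact_mod_cast this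
  have h2 : (0 : ℝ) ≤ p.toNat := Nat.cast_nonneg _
  have h3 : (0 : ℝ) ≤ (-p).toNat := Nat.cast_nonneg _
  rw [h1]
  constructor
  · nlinarith [neg_abs_le β, ht.1, ht.2, mul_nonneg ht.1 h3, mul_nonneg (sub_nonneg.2 ht.2) h2]
  · nlinarith [le_abs_self β, ht.1, ht.2, mul_nonneg ht.1 h2, mul_nonneg (sub_nonneg.2 ht.2) h3]

theorem differentiable_eval_I_mul (F : MvPolynomial (Fin d) ℂ) :
    Differentiable ℂ fun z : Fin d → ℂ => eval (fun k => Complex.I * z k) F := by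
  induction F using MvPolynomial.induction_on with
  | C a => simp
  | add p q hp hq =>
    simp only [map_add]
    exact hp.fun_add hq
  | mul_X p k hp =>
    simp only [map_mul, eval_X]
    exact hp.mul (by fun_prop)

theorem differentiableAt_prod {E ι : Type*} [NormedAddCommGroup E] [NormedSpace ℂ E]
    (s : Finset ι) {f : ι → E → ℂ} {z : E} (h : ∀ i, DifferentiableAt ℂ (f i) z) :
    DifferentiableAt ℂ (fun z => ∏ i ∈ s, f i z) z := by
  classical
  induction s using Finset.induction_on with
  | empty => simp
  | insert i s hi ih =>
    simp only [Finset.prod_insert hi]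
    exact (h i).fun_mul ih

theorem tubeHolo_tubeFun (ξ : Fin n → Fin d → ℤ) {b : Fin n → ℂ} (ζ : Fin d → ℝ)
    (hb : ∀ i, |(b i).re| < 1 / 2) (Q : Laurent d) (l : Fin d → ℤ)
    (F : MvPolynomial (Fin d) ℂ) :
    TubeHolo l fun z => eval (fun k => Complex.I * z k) F * tubeFun ξ b ζ Q l z := by
  intro x t ht
  refine (differentiable_eval_I_mul F _).mul ?_
  unfold tubeFun laurentEval Finsupp.sum linForm
  refine ((DifferentiableAt.cexp ?_).mul ?_).mul ?_
  · unfold pairC; fun_prop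
  · refine DifferentiableAt.fun_sum fun m _ => ?_
    refine DifferentiableAt.const_mul (differentiableAt_prod _ fun k => ?_) _
    have : ∀ z : Fin d → ℂ, Complex.exp (2 * Real.pi * z k) ^ (m k) =
        Complex.exp ((m k : ℂ) * (2 * Real.pi * z k)) := fun z => (Complex.exp_int_mul _ _).symm
    simp only [this]
    fun_prop
  · refine differentiableAt_prod _ fun i => DifferentiableAt.const_mul ?_ _
    refine DifferentiableAt.comp (g := gammaKernel (pair (ξ i) l)) _
      (differentiableAt_gammaKernel ?_ ?_) (by unfold pairC; fun_prop)
    · rw [pairC_tubePoint, (re_kernelArg _ _ _ _).1]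
      have := (kernelArg_bounds (pair (ξ i) l) ht (b i).re).1
      linarith [hb i]
    · rw [pairC_tubePoint, (re_kernelArg _ _ _ _).1]
      have := (kernelArg_bounds (pair (ξ i) l) ht (b i).re).2
      linarith [hb i]

theorem exists_norm_kernel_le (p : ℤ) {b : ℂ} (hb : |b.re| < 1 / 2) {ε : ℝ} (hε : 0 < ε)
    (hεπ : ε ≤ Real.pi) :
    ∃ C : ℝ, 0 ≤ C ∧ ∀ s : ℝ, ∀ t ∈ Icc (0 : ℝ) 1,
      ‖gammaKernel p (Complex.I * ((s : ℂ) + (t * Complex.I) * (p : ℂ)) + b)‖ ≤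
        C * Real.exp ((ε - Real.pi) * |s|) := by
  obtain ⟨C, hC, h⟩ := exists_norm_gammaKernel_le p (α := -|b.re| - (p.toNat : ℝ))
    (β := |b.re| + ((-p).toNat : ℝ)) (by linarith) (by linarith) hε
  refine ⟨C * Real.exp ((Real.pi - ε) * |b.im|), by positivity, fun s t ht => ?_⟩
  obtain ⟨h1, h2⟩ := kernelArg_bounds p ht b.re
  obtain ⟨e1, e2⟩ := re_kernelArg p s t b
  refine (h _ (by rw [e1]; exact h1) (by rw [e1]; exact h2)).trans ?_
  rw [e2, mul_assoc, ← Real.exp_add]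
  refine mul_le_mul_of_nonneg_left (Real.exp_le_exp.2 ?_) hC
  have h3 : |s| ≤ |s + b.im| + |b.im| := by
    have := abs_sub (s + b.im) b.im
    rwa [add_sub_cancel_right] at this
  nlinarith

theorem exists_prod_le {ι : Type*} (s : Finset ι) {α : Type*} (f : ι → α → ℂ) (g : ι → α → ℝ)
    (h : ∀ i, ∃ C : ℝ, 0 ≤ C ∧ ∀ x, ‖f i x‖ ≤ C * Real.exp (g i x)) :
    ∃ C : ℝ, 0 ≤ C ∧ ∀ x, ‖∏ i ∈ s, f i x‖ ≤ C * Real.exp (∑ i ∈ s, g i x) := by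
  choose C hC hf using h
  refine ⟨∏ i ∈ s, C i, Finset.prod_nonneg fun i _ => hC i, fun x => ?_⟩
  rw [norm_prod, Real.exp_sum, ← Finset.prod_mul_distrib]
  exact Finset.prod_le_prod (fun i _ => norm_nonneg _) fun i _ => hf i x

theorem exists_sum_abs_pairReal_le (ξ : Fin n → Fin d → ℤ) :
    ∃ B : ℝ, 0 ≤ B ∧ ∀ x, ∑ i, |pairReal (ξ i) x| ≤ B * ‖x‖ := by
  refine ⟨∑ i, ∑ k, |(ξ i k : ℝ)|, by positivity, fun x => ?_⟩
  rw [Finset.sum_mul]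
  refine Finset.sum_le_sum fun i _ => ?_
  rw [Finset.sum_mul]
  refine (Finset.abs_sum_le_sum_abs _ _).trans (Finset.sum_le_sum fun k _ => ?_)
  rw [abs_mul]
  exact mul_le_mul_of_nonneg_left (norm_le_pi_norm x k) (abs_nonneg _)

theorem norm_exp_linForm_tubePoint (ξ : Fin n → Fin d → ℤ) (ζ : Fin d → ℝ) (l : Fin d → ℤ)
    (x : Fin d → ℝ) (t : ℝ) :
    ‖Complex.exp (linForm ξ ζ (tubePoint l x (t * Complex.I)))‖ =
      Real.exp (2 * Real.pi * (∑ k, ζ k * x k - ∑ i, pairReal (ξ i) x)) := by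
  rw [Complex.norm_exp, linForm_tubePoint]
  congr 1
  have h1 : linForm ξ ζ (fun k => (x k : ℂ)) =
      ((2 * Real.pi * (∑ k, ζ k * x k - ∑ i, pairReal (ξ i) x) : ℝ) : ℂ) := by
    unfold linForm
    simp only [pairC_ofReal]
    push_cast; rfl
  have h2 : 2 * Real.pi * (t * Complex.I) * ((∑ k, ζ k * (l k : ℝ) : ℝ) : ℂ) -
      2 * Real.pi * (t * Complex.I) * ∑ i, (pair (ξ i) l : ℂ) =
      ((2 * Real.pi * t * (∑ k, ζ k * (l k : ℝ) - ∑ i, (pair (ξ i) l : ℝ)) : ℝ) : ℂ) *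
        Complex.I := by
    push_cast; ring
  rw [add_sub_assoc, h1, h2, Complex.add_re, Complex.ofReal_re, Complex.re_ofReal_mul, Complex.I_re,
    mul_zero, add_zero]

theorem norm_laurentEval_tubePoint_le (Q : Laurent d) (l : Fin d → ℤ) (x : Fin d → ℝ) (t : ℝ) :
    ‖laurentEval Q fun k => Complex.exp (2 * Real.pi * tubePoint l x (t * Complex.I) k)‖ ≤
      ∑ m ∈ Q.support, ‖Q m‖ * Real.exp (2 * Real.pi * ∑ k, (m k : ℝ) * x k) := by
  unfold laurentEval Finsupp.sum
  refine (norm_sum_le _ _).trans (Finset.sum_le_sum fun m _ => ?_)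
  rw [norm_mul, norm_prod, Finset.mul_sum, Real.exp_sum]
  refine le_of_eq ?_
  congr 1
  refine Finset.prod_congr rfl fun k _ => ?_
  rw [← Complex.exp_int_mul, Complex.norm_exp]
  congr 1
  have : (m k : ℂ) * (2 * Real.pi * tubePoint l x (t * Complex.I) k) =
      ((2 * Real.pi * ((m k : ℝ) * x k) : ℝ) : ℂ) +
        ((2 * Real.pi * (m k : ℝ) * t * (l k : ℝ) : ℝ) : ℂ) * Complex.I := by
    unfold tubePoint
    push_cast; ring
  rw [this, Complex.add_re, Complex.ofReal_re, Complex.re_ofReal_mul, Complex.I_re,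
    mul_zero, add_zero]

theorem norm_tubePoint_le (l : Fin d → ℤ) (x : Fin d → ℝ) {t : ℝ} (ht : t ∈ Icc (0 : ℝ) 1) :
    ‖fun k => Complex.I * tubePoint l x (t * Complex.I) k‖ ≤ ‖x‖ + ‖fun k => (l k : ℝ)‖ := by
  refine (pi_norm_le_iff_of_nonneg (by positivity)).2 fun k => ?_
  rw [norm_mul, Complex.norm_I, one_mul]
  refine (norm_add_le _ _).trans (add_le_add ?_ ?_)
  · rw [Complex.norm_real]; exact norm_le_pi_norm x k
  · have := norm_le_pi_norm (fun k => (l k : ℝ)) k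
    rw [norm_mul, norm_mul, Complex.norm_I, mul_one, Complex.norm_real, Real.norm_of_nonneg ht.1]
    have e : ‖(l k : ℂ)‖ = ‖(l k : ℝ)‖ := by
      rw [← Complex.ofReal_intCast, Complex.norm_real]
    rw [e]
    exact (mul_le_of_le_one_left (norm_nonneg _) ht.2).trans this

/-- The exponential and the monomials have modulus independent of `t`; with the Gamma bounds, the
monomial `m` contributes `e^{growth}` up to a loss `ε∑|ξ_i(x)|`. That loss and the polynomial `F`
cost `c/4` each, leaving the rate `c/2`. -/
theorem tubeDecay_tubeFun {ξ : Fin n → Fin d → ℤ} {b : Fin n → ℂ} {ζ : Fin d → ℝ}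
    (hb : ∀ i, |(b i).re| < 1 / 2) {Q : Laurent d}
    (hQ : ∀ m ∈ Q.support, DecayExponent ξ ζ m) (l : Fin d → ℤ)
    (F : MvPolynomial (Fin d) ℂ) :
    TubeDecay l fun z => eval (fun k => Complex.I * z k) F * tubeFun ξ b ζ Q l z := by
  obtain ⟨c, hc, hgrow⟩ := exists_uniform_decay Q.support hQ
  obtain ⟨B, hB, hsum⟩ := exists_sum_abs_pairReal_le ξ
  obtain ⟨ε, hε, hεπ, hεB⟩ : ∃ ε : ℝ, 0 < ε ∧ ε ≤ Real.pi ∧ ε * B ≤ c / 4 := by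
    refine ⟨min Real.pi (c / 4 / (B + 1)), lt_min Real.pi_pos (by positivity), min_le_left _ _, ?_⟩
    calc _ ≤ c / 4 / (B + 1) * B := by gcongr; exact min_le_right _ _
      _ ≤ c / 4 := by
        rw [div_mul_eq_mul_div, div_le_iff₀ (by positivity)]
        nlinarith
  obtain ⟨CF, hCF, hF⟩ := exists_norm_eval_le_exp F (c / 4) (by positivity)
  obtain ⟨CG, hCG, hG⟩ := exists_prod_le Finset.univ
    (α := (Fin d → ℝ) × Icc (0 : ℝ) 1)
    (fun i z => (-1) ^ (-pair (ξ i) l).toNat * (Complex.exp (-(Real.pi * Complex.I * b i)) /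
      (2 * Real.pi)) * gammaKernel (pair (ξ i) l)
        (Complex.I * pairC (ξ i) (tubePoint l z.1 (((z.2 : ℝ) : ℂ) * Complex.I)) + b i))
    (fun i z => (ε - Real.pi) * |pairReal (ξ i) z.1|) (fun i => by
      obtain ⟨C, hC, h⟩ := exists_norm_kernel_le (pair (ξ i) l) (hb i) hε hεπ
      refine ⟨‖(-1) ^ (-pair (ξ i) l).toNat * (Complex.exp (-(Real.pi * Complex.I * b i)) /
        (2 * Real.pi : ℂ))‖ * C, by positivity, fun z => ?_⟩
      rw [pairC_tubePoint, norm_mul]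
      exact (mul_le_mul_of_nonneg_left (h _ _ z.2.2) (norm_nonneg _)).trans_eq
        (mul_assoc _ _ _).symm)
  refine ⟨CF * Real.exp (c / 4 * ‖fun k => (l k : ℝ)‖) * CG * ∑ m ∈ Q.support, ‖Q m‖, c / 2,
    by positivity, fun x t ht => ?_⟩
  have h1 : ‖eval (fun k => Complex.I * tubePoint l x (t * Complex.I) k) F‖ ≤
      CF * Real.exp (c / 4 * ‖fun k => (l k : ℝ)‖) * Real.exp (c / 4 * ‖x‖) := by
    refine (hF _).trans ?_
    rw [mul_assoc, ← Real.exp_add]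
    refine mul_le_mul_of_nonneg_left (Real.exp_le_exp.2 ?_) hCF
    nlinarith [norm_tubePoint_le l x ht]
  have h2 := hG (x, ⟨t, ht⟩)
  simp only at h2
  have h3 := norm_laurentEval_tubePoint_le Q l x t
  rw [norm_mul, tubeFun, norm_mul, norm_mul, norm_exp_linForm_tubePoint]
  set A := 2 * Real.pi * (∑ k, ζ k * x k - ∑ i, pairReal (ξ i) x) with hA
  set S := ∑ i, (ε - Real.pi) * |pairReal (ξ i) x| with hS
  have hS' : S = (ε - Real.pi) * ∑ i, |pairReal (ξ i) x| := by rw [hS, Finset.mul_sum]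
  have h4 : Real.exp A * (∑ m ∈ Q.support, ‖Q m‖ *
      Real.exp (2 * Real.pi * ∑ k, (m k : ℝ) * x k)) * Real.exp S ≤
      (∑ m ∈ Q.support, ‖Q m‖) * Real.exp (-(3 * c / 4) * ‖x‖) := by
    rw [Finset.mul_sum, Finset.sum_mul, Finset.sum_mul]
    refine Finset.sum_le_sum fun m hm => ?_
    rw [mul_left_comm, mul_assoc, ← Real.exp_add, ← Real.exp_add]
    refine mul_le_mul_of_nonneg_left (Real.exp_le_exp.2 ?_) (norm_nonneg _)
    have h5 := hgrow m hm x
    have h6 : A + 2 * Real.pi * ∑ k, (m k : ℝ) * x k + S =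
        growth ξ ζ m x + ε * ∑ i, |pairReal (ξ i) x| := by
      rw [hS', hA, growth]
      simp only [add_mul, Finset.sum_add_distrib]
      ring
    rw [h6]
    have h7 : ε * ∑ i, |pairReal (ξ i) x| ≤ ε * (B * ‖x‖) :=
      mul_le_mul_of_nonneg_left (hsum x) hε.le
    nlinarith [norm_nonneg x]
  calc _ ≤ (CF * Real.exp (c / 4 * ‖fun k => (l k : ℝ)‖) * Real.exp (c / 4 * ‖x‖)) *
        (Real.exp A * (∑ m ∈ Q.support, ‖Q m‖ *
      Real.exp (2 * Real.pi * ∑ k, (m k : ℝ) * x k)) * (CG * Real.exp S)) := by gcongr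
    _ = (CF * Real.exp (c / 4 * ‖fun k => (l k : ℝ)‖) * Real.exp (c / 4 * ‖x‖)) * CG *
        (Real.exp A * (∑ m ∈ Q.support, ‖Q m‖ *
      Real.exp (2 * Real.pi * ∑ k, (m k : ℝ) * x k)) * Real.exp S) := by ring
    _ ≤ (CF * Real.exp (c / 4 * ‖fun k => (l k : ℝ)‖) * Real.exp (c / 4 * ‖x‖)) * CG *
        ((∑ m ∈ Q.support, ‖Q m‖) * Real.exp (-(3 * c / 4) * ‖x‖)) := by gcongr
    _ = CF * Real.exp (c / 4 * ‖fun k => (l k : ℝ)‖) * CG * (∑ m ∈ Q.support, ‖Q m‖) *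
        (Real.exp (c / 4 * ‖x‖) * Real.exp (-(3 * c / 4) * ‖x‖)) := by ring
    _ = _ := by
        rw [← Real.exp_add]
        congr 2
        ring

theorem tubePoint_zero_mul_I (l : Fin d → ℤ) (x : Fin d → ℝ) :
    tubePoint l x (((0 : ℝ) : ℂ) * Complex.I) = fun k => (x k : ℂ) := by
  rw [Complex.ofReal_zero, zero_mul, tubePoint_zero]

/-! ### The trace identity and the quadratic form `T(a ρ(a))`. -/

section Trace

variable {ξ : Fin n → Fin d → ℤ} {b : Fin n → ℂ} {ζ : Fin d → ℝ} {Q : Laurent d}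

theorem integrable_eval_mul_weight (hb : ∀ i, |(b i).re| < 1 / 2)
    (hQ : ∀ m ∈ Q.support, DecayExponent ξ ζ m) (F : MvPolynomial (Fin d) ℂ) :
    Integrable fun x : Fin d → ℝ =>
      eval (fun k => Complex.I * (x k : ℂ)) F * weight ξ b ζ (laurentFun Q) x := by
  have h := (tubeHolo_tubeFun ξ ζ hb Q 0 F).integrable (tubeDecay_tubeFun hb hQ 0 F)
    (t := 0) ⟨le_rfl, zero_le_one⟩
  simp only [tubePoint_zero_mul_I] at h
  simpa only [weight_eq_tubeFun ξ ζ hb] using h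

theorem expDecay_weight (hb : ∀ i, |(b i).re| < 1 / 2)
    (hQ : ∀ m ∈ Q.support, DecayExponent ξ ζ m) : ExpDecay (weight ξ b ζ (laurentFun Q)) := by
  have h := TubeDecay.expDecay (tubeDecay_tubeFun hb hQ 0 1) (t := 0) ⟨le_rfl, zero_le_one⟩
  simp only [tubePoint_zero_mul_I, map_one, one_mul] at h
  have e : weight ξ b ζ (laurentFun Q) = fun x => tubeFun ξ b ζ Q 0 fun k => (x k : ℂ) :=
    funext fun x => weight_eq_tubeFun ξ ζ hb Q x
  rwa [e]

theorem isLinearMap_integralTrace (hb : ∀ i, |(b i).re| < 1 / 2)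
    (hQ : ∀ m ∈ Q.support, DecayExponent ξ ζ m) :
    IsLinearMap ℂ (integralTrace (weight ξ b ζ (laurentFun Q))) := by
  constructor
  · intro a a'
    unfold integralTrace
    rw [← integral_add (integrable_eval_mul_weight hb hQ _) (integrable_eval_mul_weight hb hQ _)]
    simp only [Finsupp.add_apply, map_add, add_mul]
  · intro c a
    unfold integralTrace
    rw [smul_eq_mul, ← integral_const_mul]
    simp only [Finsupp.smul_apply, smul_eval, mul_assoc]

theorem integralTrace_eq_sum (hb : ∀ i, |(b i).re| < 1 / 2)
    (hQ : ∀ m ∈ Q.support, DecayExponent ξ ζ m) {a : Alg d} {s : Finset (Fin d → ℤ)}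
    {f : (Fin d → ℤ) → MvPolynomial (Fin d) ℂ} (ha : a 0 = ∑ l ∈ s, f l) :
    integralTrace (weight ξ b ζ (laurentFun Q)) a =
      ∑ l ∈ s, ∫ x : Fin d → ℝ,
        eval (fun k => Complex.I * (x k : ℂ)) (f l) * weight ξ b ζ (laurentFun Q) x := by
  rw [← integral_finsetSum _ fun l _ => integrable_eval_mul_weight hb hQ (f l), integralTrace, ha]
  simp only [map_sum, Finset.sum_mul]

theorem integral_mul_pairFactor (hb : ∀ i, |(b i).re| < 1 / 2)
    (hQ : ∀ m ∈ Q.support, DecayExponent ξ ζ m) (F : MvPolynomial (Fin d) ℂ) (l : Fin d → ℤ)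
    {t : ℝ} (ht : t ∈ Icc (0 : ℝ) 1) :
    ∫ x : Fin d → ℝ, eval (fun k => Complex.I * (x k : ℂ)) (F * pairFactor ξ b l) *
        weight ξ b ζ (laurentFun Q) x =
      ∫ x : Fin d → ℝ, eval (fun k => Complex.I * tubePoint l x (t * Complex.I) k) F *
        tubeFun ξ b ζ Q l (tubePoint l x (t * Complex.I)) := by
  rw [← integral_tube_shift (tubeHolo_tubeFun ξ ζ hb Q l F) (tubeDecay_tubeFun hb hQ l F) ht]
  simp only [map_mul, mul_assoc, eval_pairFactor_mul_weight ξ ζ hb]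

theorem isTwistedTrace_integralTrace (hb : ∀ i, |(b i).re| < 1 / 2)
    (hQ : ∀ m ∈ Q.support, DecayExponent ξ ζ m) :
    IsTwistedTrace ξ b ζ (integralTrace (weight ξ b ζ (laurentFun Q))) := by
  refine ⟨isLinearMap_integralTrace hb hQ, fun a a' => ?_⟩
  have h2 : mul ξ b a' (rho ξ ζ (rho ξ ζ a)) 0 = ∑ l ∈ a.support,
      a' (-l) * shift (-l) (C (twist ξ ζ l) * a l) * pairFactor ξ b (-l) := by
    rw [mul_apply_zero', Finsupp.sum_of_support_subset (s := a.support)]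
    · exact Finset.sum_congr rfl fun l _ => by rw [rho_rho_apply]
    · intro l hl
      rw [Finsupp.mem_support_iff, rho_rho_apply] at hl
      exact Finsupp.mem_support_iff.2 (right_ne_zero_of_mul hl)
    · intro l _; simp
  rw [integralTrace_eq_sum hb hQ (mul_apply_zero ξ b a a'), integralTrace_eq_sum hb hQ h2]
  refine Finset.sum_congr rfl fun l _ => ?_
  -- The left integral is translated by the full `il`. The right one, which belongs to `-l`, is only
  -- rewritten, so that the integrands can be compared pointwise.
  rw [integral_mul_pairFactor hb hQ _ _ (t := 1) ⟨zero_le_one, le_rfl⟩,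
    integral_mul_pairFactor hb hQ _ _ (t := 0) ⟨le_rfl, zero_le_one⟩]
  simp only [tubeFun_full_shift, tubePoint_zero_mul_I]
  refine integral_congr_ae (Filter.Eventually.of_forall fun x => ?_)
  simp only [map_mul, eval_shift, eval_C]
  have e1 : (fun k => Complex.I * tubePoint l x (((1 : ℝ) : ℂ) * Complex.I) k + (l k : ℂ)) =
      fun k => Complex.I * (x k : ℂ) := by
    ext k
    unfold tubePoint
    push_cast
    linear_combination (l k : ℂ) * Complex.I_mul_I
  have e2 : (fun k => Complex.I * tubePoint l x (((1 : ℝ) : ℂ) * Complex.I) k) =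
      fun k => Complex.I * (x k : ℂ) + (((-l) k : ℤ) : ℂ) := by
    ext k
    unfold tubePoint
    simp only [Pi.neg_apply]
    push_cast
    linear_combination (l k : ℂ) * Complex.I_mul_I
  rw [e1, e2]
  ring

/-- The point `ix - l/2`. -/
def halfPoint (l : Fin d → ℤ) (x : Fin d → ℝ) : Fin d → ℂ :=
  fun k => Complex.I * (x k : ℂ) - (l k : ℂ) / 2

theorem I_mul_tubePoint_half (l : Fin d → ℤ) (x : Fin d → ℝ) :
    (fun k => Complex.I * tubePoint l x (((1 / 2 : ℝ) : ℂ) * Complex.I) k) = halfPoint l x := by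
  ext k
  unfold tubePoint halfPoint
  push_cast
  linear_combination (l k : ℂ) / 2 * Complex.I_mul_I

theorem half_mem_Icc : (1 / 2 : ℝ) ∈ Icc (0 : ℝ) 1 := by constructor <;> norm_num

theorem continuous_half (hb : ∀ i, |(b i).re| < 1 / 2) (Q : Laurent d) (l : Fin d → ℤ) :
    Continuous fun x => laurentFun Q (signedExp l x) * halfDensity ξ b ζ l x := by
  have h := (tubeHolo_tubeFun ξ ζ hb Q l 1).continuous half_mem_Icc
  simp only [map_one, one_mul] at h
  simpa only [rhoCoeff_mul_tubeFun_half] using h.const_mul (rhoCoeff ξ ζ l)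

theorem expDecay_half (hb : ∀ i, |(b i).re| < 1 / 2)
    (hQ : ∀ m ∈ Q.support, DecayExponent ξ ζ m) (l : Fin d → ℤ) :
    ExpDecay fun x => laurentFun Q (signedExp l x) * halfDensity ξ b ζ l x := by
  obtain ⟨C, c, hc, h⟩ := TubeDecay.expDecay (tubeDecay_tubeFun hb hQ l 1) half_mem_Icc
  refine ⟨‖rhoCoeff ξ ζ l‖ * C, c, hc, fun x => ?_⟩
  have h1 := h x
  simp only [map_one, one_mul] at h1
  beta_reduce
  rw [← rhoCoeff_mul_tubeFun_half, norm_mul, mul_assoc]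
  exact mul_le_mul_of_nonneg_left h1 (norm_nonneg _)

/-- The points `ix - l/2` are fixed by `z ↦ -conj(z + l)`, so the two factors take conjugate values
there. -/
theorem eval_mul_shift_negConj (F : MvPolynomial (Fin d) ℂ) (l : Fin d → ℤ) (x : Fin d → ℝ) :
    eval (halfPoint l x) (F * shift l (negConj F)) =
      (Complex.normSq (eval (halfPoint l x) F) : ℂ) := by
  rw [map_mul, eval_shift, eval_negConj]
  have : (fun k => -(starRingEnd ℂ) (halfPoint l x k + (l k : ℂ))) = halfPoint l x := by
    ext k
    unfold halfPoint
    simp only [map_add, map_sub, map_mul, map_div₀, Complex.conj_I, Complex.conj_ofReal, map_intCast,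
      map_ofNat]
    ring
  rw [this, Complex.mul_conj]

theorem integrable_half (hb : ∀ i, |(b i).re| < 1 / 2)
    (hQ : ∀ m ∈ Q.support, DecayExponent ξ ζ m) (F : MvPolynomial (Fin d) ℂ) (l : Fin d → ℤ) :
    Integrable fun x => (Complex.normSq (eval (halfPoint l x) F) : ℂ) *
      (laurentFun Q (signedExp l x) * halfDensity ξ b ζ l x) := by
  have h := ((tubeHolo_tubeFun ξ ζ hb Q l (F * shift l (negConj F))).integrable
    (tubeDecay_tubeFun hb hQ l _) half_mem_Icc).const_mul (rhoCoeff ξ ζ l)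
  refine h.congr (Filter.Eventually.of_forall fun x => ?_)
  simp only
  rw [I_mul_tubePoint_half, eval_mul_shift_negConj, ← rhoCoeff_mul_tubeFun_half]
  ring

theorem integralTrace_mul_rho (hb : ∀ i, |(b i).re| < 1 / 2)
    (hQ : ∀ m ∈ Q.support, DecayExponent ξ ζ m) (a : Alg d) :
    integralTrace (weight ξ b ζ (laurentFun Q)) (mul ξ b a (rho ξ ζ a)) =
      ∑ l ∈ a.support, ∫ x : Fin d → ℝ, (Complex.normSq (eval (halfPoint l x) (a l)) : ℂ) *
        (laurentFun Q (signedExp l x) * halfDensity ξ b ζ l x) := by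
  rw [integralTrace_eq_sum hb hQ (mul_apply_zero ξ b a _)]
  refine Finset.sum_congr rfl fun l _ => ?_
  rw [integral_mul_pairFactor hb hQ _ _ half_mem_Icc]
  refine integral_congr_ae (Filter.Eventually.of_forall fun x => ?_)
  simp only
  rw [I_mul_tubePoint_half, ← rhoCoeff_mul_tubeFun_half, rho_apply, neg_neg, map_mul (shift l),
    mul_left_comm, map_mul, eval_mul_shift_negConj, eval_shift, eval_C]
  ring

end Trace

/-! ### The positivity criterion on all orthants. -/

theorem complex_integral_nonneg {f : (Fin d → ℝ) → ℂ} (h0 : ∀ x, 0 ≤ f x) : 0 ≤ ∫ x, f x := by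
  have e : ∀ x, f x = ((f x).re : ℂ) := fun x => by
    rw [← Complex.re_add_im (f x), ← (Complex.le_def.1 (h0 x)).2]; simp
  rw [funext e, integral_complex_ofReal]
  exact_mod_cast integral_nonneg fun x => (Complex.le_def.1 (h0 x)).1

theorem complex_integral_pos {f : (Fin d → ℝ) → ℂ} (hf : Continuous f) (hi : Integrable f)
    (h0 : ∀ x, 0 ≤ f x) {x₀ : Fin d → ℝ} (hx : f x₀ ≠ 0) : 0 < ∫ x, f x := by
  have e : ∀ x, f x = ((f x).re : ℂ) := fun x => by
    rw [← Complex.re_add_im (f x), ← (Complex.le_def.1 (h0 x)).2]; simp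
  rw [funext e, integral_complex_ofReal]
  have : 0 < ∫ x, (f x).re := by
    rw [integral_pos_iff_support_of_nonneg (f := fun x => (f x).re)
      (fun x => (Complex.le_def.1 (h0 x)).1) hi.re]
    refine IsOpen.measure_pos volume (Complex.continuous_re.comp hf).isOpen_support ⟨x₀, ?_⟩
    rw [Function.mem_support]
    intro h
    exact hx (by rw [e, h, Complex.ofReal_zero])
  exact_mod_cast this

theorem exists_signedExp_eq {y : Fin d → ℝ} (hy : ∀ k, y k ≠ 0) :
    ∃ l x, signedExp l x = y := by
  refine ⟨fun k => if 0 < y k then 0 else 1, fun k => Real.log |y k| / (2 * Real.pi), ?_⟩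
  ext k
  unfold signedExp
  have hpi := Real.pi_pos
  rw [mul_div_cancel₀ _ (by positivity), Real.exp_log (abs_pos.2 (hy k))]
  beta_reduce
  split_ifs with h
  · rw [zpow_zero, one_mul, abs_of_pos h]
  · rw [zpow_one, abs_of_nonpos (not_lt.1 h)]; ring

theorem signedExp_ne_zero (l : Fin d → ℤ) (x : Fin d → ℝ) (k : Fin d) : signedExp l x k ≠ 0 :=
  mul_ne_zero (zpow_ne_zero _ (by norm_num)) (Real.exp_pos _).ne'

theorem laurentFun_signedExp (Q : Laurent d) (l : Fin d → ℤ) (x : Fin d → ℝ) :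
    laurentFun Q (signedExp l x) = ∑ m ∈ Q.support, Q m * (∏ k, ((-1 : ℂ) ^ (l k)) ^ (m k)) *
      Complex.exp (2 * Real.pi * ∑ k, (m k : ℂ) * (x k : ℂ)) := by
  unfold laurentFun Finsupp.sum
  refine Finset.sum_congr rfl fun m _ => ?_
  rw [mul_assoc (Q m), Finset.mul_sum, Complex.exp_sum, ← Finset.prod_mul_distrib]
  refine congrArg (Q m * ·) (Finset.prod_congr rfl fun k _ => ?_)
  unfold signedExp
  push_cast
  rw [mul_zpow, ← Complex.exp_int_mul]
  congr 2
  ring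

theorem analyticOnNhd_laurentFun_signedExp (Q : Laurent d) (l : Fin d → ℤ) :
    AnalyticOnNhd ℝ (fun x => laurentFun Q (signedExp l x)) univ := by
  simp only [laurentFun_signedExp]
  intro x _
  refine Finset.analyticAt_fun_sum _ fun m _ => ?_
  refine analyticAt_const.mul ?_
  refine (analyticAt_cexp.restrictScalars (𝕜 := ℝ)).comp (analyticAt_const.mul ?_)
  refine Finset.analyticAt_fun_sum _ fun k _ => analyticAt_const.mul ?_
  exact (Complex.ofRealCLM.comp (ContinuousLinearMap.proj k)).analyticAt x

/-- The functions `x ↦ e^{2πm(x)}` are distinct characters of `ℝ^d`, hence linearly independent. One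
orthant therefore determines all coefficients. -/
theorem laurent_eq_zero_of_forall_signedExp {Q : Laurent d} {l : Fin d → ℤ}
    (h : ∀ x, laurentFun Q (signedExp l x) = 0) : Q = 0 := by
  let χ : (Fin d → ℤ) → (Multiplicative (Fin d → ℝ) →* ℂ) := fun m =>
    { toFun := fun x => Complex.exp (2 * Real.pi * ∑ k, (m k : ℂ) * ((x.toAdd k : ℝ) : ℂ))
      map_one' := by simp
      map_mul' := fun x y => by
        rw [← Complex.exp_add]
        simp only [toAdd_mul, Pi.add_apply, Complex.ofReal_add, mul_add, Finset.sum_add_distrib] }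
  have hχ : Function.Injective χ := by
    intro m m' hm
    ext k
    have h1 := DFunLike.congr_fun hm (Multiplicative.ofAdd (Pi.single k 1))
    have h2 : ∀ m : Fin d → ℤ, χ m (Multiplicative.ofAdd (Pi.single k 1)) =
        ((Real.exp (2 * Real.pi * m k) : ℝ) : ℂ) := by
      intro m
      change Complex.exp _ = _
      rw [Finset.sum_eq_single k]
      · simp
      · intro j _ hj; simp [hj]
      · simp
    rw [h2, h2] at h1
    have h3 := Real.exp_injective (Complex.ofReal_injective h1)
    have h4 := mul_left_cancel₀ (by positivity) h3
    exact_mod_cast h4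
  have hli := (linearIndependent_monoidHom (Multiplicative (Fin d → ℝ)) ℂ).comp χ hχ
  rw [linearIndependent_iff'] at hli
  have hz := hli Q.support (fun m => Q m * ∏ k, ((-1 : ℂ) ^ (l k)) ^ (m k)) (by
    ext x
    have := h x.toAdd
    rw [laurentFun_signedExp] at this
    rw [Finset.sum_apply]
    exact this)
  ext m
  by_contra hm
  have := hz m (Finsupp.mem_support_iff.2 hm)
  refine (mul_ne_zero hm (Finset.prod_ne_zero_iff.2 fun k _ => ?_)) this
  exact zpow_ne_zero _ (zpow_ne_zero _ (by norm_num))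

theorem laurent_ext {Q Q' : Laurent d}
    (h : ∀ y : Fin d → ℝ, (∀ k, y k ≠ 0) → laurentFun Q y = laurentFun Q' y) : Q = Q' := by
  rw [← sub_eq_zero]
  refine laurent_eq_zero_of_forall_signedExp (l := 0) fun x => ?_
  have e : laurentFun (Q - Q') (signedExp 0 x) =
      laurentFun Q (signedExp 0 x) - laurentFun Q' (signedExp 0 x) :=
    Finsupp.sum_sub_index fun _ _ _ => sub_mul _ _ _
  rw [e, h _ (signedExp_ne_zero 0 x), sub_self]

theorem exists_eval_halfPoint_ne_zero {F : MvPolynomial (Fin d) ℂ} (hF : F ≠ 0) (l : Fin d → ℤ) :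
    ∃ x, eval (halfPoint l x) F ≠ 0 := by
  by_contra! h
  refine hF (MvPolynomial.funext_set (fun k => range fun t : ℝ => Complex.I * t - (l k : ℂ) / 2)
    (fun k => infinite_range_of_injective fun t t' ht => ?_) fun v hv => ?_)
  · simpa using ht
  · choose x hx using fun k => hv k (mem_univ k)
    have : v = halfPoint l x := funext fun k => (hx k).symm
    rw [this, h, map_zero]

/-- Otherwise `Q` would vanish on a nonempty open set where `F` does not, and by analyticity on the
whole orthant. This upgrades nonnegativity of the trace form to strict positivity. -/
theorem exists_eval_mul_laurentFun_ne_zero {F : MvPolynomial (Fin d) ℂ} (hF : F ≠ 0)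
    {Q : Laurent d} (hQ : Q ≠ 0) (l : Fin d → ℤ) :
    ∃ x, eval (halfPoint l x) F ≠ 0 ∧ laurentFun Q (signedExp l x) ≠ 0 := by
  by_contra! h
  obtain ⟨x₀, hx₀⟩ := exists_eval_halfPoint_ne_zero hF l
  have hc : Continuous fun x => eval (halfPoint l x) F := by
    refine (MvPolynomial.continuous_eval F).comp ?_
    unfold halfPoint
    fun_prop
  have hev : (fun x => laurentFun Q (signedExp l x)) =ᶠ[nhds x₀] 0 := by
    filter_upwards [hc.continuousAt.eventually_ne hx₀] with x hx using h x hx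
  have := (analyticOnNhd_laurentFun_signedExp Q l).eqOn_zero_of_preconnected_of_eventuallyEq_zero
    isPreconnected_univ (mem_univ x₀) hev
  exact hQ (laurent_eq_zero_of_forall_signedExp fun x => this (mem_univ x))

theorem isPositiveTrace_iff {ξ : Fin n → Fin d → ℤ} {b : Fin n → ℂ} {ζ : Fin d → ℝ}
    {Q : Laurent d} (hb : ∀ i, |(b i).re| < 1 / 2) (hρ : FlavorsSelfConjugate ξ b)
    (hQ : ∀ m ∈ Q.support, DecayExponent ξ ζ m) :
    IsPositiveTrace ξ b ζ (integralTrace (weight ξ b ζ (laurentFun Q))) ↔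
      Q ≠ 0 ∧ ∀ y : Fin d → ℝ, (∀ k, y k ≠ 0) → 0 ≤ laurentFun Q y := by
  constructor
  · rintro ⟨-, hpos⟩
    refine ⟨?_, ?_⟩
    · rintro rfl
      have h1 := hpos (Finsupp.single 0 1) (by simp)
      have h2 : weight ξ b ζ (laurentFun (0 : Laurent d)) = 0 := by
        ext x
        simp [weight, laurentFun]
      simp [h2, integralTrace] at h1
    · intro y hy
      obtain ⟨l, x, rfl⟩ := exists_signedExp_eq hy
      set W : (Fin d → ℝ) → ℂ := fun x => laurentFun Q (signedExp l x) * halfDensity ξ b ζ l x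
        with hW
      have hWc : Continuous W := continuous_half hb Q l
      obtain ⟨C₀, c, hc, hdec⟩ := expDecay_half hb hQ l
      have key : ∀ p : MvPolynomial (Fin d) ℝ,
          Integrable (fun x => ((eval x p ^ 2 : ℝ) : ℂ) * W x) ∧
            0 ≤ ∫ x, ((eval x p ^ 2 : ℝ) : ℂ) * W x := by
        intro p
        -- The substitution `z ↦ -i(z + l/2)` inverts `x ↦ ix - l/2`, so `F` takes the real value
        -- `p(x)` at the half-shifted point.
        set F : MvPolynomial (Fin d) ℂ := aeval (fun k =>
          (C (-Complex.I) * (X k + C ((l k : ℂ) / 2)) : MvPolynomial (Fin d) ℂ))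
          (map Complex.ofRealHom p) with hF
        have hFe : ∀ x, eval (halfPoint l x) F = ((eval x p : ℝ) : ℂ) := by
          intro x
          rw [hF]
          clear_value W
          clear hF F
          induction p using MvPolynomial.induction_on with
          | C a => simp
          | add p q hp hq => simp only [map_add, hp, hq, Complex.ofReal_add]
          | mul_X p k hp =>
            simp only [map_mul, hp, map_X, aeval_X, eval_C, map_add, eval_X, Complex.ofReal_mul]
            unfold halfPoint
            linear_combination (-((eval x p : ℝ) : ℂ) * (x k : ℂ)) * Complex.I_mul_I
        have hsq : ∀ x, (Complex.normSq (eval (halfPoint l x) F) : ℂ) =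
            ((eval x p ^ 2 : ℝ) : ℂ) := by
          intro x
          rw [hFe, Complex.normSq_ofReal, sq]
        have hint := integrable_half hb hQ F l
        simp only [hsq] at hint
        refine ⟨hint, ?_⟩
        by_cases hF0 : F = 0
        · have : ∀ x, ((eval x p ^ 2 : ℝ) : ℂ) = 0 := fun x => by rw [← hsq, hF0]; simp
          simp [this]
        · have h1 := (hpos (Finsupp.single l F) (by simpa using hF0)).le
          rw [integralTrace_mul_rho hb hQ, Finsupp.support_single l hF0] at h1
          simpa [hsq] using h1
      have hre : ∀ p : MvPolynomial (Fin d) ℝ, 0 ≤ ∫ x, eval x p ^ 2 * (W x).re := by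
        intro p
        have h1 := (Complex.le_def.1 (key p).2).1
        rw [← RCLike.re_eq_complex_re, ← integral_re (key p).1] at h1
        simpa only [RCLike.re_eq_complex_re, Complex.re_ofReal_mul, Complex.zero_re] using h1
      have him : ∀ p : MvPolynomial (Fin d) ℝ, ∫ x, eval x p ^ 2 * (W x).im = 0 := by
        intro p
        have h1 := (Complex.le_def.1 (key p).2).2
        rw [← RCLike.im_eq_complex_im, ← integral_im (key p).1] at h1
        simpa only [RCLike.im_eq_complex_im, Complex.im_ofReal_mul, Complex.zero_im] using h1.symm
      have h1 := nonneg_of_integral_sq_mul_nonneg (Complex.continuous_re.comp hWc) hc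
        (fun x => (Complex.abs_re_le_norm _).trans (hdec x)) hre x
      have h2 := nonneg_of_integral_sq_mul_nonneg (Complex.continuous_im.comp hWc) hc
        (fun x => (Complex.abs_im_le_norm _).trans (hdec x)) (fun p => (him p).ge) x
      -- The imaginary part integrates to zero against every square, so the criterion applies to it
      -- with both signs and makes it vanish.
      have h3 := nonneg_of_integral_sq_mul_nonneg (W := fun x => -(W x).im)
        (Complex.continuous_im.comp hWc).neg hc
        (fun x => by rw [abs_neg]; exact (Complex.abs_im_le_norm _).trans (hdec x))
        (fun p => by
          simp only [mul_neg]
          rw [integral_neg, him, neg_zero]) x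
      have hW0 : 0 ≤ W x := by
        refine Complex.le_def.2 ⟨h1, ?_⟩
        exact le_antisymm h2 (by simpa using h3)
      have hH := halfDensity_pos ζ hb hρ l x
      have e : laurentFun Q (signedExp l x) = W x * (halfDensity ξ b ζ l x)⁻¹ := by
        rw [hW]
        field_simp [hH.ne']
      rw [e]
      exact mul_nonneg hW0 (inv_nonneg.2 hH.le)
  · rintro ⟨hQ0, hnn⟩
    refine ⟨isTwistedTrace_integralTrace hb hQ, fun a ha => ?_⟩
    rw [integralTrace_mul_rho hb hQ]
    have hterm : ∀ (l : Fin d → ℤ) (x : Fin d → ℝ),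
        0 ≤ (Complex.normSq (eval (halfPoint l x) (a l)) : ℂ) *
          (laurentFun Q (signedExp l x) * halfDensity ξ b ζ l x) := by
      intro l x
      have h1 : (0 : ℂ) ≤ (Complex.normSq (eval (halfPoint l x) (a l)) : ℂ) := by
        exact_mod_cast Complex.normSq_nonneg _
      exact mul_nonneg h1 (mul_nonneg (hnn _ (signedExp_ne_zero l x))
        (halfDensity_pos ζ hb hρ l x).le)
    obtain ⟨l, hl⟩ := Finsupp.support_nonempty_iff.2 ha
    refine Finset.sum_pos' (fun l _ => complex_integral_nonneg (hterm l)) ⟨l, hl, ?_⟩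
    obtain ⟨x, hx1, hx2⟩ := exists_eval_mul_laurentFun_ne_zero (Finsupp.mem_support_iff.1 hl) hQ0 l
    refine complex_integral_pos ?_ (integrable_half hb hQ (a l) l) (hterm l) (x₀ := x) ?_
    · refine Continuous.mul ?_ (continuous_half hb Q l)
      refine Complex.continuous_ofReal.comp (Complex.continuous_normSq.comp
        ((MvPolynomial.continuous_eval (a l)).comp ?_))
      unfold halfPoint
      fun_prop
    · refine mul_ne_zero ?_ (mul_ne_zero hx2 (halfDensity_pos ζ hb hρ l x).ne')
      exact_mod_cast (Complex.normSq_pos.2 hx1).ne'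

end Analysis

/-! ### Generic directions and the decay of individual monomials. -/

section Cone

open MvPolynomial MeasureTheory Set Filter

variable {d n : ℕ}

theorem continuous_pairReal (ξ : Fin d → ℤ) : Continuous (pairReal ξ) := by
  unfold pairReal
  fun_prop

theorem pairReal_smul (ξ : Fin d → ℤ) (t : ℝ) (x : Fin d → ℝ) :
    pairReal ξ (t • x) = t * pairReal ξ x := by
  unfold pairReal
  rw [Finset.mul_sum]
  exact Finset.sum_congr rfl fun k _ => by simp; ring

theorem continuous_growth (ξ : Fin n → Fin d → ℤ) (ζ : Fin d → ℝ) (m : Fin d → ℤ) :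
    Continuous (growth ξ ζ m) := by
  unfold growth
  have := fun i => continuous_pairReal (ξ i)
  fun_prop

theorem growth_eq (ξ : Fin n → Fin d → ℤ) (ζ : Fin d → ℝ) (m : Fin d → ℤ) (x : Fin d → ℝ) :
    growth ξ ζ m x = growth ξ ζ 0 x + 2 * Real.pi * pairReal m x := by
  unfold growth
  have : pairReal m x = ∑ k, (m k : ℝ) * x k := rfl
  rw [this]
  simp only [add_mul, Finset.sum_add_distrib]
  simp
  ring

theorem growth_smul (ξ : Fin n → Fin d → ℤ) (ζ : Fin d → ℝ) (m : Fin d → ℤ) {t : ℝ} (ht : 0 ≤ t)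
    (x : Fin d → ℝ) : growth ξ ζ m (t • x) = t * growth ξ ζ m x := by
  unfold growth
  simp only [pairReal_smul, abs_mul, abs_of_nonneg ht, ← Finset.mul_sum]
  have : ∑ k, ((m k : ℝ) + ζ k) * (t • x) k = t * ∑ k, ((m k : ℝ) + ζ k) * x k := by
    rw [Finset.mul_sum]
    exact Finset.sum_congr rfl fun k _ => by simp; ring
  rw [this]
  ring

/-- The excluded directions lie in finitely many proper hyperplanes, which have measure zero. -/
theorem dense_setOf_injOn_pairReal (S : Finset (Fin d → ℤ)) :
    Dense {u : Fin d → ℝ | InjOn (fun m => pairReal m u) (S : Set (Fin d → ℤ))} := by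
  have hae : ∀ m m' : Fin d → ℤ, m ≠ m' →
      ∀ᵐ u : Fin d → ℝ, pairReal m u ≠ pairReal m' u := by
    intro m m' hm
    let φ : (Fin d → ℝ) →ₗ[ℝ] ℝ := ∑ k, ((m k : ℝ) - (m' k : ℝ)) • LinearMap.proj k
    have hφ : ∀ u, φ u = pairReal m u - pairReal m' u := by
      intro u
      simp only [φ, pairReal, LinearMap.sum_apply, LinearMap.smul_apply, LinearMap.proj_apply,
        smul_eq_mul, sub_mul, Finset.sum_sub_distrib]
    have hne : LinearMap.ker φ ≠ ⊤ := by
      intro h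
      refine hm (funext fun k => ?_)
      have h1 : φ (Pi.single k 1) = 0 := by
        rw [← LinearMap.mem_ker, h]; trivial
      rw [hφ] at h1
      have h2 : ∀ m : Fin d → ℤ, pairReal m (Pi.single k 1) = m k := by
        intro m
        unfold pairReal
        rw [Finset.sum_eq_single k]
        · simp
        · intro j _ hj; simp [hj]
        · simp
      rw [h2, h2, sub_eq_zero] at h1
      exact_mod_cast h1
    have h0 := Measure.addHaar_submodule (volume : Measure (Fin d → ℝ)) _ hne
    rw [ae_iff]
    refine measure_mono_null (fun u hu => ?_) h0
    simp only [ne_eq, not_not, mem_ofPred_eq] at hu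
    rw [SetLike.mem_coe, LinearMap.mem_ker, hφ, hu, sub_self]
  have hall : ∀ᵐ u : Fin d → ℝ, ∀ m ∈ S, ∀ m' ∈ S, m ≠ m' → pairReal m u ≠ pairReal m' u := by
    refine (Finset.eventually_all S).2 fun m _ => (Finset.eventually_all S).2 fun m' _ => ?_
    by_cases h : m = m'
    · exact Eventually.of_forall fun u h' => absurd h h'
    · filter_upwards [hae m m' h] with u hu using fun _ => hu
  refine (Measure.dense_of_ae hall).mono fun u hu m hm m' hm' h => ?_
  by_contra hne
  exact hu m hm m' hm' hne h

/-- Injectivity on the support makes the maximal exponent strictly dominant. It is the same `m₀` for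
every sign pattern `l`, which later reveals its parity. -/
theorem exists_tendsto_leading {Q : Laurent d} (hQ : Q ≠ 0) {u : Fin d → ℝ}
    (hu : InjOn (fun m => pairReal m u) (Q.support : Set (Fin d → ℤ))) :
    ∃ m₀ ∈ Q.support, (∀ m ∈ Q.support, pairReal m u ≤ pairReal m₀ u) ∧
      ∀ l : Fin d → ℤ, Tendsto (fun t : ℝ => ((Real.exp (-(2 * Real.pi * pairReal m₀ u) * t) : ℝ) : ℂ) *
        laurentFun Q (signedExp l (t • u))) atTop
        (nhds (Q m₀ * ∏ k, ((-1 : ℂ) ^ (l k)) ^ (m₀ k))) := by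
  obtain ⟨m₀, hm₀, hmax⟩ := Q.support.exists_max_image (fun m => pairReal m u)
    (Finsupp.support_nonempty_iff.2 hQ)
  refine ⟨m₀, hm₀, hmax, fun l => ?_⟩
  have hpi := Real.pi_pos
  have key : ∀ m ∈ Q.support, Tendsto (fun t : ℝ =>
      Q m * (∏ k, ((-1 : ℂ) ^ (l k)) ^ (m k)) *
        ((Real.exp (2 * Real.pi * (pairReal m u - pairReal m₀ u) * t) : ℝ) : ℂ)) atTop
      (nhds (if m = m₀ then Q m * ∏ k, ((-1 : ℂ) ^ (l k)) ^ (m k) else 0)) := by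
    intro m hm
    split_ifs with h
    · subst h
      simp
    · have hlt : pairReal m u < pairReal m₀ u :=
        lt_of_le_of_ne (hmax m hm) fun h' => h (hu hm hm₀ h')
      have h1 : Tendsto (fun t : ℝ => Real.exp (2 * Real.pi * (pairReal m u - pairReal m₀ u) * t))
          atTop (nhds 0) := by
        refine Real.tendsto_exp_atBot.comp (tendsto_id.const_mul_atTop_of_neg ?_)
        exact mul_neg_of_pos_of_neg (by positivity) (by linarith)
      have h2 := ((Complex.continuous_ofReal.tendsto 0).comp h1).const_mul
        (Q m * (∏ k, ((-1 : ℂ) ^ (l k)) ^ (m k)))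
      simpa using h2
  have hsum := tendsto_finsetSum _ key
  rw [Finset.sum_ite_eq' Q.support m₀, if_pos hm₀] at hsum
  refine hsum.congr fun t => ?_
  rw [laurentFun_signedExp, Finset.mul_sum]
  refine Finset.sum_congr rfl fun m _ => ?_
  have e : Complex.exp (2 * Real.pi * ∑ k, (m k : ℂ) * (((t • u) k : ℝ) : ℂ)) =
      ((Real.exp (2 * Real.pi * pairReal m u * t) : ℝ) : ℂ) := by
    have : pairReal m u * t = ∑ k, (m k : ℝ) * (t • u) k := by
      rw [pairReal, Finset.sum_mul]
      exact Finset.sum_congr rfl fun k _ => by simp; ring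
    rw [mul_assoc (2 * Real.pi) (pairReal m u) t, this]
    push_cast
    rfl
  rw [e, mul_left_comm, ← Complex.ofReal_mul, ← Real.exp_add]
  congr 4
  ring

/-- Each denominator is at most a constant times `e^{π(s + |s|)}` with `s = ξ_j(x)`. These exponents
and the prefactor of the weight add up to `-growth` at exponent zero. -/
theorem exists_norm_laurentFun_le (ξ : Fin n → Fin d → ℤ) {b : Fin n → ℂ} (ζ : Fin d → ℝ)
    (hb : ∀ i, |(b i).re| < 1 / 2) (Q : Laurent d) :
    ∃ D : ℝ, 0 ≤ D ∧ ∀ x, ‖laurentFun Q (signedExp 0 x)‖ ≤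
      D * Real.exp (-growth ξ ζ 0 x) * ‖weight ξ b ζ (laurentFun Q) x‖ := by
  obtain ⟨D, hD, hprod⟩ := exists_prod_le Finset.univ
    (fun (j : Fin n) (x : Fin d → ℝ) => (Real.exp (2 * Real.pi * pairReal (ξ j) x) : ℂ) +
      Complex.exp (2 * Real.pi * Complex.I * b j))
    (fun j x => Real.pi * (pairReal (ξ j) x + |pairReal (ξ j) x|)) (fun j => by
      refine ⟨1 + ‖Complex.exp (2 * Real.pi * Complex.I * b j)‖, by positivity, fun x => ?_⟩
      refine (norm_add_le _ _).trans ?_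
      have hpi := Real.pi_pos
      rw [Complex.norm_real, Real.norm_of_nonneg (Real.exp_pos _).le, add_mul, one_mul]
      refine add_le_add (Real.exp_le_exp.2 ?_) (le_mul_of_one_le_right (norm_nonneg _)
        (Real.one_le_exp ?_))
      · nlinarith [le_abs_self (pairReal (ξ j) x)]
      · nlinarith [neg_abs_le (pairReal (ξ j) x)])
  refine ⟨D, hD, fun x => ?_⟩
  have hpos : (∏ j, ((Real.exp (2 * Real.pi * pairReal (ξ j) x) : ℂ) +
      Complex.exp (2 * Real.pi * Complex.I * b j))) ≠ 0 := by
    refine Finset.prod_ne_zero_iff.2 fun j _ => ?_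
    have e0 : ((Real.exp (2 * Real.pi * pairReal (ξ j) x) : ℝ) : ℂ) =
        Complex.exp (2 * Real.pi * (pairReal (ξ j) x : ℂ)) := by push_cast; rfl
    rw [e0, exp_add_exp_eq_cos]
    refine mul_ne_zero (mul_ne_zero two_ne_zero (cos_pi_mul_ne_zero ?_)) (Complex.exp_ne_zero _)
    simpa using hb j
  have hs : (fun k => Real.exp (2 * Real.pi * x k)) = signedExp 0 x := by
    ext k; simp [signedExp]
  have h1 := hprod x
  rw [weight, hs, norm_div, norm_mul, Complex.norm_real, Real.norm_of_nonneg (Real.exp_pos _).le]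
  set P := ‖∏ j, ((Real.exp (2 * Real.pi * pairReal (ξ j) x) : ℂ) +
      Complex.exp (2 * Real.pi * Complex.I * b j))‖ with hP
  have hP0 : 0 < P := norm_pos_iff.2 hpos
  set L := ‖laurentFun Q (signedExp 0 x)‖
  have hL : 0 ≤ L := norm_nonneg _
  rw [mul_div_assoc', le_div_iff₀ hP0]
  have h2 : D * Real.exp (∑ j, Real.pi * (pairReal (ξ j) x + |pairReal (ξ j) x|)) =
      D * Real.exp (-growth ξ ζ 0 x) *
        Real.exp (2 * Real.pi * (∑ k, ζ k * x k) - Real.pi * ∑ i, pairReal (ξ i) x) := by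
    rw [mul_assoc, ← Real.exp_add]
    congr 2
    unfold growth
    simp only [← Finset.mul_sum, Finset.sum_add_distrib, Pi.zero_apply, Int.cast_zero, zero_add]
    ring
  rw [h2] at h1
  calc L * P ≤ L * (D * Real.exp (-growth ξ ζ 0 x) *
        Real.exp (2 * Real.pi * (∑ k, ζ k * x k) - Real.pi * ∑ i, pairReal (ξ i) x)) := by gcongr
    _ = _ := by ring

/-- In a generic direction, growth of the dominant monomial above `-c‖u‖` would force its
coefficient to be zero, and the other monomials grow no faster. The inequality is closed in `u`, so
density of generic directions gives it everywhere, with the same `c`. -/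
theorem decayExponent_of_expDecay {ξ : Fin n → Fin d → ℤ} {b : Fin n → ℂ} {ζ : Fin d → ℝ}
    (hb : ∀ i, |(b i).re| < 1 / 2) {Q : Laurent d}
    (hw : ExpDecay (weight ξ b ζ (laurentFun Q))) : ∀ m ∈ Q.support, DecayExponent ξ ζ m := by
  intro m hm
  have hQ : Q ≠ 0 := by rintro rfl; simp at hm
  obtain ⟨C, c, hc, hdec⟩ := hw
  obtain ⟨D, hD, hlow⟩ := exists_norm_laurentFun_le ξ ζ hb Q
  refine ⟨c, hc, fun x => ?_⟩
  have hcl : IsClosed {u : Fin d → ℝ | growth ξ ζ m u ≤ -c * ‖u‖} :=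
    isClosed_le (continuous_growth ξ ζ m) (by fun_prop)
  refine hcl.closure_subset_iff.2 (fun u hu => ?_) (dense_setOf_injOn_pairReal Q.support x)
  obtain ⟨m₀, hm₀, hmax, hlim⟩ := exists_tendsto_leading hQ hu
  have hpi := Real.pi_pos
  have h1 : growth ξ ζ m u ≤ growth ξ ζ m₀ u := by
    rw [growth_eq ξ ζ m, growth_eq ξ ζ m₀]
    have := hmax m hm
    gcongr
  refine h1.trans ?_
  by_contra hlt
  rw [not_le] at hlt
  have hz : Tendsto (fun t : ℝ => ((Real.exp (-(2 * Real.pi * pairReal m₀ u) * t) : ℝ) : ℂ) *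
      laurentFun Q (signedExp 0 (t • u))) atTop (nhds 0) := by
    have h2 : Tendsto (fun t : ℝ => D * C * Real.exp (-(growth ξ ζ m₀ u + c * ‖u‖) * t)) atTop
        (nhds 0) := by
      have : Tendsto (fun t : ℝ => Real.exp (-(growth ξ ζ m₀ u + c * ‖u‖) * t)) atTop (nhds 0) :=
        Real.tendsto_exp_atBot.comp (tendsto_id.const_mul_atTop_of_neg (by linarith))
      simpa using this.const_mul (D * C)
    refine squeeze_zero_norm' ?_ h2
    filter_upwards [eventually_ge_atTop (0 : ℝ)] with t ht
    rw [norm_mul, Complex.norm_real, Real.norm_of_nonneg (Real.exp_pos _).le]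
    have h3 := hlow (t • u)
    have h4 := hdec (t • u)
    rw [norm_smul, Real.norm_of_nonneg ht] at h4
    calc _ ≤ Real.exp (-(2 * Real.pi * pairReal m₀ u) * t) *
          (D * Real.exp (-growth ξ ζ 0 (t • u)) * (C * Real.exp (-c * (t * ‖u‖)))) := by
          refine mul_le_mul_of_nonneg_left (h3.trans ?_) (Real.exp_pos _).le
          gcongr
      _ = D * C * (Real.exp (-(2 * Real.pi * pairReal m₀ u) * t) *
          Real.exp (-growth ξ ζ 0 (t • u)) * Real.exp (-c * (t * ‖u‖))) := by ring
      _ = _ := by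
          rw [← Real.exp_add, ← Real.exp_add, growth_smul ξ ζ 0 ht, growth_eq ξ ζ m₀]
          congr 2
          ring
  have := tendsto_nhds_unique (hlim 0) hz
  simp only [Pi.zero_apply, zpow_zero, one_zpow, Finset.prod_const_one, mul_one] at this
  exact Finsupp.mem_support_iff.1 hm₀ this

/-! ### Decaying exponents are the integer points of `𝒫°`: growth is `2π` times `m(x)` minus the
support function of `𝒫`. -/

theorem growth_eq_max (ξ : Fin n → Fin d → ℤ) (ζ : Fin d → ℝ) (m : Fin d → ℤ) (x : Fin d → ℝ) :
    growth ξ ζ m x = 2 * Real.pi * (pairReal m x +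
      ∑ k, (ζ k - 1 / 2 * ∑ i, (ξ i k : ℝ)) * x k - ∑ i, max (pairReal (ξ i) x) 0) := by
  have h1 : ∀ s : ℝ, max s 0 = 1 / 2 * s + 1 / 2 * |s| := by
    intro s
    rcases le_total s 0 with h | h
    · rw [max_eq_right h, abs_of_nonpos h]; ring
    · rw [max_eq_left h, abs_of_nonneg h]; ring
  have h2 : ∑ k, (∑ i, (ξ i k : ℝ)) * x k = ∑ i, pairReal (ξ i) x := by
    unfold pairReal
    simp only [Finset.sum_mul]
    exact Finset.sum_comm
  have h3 : ∑ k, (ζ k - 1 / 2 * ∑ i, (ξ i k : ℝ)) * x k =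
      ∑ k, ζ k * x k - 1 / 2 * ∑ i, pairReal (ξ i) x := by
    rw [← h2, Finset.mul_sum, ← Finset.sum_sub_distrib]
    exact Finset.sum_congr rfl fun k _ => by ring
  have h4 : ∑ k, ((m k : ℝ) + ζ k) * x k = pairReal m x + ∑ k, ζ k * x k := by
    simp only [add_mul, Finset.sum_add_distrib, pairReal]
  rw [growth, h3, h4]
  simp only [h1, Finset.sum_add_distrib, ← Finset.mul_sum]
  ring

theorem sum_polytope_point (ξ : Fin n → Fin d → ℤ) (ζ : Fin d → ℝ) (t : Fin n → ℝ)
    (x : Fin d → ℝ) :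
    ∑ k, (-(ζ k - 1 / 2 * ∑ i, (ξ i k : ℝ)) + ∑ i, t i * (ξ i k : ℝ)) * x k =
      -∑ k, (ζ k - 1 / 2 * ∑ i, (ξ i k : ℝ)) * x k + ∑ i, t i * pairReal (ξ i) x := by
  have h2 : ∑ k, (∑ i, t i * (ξ i k : ℝ)) * x k = ∑ i, t i * pairReal (ξ i) x := by
    unfold pairReal
    simp only [Finset.sum_mul, Finset.mul_sum]
    rw [Finset.sum_comm]
    exact Finset.sum_congr rfl fun i _ => Finset.sum_congr rfl fun k _ => by ring
  simp only [add_mul, Finset.sum_add_distrib, h2, neg_mul, Finset.sum_neg_distrib]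

theorem isCompact_polytope (ξ : Fin n → Fin d → ℤ) (ζ : Fin d → ℝ) :
    IsCompact (polytope ξ ζ) := by
  have : polytope ξ ζ = (fun (t : Fin n → ℝ) k =>
      -(ζ k - 1 / 2 * ∑ i, (ξ i k : ℝ)) + ∑ i, t i * (ξ i k : ℝ)) '' Icc 0 1 := by
    ext p
    constructor
    · rintro ⟨t, ht, hp⟩
      exact ⟨t, ⟨fun i => (ht i).1, fun i => (ht i).2⟩, funext fun k => (hp k).symm⟩
    · rintro ⟨t, ht, rfl⟩
      exact ⟨t, fun i => ⟨ht.1 i, ht.2 i⟩, fun k => rfl⟩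
  rw [this]
  exact isCompact_Icc.image (by fun_prop)

theorem convex_polytope (ξ : Fin n → Fin d → ℤ) (ζ : Fin d → ℝ) : Convex ℝ (polytope ξ ζ) := by
  rintro p ⟨t, ht, hp⟩ q ⟨s, hs, hq⟩ a b ha hb hab
  refine ⟨a • t + b • s, fun i => convex_Icc 0 1 (ht i) (hs i) ha hb hab, fun k => ?_⟩
  simp only [Pi.add_apply, Pi.smul_apply, smul_eq_mul, hp, hq, add_mul, Finset.sum_add_distrib,
    mul_assoc, ← Finset.mul_sum]
  linear_combination (-(ζ k - 1 / 2 * ∑ i, (ξ i k : ℝ))) * hab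

theorem decayExponent_of_mem_interior {ξ : Fin n → Fin d → ℤ} {ζ : Fin d → ℝ} {m : Fin d → ℤ}
    (hm : (fun k => (m k : ℝ)) ∈ interior (polytope ξ ζ)) : DecayExponent ξ ζ m := by
  obtain ⟨r, hr, hball⟩ := Metric.mem_nhds_iff.1 (mem_interior_iff_mem_nhds.1 hm)
  have hpi := Real.pi_pos
  refine ⟨2 * Real.pi * (r / 2), by positivity, fun x => ?_⟩
  -- Moving `m` towards the signs of `x` stays in `𝒫` and raises the pairing with `x` by
  -- `(r/2)∑|x_k|`, which becomes the decay margin.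
  obtain ⟨t, ht, hp⟩ := hball (show (fun k => (m k : ℝ) + r / 2 * SignType.sign (x k)) ∈ _ by
    rw [Metric.mem_ball]
    refine lt_of_le_of_lt ((dist_pi_le_iff (by positivity : 0 ≤ r / 2)).2 fun k => ?_)
      (half_lt_self hr)
    rw [Real.dist_eq, add_sub_cancel_left, abs_mul, abs_of_pos (half_pos hr)]
    refine mul_le_of_le_one_right (by positivity) ?_
    rcases lt_trichotomy (x k) 0 with h | h | h <;> simp [h])
  have h1 := sum_polytope_point ξ ζ t x
  simp only [← hp] at h1
  have h2 : ∑ k, ((m k : ℝ) + r / 2 * SignType.sign (x k)) * x k =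
      pairReal m x + r / 2 * ∑ k, |x k| := by
    rw [pairReal, Finset.mul_sum, ← Finset.sum_add_distrib]
    refine Finset.sum_congr rfl fun k _ => ?_
    rw [add_mul, mul_assoc, sign_mul_self]
  have h3 : ∑ i, t i * pairReal (ξ i) x ≤ ∑ i, max (pairReal (ξ i) x) 0 := by
    refine Finset.sum_le_sum fun i _ => ?_
    rcases le_total (pairReal (ξ i) x) 0 with h | h
    · rw [max_eq_right h]; exact mul_nonpos_of_nonneg_of_nonpos (ht i).1 h
    · rw [max_eq_left h]; exact mul_le_of_le_one_left h (ht i).2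
  have h4 : ‖x‖ ≤ ∑ k, |x k| := by
    refine (pi_norm_le_iff_of_nonneg (Finset.sum_nonneg fun _ _ => abs_nonneg _)).2 fun k => ?_
    exact Finset.single_le_sum (f := fun k => |x k|) (fun _ _ => abs_nonneg _) (Finset.mem_univ k)
  rw [growth_eq_max]
  rw [h2] at h1
  have h5 : r / 2 * ‖x‖ ≤ r / 2 * ∑ k, |x k| := by gcongr
  rw [show -(2 * Real.pi * (r / 2)) * ‖x‖ = 2 * Real.pi * -(r / 2 * ‖x‖) by ring]
  refine mul_le_mul_of_nonneg_left ?_ (by positivity)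
  linarith

/-- A point near `m` outside `𝒫` would be separated from it by some `v`, hence exceed the support
function at `v`. The margin `c‖v‖` in the decay of `m` excludes this. -/
theorem mem_interior_of_decayExponent {ξ : Fin n → Fin d → ℤ} {ζ : Fin d → ℝ} {m : Fin d → ℤ}
    (hm : DecayExponent ξ ζ m) : (fun k => (m k : ℝ)) ∈ interior (polytope ξ ζ) := by
  obtain ⟨c, hc, hg⟩ := hm
  have hpi := Real.pi_pos
  rw [mem_interior_iff_mem_nhds, Metric.mem_nhds_iff]
  -- The factor `d` bounds the pairing of two vectors by their sup norms; `d + 1` keeps the radius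
  -- meaningful for `d = 0`.
  refine ⟨c / (2 * Real.pi * (d + 1)), by positivity, fun m' hm' => ?_⟩
  by_contra hnot
  obtain ⟨f, u, hf1, hf2⟩ := geometric_hahn_banach_closed_point (convex_polytope ξ ζ)
    (isCompact_polytope ξ ζ).isClosed hnot
  set v : Fin d → ℝ := fun k => f (Pi.single k 1) with hv
  -- This choice of `t` maximises the pairing with `v` over `𝒫`.
  have hlt := (hf1 _ ⟨fun i => if 0 ≤ pairReal (ξ i) v then 1 else 0, fun i => by
    beta_reduce
    split_ifs <;> simp, fun k => rfl⟩).trans hf2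
  rw [dual_apply_eq_sum f m', dual_apply_eq_sum f, sum_polytope_point] at hlt
  have h1 : ∑ i, (if 0 ≤ pairReal (ξ i) v then 1 else 0) * pairReal (ξ i) v =
      ∑ i, max (pairReal (ξ i) v) 0 := by
    refine Finset.sum_congr rfl fun i _ => ?_
    split_ifs with h
    · rw [one_mul, max_eq_left h]
    · rw [zero_mul, max_eq_right (not_le.1 h).le]
  rw [h1] at hlt
  have h2 := hg v
  rw [growth_eq_max] at h2
  have h3 : ∑ k, m' k * v k - pairReal m v ≤ d * (c / (2 * Real.pi * (d + 1)) * ‖v‖) := by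
    rw [pairReal, ← Finset.sum_sub_distrib]
    have : ∀ k ∈ Finset.univ, m' k * v k - (m k : ℝ) * v k ≤
        c / (2 * Real.pi * (d + 1)) * ‖v‖ := by
      intro k _
      rw [← sub_mul]
      refine (le_abs_self _).trans ?_
      rw [abs_mul]
      refine mul_le_mul ?_ (norm_le_pi_norm v k) (abs_nonneg _) (by positivity)
      have := dist_le_pi_dist m' (fun k => (m k : ℝ)) k
      rw [Real.dist_eq] at this
      exact this.trans (Metric.mem_ball.1 hm').le
    refine (Finset.sum_le_card_nsmul _ _ _ this).trans_eq ?_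
    simp
  have h4 : 2 * Real.pi * (d * (c / (2 * Real.pi * (d + 1)) * ‖v‖)) ≤ c * ‖v‖ := by
    have e : 2 * Real.pi * (d * (c / (2 * Real.pi * (d + 1)) * ‖v‖)) =
        (d / (d + 1)) * (c * ‖v‖) := by field_simp
    rw [e]
    refine mul_le_of_le_one_left (by positivity) ?_
    rw [div_le_one (by positivity)]
    linarith
  change _ < ∑ k, m' k * v k at hlt
  have h5 : 2 * Real.pi * -(d * (c / (2 * Real.pi * (d + 1)) * ‖v‖)) < 2 * Real.pi * (pairReal m v +
      ∑ k, (ζ k - 1 / 2 * ∑ i, (ξ i k : ℝ)) * v k - ∑ i, max (pairReal (ξ i) v) 0) := by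
    refine mul_lt_mul_of_pos_left ?_ (by positivity)
    linarith
  linarith

/-! ### Exponents of nonnegative Laurent polynomials. -/

/-- An integer vector as a real vector. -/
def toReal (m : Fin d → ℤ) : Fin d → ℝ := fun k => (m k : ℝ)

theorem toReal_injective : Function.Injective (toReal (d := d)) := fun _ _ h =>
  funext fun k => Int.cast_injective (congrFun h k)

theorem finite_setOf_toReal_mem {s : Set (Fin d → ℝ)} (hs : Bornology.IsBounded s) :
    {m : Fin d → ℤ | toReal m ∈ s}.Finite := by
  obtain ⟨R, hR⟩ := hs.exists_norm_le
  refine (finite_Icc (fun _ => -⌈R⌉ : Fin d → ℤ) (fun _ => ⌈R⌉)).subset fun m hm => ?_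
  have h : ∀ k, |(m k : ℝ)| ≤ ⌈R⌉ := fun k =>
    (norm_le_pi_norm (toReal m) k).trans ((hR _ hm).trans (Int.le_ceil R))
  refine ⟨fun k => ?_, fun k => ?_⟩
  · have := (abs_le.1 (h k)).1
    exact_mod_cast this
  · have := (abs_le.1 (h k)).2
    exact_mod_cast this

theorem finite_setOf_toReal_mem_polytope (ξ : Fin n → Fin d → ℤ) (ζ : Fin d → ℝ) :
    {m : Fin d → ℤ | toReal m ∈ polytope ξ ζ}.Finite :=
  finite_setOf_toReal_mem (isCompact_polytope ξ ζ).isBounded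

theorem convexHull_evenInteriorPoints_subset (ξ : Fin n → Fin d → ℤ) (ζ : Fin d → ℝ) :
    convexHull ℝ (evenInteriorPoints ξ ζ) ⊆ interior (polytope ξ ζ) :=
  convexHull_min inter_subset_left (convex_polytope ξ ζ).interior

theorem finite_hullIntegerPoints (ξ : Fin n → Fin d → ℤ) (ζ : Fin d → ℝ) :
    (hullIntegerPoints ξ ζ).Finite :=
  (finite_setOf_toReal_mem_polytope ξ ζ).subset fun _ hm =>
    interior_subset (s := polytope ξ ζ) (convexHull_evenInteriorPoints_subset ξ ζ hm)

theorem evenInteriorPoints_eq_toReal {ξ : Fin n → Fin d → ℤ} {ζ : Fin d → ℝ} {p : Fin d → ℝ}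
    (hp : p ∈ evenInteriorPoints ξ ζ) : ∃ m : Fin d → ℤ, (∀ k, Even (m k)) ∧ toReal m = p := by
  obtain ⟨-, m, hm⟩ := hp
  refine ⟨fun k => 2 * m k, fun k => even_two_mul _, funext fun k => ?_⟩
  rw [hm, toReal]
  push_cast
  rfl

theorem finite_evenInteriorPoints (ξ : Fin n → Fin d → ℤ) (ζ : Fin d → ℝ) :
    (evenInteriorPoints ξ ζ).Finite := by
  refine ((finite_setOf_toReal_mem_polytope ξ ζ).image toReal).subset fun p hp => ?_
  obtain ⟨m, -, rfl⟩ := evenInteriorPoints_eq_toReal hp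
  exact ⟨m, interior_subset (s := polytope ξ ζ) hp.1, rfl⟩

theorem mem_evenInteriorPoints_of_even {ξ : Fin n → Fin d → ℤ} {ζ : Fin d → ℝ} {m : Fin d → ℤ}
    (hm : DecayExponent ξ ζ m) (he : ∀ k, Even (m k)) : toReal m ∈ evenInteriorPoints ξ ζ := by
  refine ⟨mem_interior_of_decayExponent hm, ?_⟩
  choose a ha using he
  refine ⟨a, fun k => ?_⟩
  rw [toReal, ha]
  push_cast
  ring

/-- An exponent outside the hull is separated from it by an open set of directions, hence by a
generic one. The dominant exponent there must be even by nonnegativity on all orthants, so it is one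
of the separated points, although it pairs at least as strongly as `m`. -/
theorem support_subset_hullIntegerPoints {ξ : Fin n → Fin d → ℤ} {ζ : Fin d → ℝ} {Q : Laurent d}
    (hQ : ∀ m ∈ Q.support, DecayExponent ξ ζ m)
    (hnn : ∀ y : Fin d → ℝ, (∀ k, y k ≠ 0) → 0 ≤ laurentFun Q y) :
    ∀ m ∈ Q.support, m ∈ hullIntegerPoints ξ ζ := by
  intro m hm
  have hQ0 : Q ≠ 0 := by rintro rfl; simp at hm
  by_contra hnot
  obtain ⟨f, u, hf1, hf2⟩ := geometric_hahn_banach_closed_point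
    (convex_convexHull ℝ (evenInteriorPoints ξ ζ))
    ((finite_evenInteriorPoints ξ ζ).isClosed_convexHull ℝ) hnot
  set U : Set (Fin d → ℝ) :=
    ⋂ p ∈ evenInteriorPoints ξ ζ, {v | ∑ k, p k * v k < pairReal m v} with hU
  have hUo : IsOpen U := by
    refine (finite_evenInteriorPoints ξ ζ).isOpen_biInter fun p _ => ?_
    exact isOpen_lt (by fun_prop) (continuous_pairReal m)
  have hUne : U.Nonempty := by
    refine ⟨fun k => f (Pi.single k 1), ?_⟩
    simp only [hU, mem_iInter]
    intro p hp
    have := (hf1 p (subset_convexHull ℝ _ hp)).trans hf2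
    rwa [dual_apply_eq_sum f p, dual_apply_eq_sum f] at this
  obtain ⟨v, hvU, hv⟩ := (dense_setOf_injOn_pairReal Q.support).inter_open_nonempty U hUo hUne
  obtain ⟨m₀, hm₀, hmax, hlim⟩ := exists_tendsto_leading hQ0 hv
  have hge : ∀ l : Fin d → ℤ, 0 ≤ Q m₀ * ∏ k, ((-1 : ℂ) ^ (l k)) ^ (m₀ k) := by
    intro l
    refine ge_of_tendsto' (hlim l) fun t => mul_nonneg ?_ (hnn _ (signedExp_ne_zero _ _))
    exact_mod_cast (Real.exp_pos _).le
  have hpos : 0 < Q m₀ := by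
    refine lt_of_le_of_ne ?_ (Finsupp.mem_support_iff.1 hm₀).symm
    simpa using hge 0
  have heven : ∀ k, Even (m₀ k) := by
    intro k
    by_contra hodd
    rw [Int.not_even_iff_odd] at hodd
    -- Reversing the sign of the single coordinate `k` would negate the leading term if its exponent
    -- were odd.
    have h1 := hge (Pi.single k 1)
    rw [Finset.prod_eq_single k (by
      intro j _ hj
      simp [hj]) (by simp)] at h1
    rw [Pi.single_eq_same, zpow_one, hodd.neg_one_zpow, mul_neg, mul_one] at h1
    exact absurd h1 (not_le_of_gt (neg_neg_of_pos hpos))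
  have h1 := mem_evenInteriorPoints_of_even (hQ m₀ hm₀) heven
  simp only [hU, mem_iInter] at hvU
  have h2 : ∑ k, toReal m₀ k * v k < pairReal m v := hvU _ h1
  exact absurd (h2.trans_le (hmax m hm)) (lt_irrefl _)

/-- The real value of a Laurent monomial. -/
def realMonomial (m : Fin d → ℤ) (y : Fin d → ℝ) : ℝ := ∏ k, y k ^ (m k)

theorem laurentFun_single (m : Fin d → ℤ) (c : ℂ) (y : Fin d → ℝ) :
    laurentFun (Finsupp.single m c) y = c * (realMonomial m y : ℂ) := by
  unfold laurentFun realMonomial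
  rw [Finsupp.sum_single_index (by simp)]
  push_cast
  rfl

theorem laurentFun_add (Q Q' : Laurent d) (y : Fin d → ℝ) :
    laurentFun (Q + Q') y = laurentFun Q y + laurentFun Q' y :=
  Finsupp.sum_add_index' (fun _ => zero_mul _) fun _ _ _ => add_mul _ _ _

theorem laurentFun_smul (c : ℂ) (Q : Laurent d) (y : Fin d → ℝ) :
    laurentFun (c • Q) y = c * laurentFun Q y := by
  unfold laurentFun
  rw [Finsupp.sum_smul_index fun _ => zero_mul _, Finsupp.mul_sum]
  exact Finsupp.sum_congr fun _ _ => mul_assoc _ _ _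

/-- Evaluation at a real point as a linear map on Laurent polynomials. -/
def laurentFunₗ (y : Fin d → ℝ) : Laurent d →ₗ[ℂ] ℂ where
  toFun Q := laurentFun Q y
  map_add' Q Q' := laurentFun_add Q Q' y
  map_smul' c Q := laurentFun_smul c Q y

theorem laurentFun_sum {ι : Type*} (s : Finset ι) (Q : ι → Laurent d) (y : Fin d → ℝ) :
    laurentFun (∑ i ∈ s, Q i) y = ∑ i ∈ s, laurentFun (Q i) y :=
  map_sum (laurentFunₗ y) Q s

theorem realMonomial_nonneg {m : Fin d → ℤ} (hm : ∀ k, Even (m k)) (y : Fin d → ℝ) :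
    0 ≤ realMonomial m y :=
  Finset.prod_nonneg fun k _ => (hm k).zpow_nonneg _

theorem abs_realMonomial (m : Fin d → ℤ) {y : Fin d → ℝ} (hy : ∀ k, y k ≠ 0) :
    |realMonomial m y| = Real.exp (∑ k, toReal m k * Real.log |y k|) := by
  unfold realMonomial
  rw [Finset.abs_prod, Real.exp_sum]
  refine Finset.prod_congr rfl fun k _ => ?_
  rw [abs_zpow, ← Real.rpow_intCast, Real.rpow_def_of_pos (abs_pos.2 (hy k)), mul_comm]
  rfl

/-- For fixed `y`, `log |y^m|` is linear in `m`, so on the hull it is bounded by its value at one of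
the generating even points. -/
theorem exists_abs_realMonomial_le {ξ : Fin n → Fin d → ℤ} {ζ : Fin d → ℝ} {m : Fin d → ℤ}
    (hm : m ∈ hullIntegerPoints ξ ζ) {y : Fin d → ℝ} (hy : ∀ k, y k ≠ 0) :
    ∃ e : Fin d → ℤ, toReal e ∈ evenInteriorPoints ξ ζ ∧
      |realMonomial m y| ≤ realMonomial e y := by
  let φ : (Fin d → ℝ) →ₗ[ℝ] ℝ := ∑ k, Real.log |y k| • LinearMap.proj k
  have hφ : ∀ p, φ p = ∑ k, p k * Real.log |y k| := by
    intro p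
    simp [φ, LinearMap.sum_apply, mul_comm]
  obtain ⟨p, hp, hle⟩ := (φ.convexOn convex_univ).exists_ge_of_mem_convexHull (subset_univ _) hm
  obtain ⟨e, he, rfl⟩ := evenInteriorPoints_eq_toReal hp
  refine ⟨e, hp, ?_⟩
  rw [hφ, hφ] at hle
  rw [← abs_of_nonneg (realMonomial_nonneg he y), abs_realMonomial m hy, abs_realMonomial e hy]
  exact Real.exp_le_exp.2 hle

/-- Real values are unchanged by conjugating the coefficients, and the values determine the
coefficients. -/
theorem conj_coeff_eq {Q : Laurent d}
    (hnn : ∀ y : Fin d → ℝ, (∀ k, y k ≠ 0) → 0 ≤ laurentFun Q y) (m : Fin d → ℤ) :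
    ((Q m).re : ℂ) = Q m := by
  have h : Q.mapRange (starRingEnd ℂ) (map_zero _) = Q := by
    refine laurent_ext fun y hy => ?_
    have h1 : laurentFun (Q.mapRange (starRingEnd ℂ) (map_zero _)) y =
        (starRingEnd ℂ) (laurentFun Q y) := by
      unfold laurentFun
      rw [Finsupp.sum_mapRange_index fun _ => zero_mul _, Finsupp.sum, Finsupp.sum, map_sum]
      simp
    rw [h1, Complex.conj_eq_iff_im]
    exact (Complex.le_def.1 (hnn y hy)).2.symm
  have h2 := DFunLike.congr_fun h m
  rw [Finsupp.mapRange_apply] at h2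
  exact Complex.conj_eq_iff_re.1 h2

/-- The Laurent polynomial with the same coefficients as a given polynomial. -/
def toLaurent (Q : MvPolynomial (Fin d) ℂ) : Laurent d :=
  ∑ s ∈ Q.support, Finsupp.single (fun k => (s k : ℤ)) (coeff s Q)

theorem laurentFun_toLaurent (Q : MvPolynomial (Fin d) ℂ) : laurentFun (toLaurent Q) = polyFun Q := by
  ext y
  unfold toLaurent polyFun
  rw [laurentFun_sum, eval_eq']
  refine Finset.sum_congr rfl fun s _ => ?_
  rw [laurentFun_single, realMonomial]
  simp

theorem toLaurent_ne_zero_iff (Q : MvPolynomial (Fin d) ℂ) : toLaurent Q ≠ 0 ↔ Q ≠ 0 := by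
  refine not_congr ⟨fun h => ?_, fun h => by simp [h, toLaurent]⟩
  refine MvPolynomial.funext_set (fun _ => range Complex.ofReal)
    (fun _ => infinite_range_of_injective Complex.ofReal_injective) fun v hv => ?_
  choose y hy using fun k => hv k (mem_univ k)
  have h1 := congrFun (laurentFun_toLaurent Q) y
  rw [h] at h1
  rw [map_zero, ← funext hy]
  exact h1.symm

theorem polyFun_nonneg_iff (Q : MvPolynomial (Fin d) ℂ) :
    (∀ y : Fin d → ℝ, (∀ k, y k ≠ 0) → 0 ≤ polyFun Q y) ↔ ∀ y, 0 ≤ polyFun Q y := by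
  refine ⟨fun h y => ?_, fun h y _ => h y⟩
  have hc : Continuous (polyFun Q) := by
    unfold polyFun
    exact (MvPolynomial.continuous_eval Q).comp (by fun_prop)
  have hd : Dense (Set.pi univ fun _ : Fin d => ({0}ᶜ : Set ℝ)) :=
    dense_pi univ fun _ _ => dense_compl_singleton 0
  have hcl : IsClosed {y | 0 ≤ polyFun Q y} := isClosed_le continuous_const hc
  exact hcl.closure_subset_iff.2 (fun y' hy' => h y' fun k => mem_pi.1 hy' k (mem_univ k)) (hd y)

/-! ### The cone of positive weights and its real span. -/

section Weights

variable (ξ : Fin n → Fin d → ℤ) (b : Fin n → ℂ) (ζ : Fin d → ℝ)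

/-- The weight as a linear function of the Laurent polynomial. -/
def weightₗ : Laurent d →ₗ[ℂ] ((Fin d → ℝ) → ℂ) where
  toFun Q := weight ξ b ζ (laurentFun Q)
  map_add' Q Q' := by
    ext x
    simp only [weight, laurentFun_add, Pi.add_apply]
    ring
  map_smul' c Q := by
    ext x
    simp only [weight, laurentFun_smul, Pi.smul_apply, smul_eq_mul, RingHom.id_apply]
    ring

variable {b}

theorem ker_weightₗ (hb : ∀ i, |(b i).re| < 1 / 2) : LinearMap.ker (weightₗ ξ b ζ) = ⊥ := by
  rw [LinearMap.ker_eq_bot']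
  intro Q hQ
  obtain ⟨D, -, hD⟩ := exists_norm_laurentFun_le ξ ζ hb Q
  refine laurent_eq_zero_of_forall_signedExp (l := 0) fun x => ?_
  have h1 : weight ξ b ζ (laurentFun Q) x = 0 := congrFun hQ x
  have := hD x
  rw [h1, norm_zero, mul_zero] at this
  exact norm_le_zero_iff.1 this

theorem mem_positiveWeights_iff (hb : ∀ i, |(b i).re| < 1 / 2) (hρ : FlavorsSelfConjugate ξ b)
    (w : (Fin d → ℝ) → ℂ) :
    w ∈ positiveWeights ξ b ζ ↔ ∃ Q : Laurent d, weightₗ ξ b ζ Q = w ∧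
      (∀ m ∈ Q.support, DecayExponent ξ ζ m) ∧ Q ≠ 0 ∧
      ∀ y : Fin d → ℝ, (∀ k, y k ≠ 0) → 0 ≤ laurentFun Q y := by
  constructor
  · rintro ⟨⟨Q, rfl⟩, hdec, hpos⟩
    have hQ := decayExponent_of_expDecay hb hdec
    exact ⟨Q, rfl, hQ, (isPositiveTrace_iff hb hρ hQ).1 hpos⟩
  · rintro ⟨Q, rfl, hQ, h⟩
    exact ⟨⟨Q, rfl⟩, expDecay_weight hb hQ, (isPositiveTrace_iff hb hρ hQ).2 h⟩

theorem smul_mem_positiveWeights (hb : ∀ i, |(b i).re| < 1 / 2) (hρ : FlavorsSelfConjugate ξ b)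
    {c : ℝ} (hc : 0 < c) {w : (Fin d → ℝ) → ℂ} (hw : w ∈ positiveWeights ξ b ζ) :
    c • w ∈ positiveWeights ξ b ζ := by
  rw [mem_positiveWeights_iff ξ ζ hb hρ] at hw ⊢
  obtain ⟨Q, rfl, hQ, hQ0, hnn⟩ := hw
  have hc' : (c : ℂ) ≠ 0 := by exact_mod_cast hc.ne'
  refine ⟨(c : ℂ) • Q, ?_, fun m hm => hQ m (Finsupp.support_smul hm), smul_ne_zero hc' hQ0,
    fun y hy => ?_⟩
  · rw [map_smul]
    ext x
    simp
  · rw [laurentFun_smul]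
    exact mul_nonneg (by exact_mod_cast hc.le) (hnn y hy)

theorem add_mem_positiveWeights (hb : ∀ i, |(b i).re| < 1 / 2) (hρ : FlavorsSelfConjugate ξ b)
    {w w' : (Fin d → ℝ) → ℂ} (hw : w ∈ positiveWeights ξ b ζ) (hw' : w' ∈ positiveWeights ξ b ζ) :
    w + w' ∈ positiveWeights ξ b ζ := by
  classical
  rw [mem_positiveWeights_iff ξ ζ hb hρ] at hw hw' ⊢
  obtain ⟨Q, rfl, hQ, hQ0, hnn⟩ := hw
  obtain ⟨Q', rfl, hQ', -, hnn'⟩ := hw'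
  refine ⟨Q + Q', map_add _ _ _, fun m hm => ?_, fun h0 => hQ0 ?_, fun y hy => ?_⟩
  · rcases Finset.mem_union.1 (Finsupp.support_add hm) with h | h
    · exact hQ m h
    · exact hQ' m h
  -- Two nonnegative functions with zero sum both vanish; this keeps the cone closed under addition
  -- although zero is excluded.
  · refine laurent_ext fun y hy => ?_
    have h1 : laurentFun Q y + laurentFun Q' y = 0 := by
      rw [← laurentFun_add, h0]
      simp [laurentFun]
    have h2 : laurentFun Q y ≤ 0 := by
      rw [← h1]
      exact le_add_of_nonneg_right (hnn' y hy)
    rw [le_antisymm h2 (hnn y hy)]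
    simp [laurentFun]
  · rw [laurentFun_add]
    exact add_nonneg (hnn y hy) (hnn' y hy)

/-- The convex cone of positive weights. -/
def positiveCone (hb : ∀ i, |(b i).re| < 1 / 2) (hρ : FlavorsSelfConjugate ξ b) :
    ConvexCone ℝ ((Fin d → ℝ) → ℂ) where
  carrier := positiveWeights ξ b ζ
  smul_mem' _ hc _ hw := smul_mem_positiveWeights ξ ζ hb hρ hc hw
  add_mem' _ hw _ hw' := add_mem_positiveWeights ξ ζ hb hρ hw hw'

/-- The monomial weights with exponents in the hull of the even points. -/
def hullWeight (b : Fin n → ℂ) (m : hullIntegerPoints ξ ζ) : (Fin d → ℝ) → ℂ :=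
  weightₗ ξ b ζ (Finsupp.single m 1)

theorem linearIndependent_hullWeight (hb : ∀ i, |(b i).re| < 1 / 2) :
    LinearIndependent ℝ (hullWeight ξ ζ b) := by
  have h1 : LinearIndependent ℂ fun m : Fin d → ℤ => (Finsupp.single m 1 : Laurent d) :=
    Finsupp.linearIndependent_single_one ℂ _
  have h2 := (h1.map' _ (ker_weightₗ ξ ζ hb)).comp
    (fun m : hullIntegerPoints ξ ζ => (m : Fin d → ℤ)) Subtype.val_injective
  refine LinearIndependent.restrict_scalars (K := ℂ) (fun r s h => ?_) h2
  simpa using h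

theorem span_positiveWeights_le (hb : ∀ i, |(b i).re| < 1 / 2) (hρ : FlavorsSelfConjugate ξ b) :
    Submodule.span ℝ (positiveWeights ξ b ζ) ≤ Submodule.span ℝ (range (hullWeight ξ ζ b)) := by
  rw [Submodule.span_le]
  intro w hw
  obtain ⟨Q, rfl, hQ, -, hnn⟩ := (mem_positiveWeights_iff ξ ζ hb hρ w).1 hw
  rw [SetLike.mem_coe, ← Finsupp.sum_single Q, Finsupp.sum, map_sum]
  refine Submodule.sum_mem _ fun m hm => ?_
  have e : weightₗ ξ b ζ (Finsupp.single m (Q m)) =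
      (Q m).re • hullWeight ξ ζ b ⟨m, support_subset_hullIntegerPoints hQ hnn m hm⟩ := by
    have h1 : (Finsupp.single m (Q m) : Laurent d) =
        ((Q m).re : ℂ) • (Finsupp.single m 1 : Laurent d) := by
      rw [conj_coeff_eq hnn]; simp
    rw [h1, map_smul]
    ext x
    simp [hullWeight]
  rw [e]
  exact Submodule.smul_mem _ _ (Submodule.subset_span ⟨_, rfl⟩)

/-- Let `Q₀` be the sum of all even monomials with exponent in `𝒫°`. It is nonnegative and dominates
`|y^m|`, so `y^m = (Q₀ + y^m) - Q₀` is a difference of two admissible Laurent polynomials. -/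
theorem hullWeight_mem_span (hb : ∀ i, |(b i).re| < 1 / 2) (hρ : FlavorsSelfConjugate ξ b)
    (m : hullIntegerPoints ξ ζ) :
    hullWeight ξ ζ b m ∈ Submodule.span ℝ (positiveWeights ξ b ζ) := by
  classical
  obtain ⟨m, hm⟩ := m
  have hfin : {e : Fin d → ℤ | toReal e ∈ evenInteriorPoints ξ ζ}.Finite :=
    (finite_evenInteriorPoints ξ ζ).preimage toReal_injective.injOn
  set E : Finset (Fin d → ℤ) := hfin.toFinset with hE
  have hEmem : ∀ e, e ∈ E ↔ toReal e ∈ evenInteriorPoints ξ ζ := fun e => by simp [hE]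
  have hEeven : ∀ e ∈ E, ∀ k, Even (e k) := by
    intro e he
    obtain ⟨e', he', h⟩ := evenInteriorPoints_eq_toReal ((hEmem e).1 he)
    rwa [← toReal_injective h]
  have hEne : E.Nonempty := by
    obtain ⟨p, hp⟩ := convexHull_nonempty_iff.1 ⟨_, hm⟩
    obtain ⟨e, -, rfl⟩ := evenInteriorPoints_eq_toReal hp
    exact ⟨e, (hEmem e).2 hp⟩
  set Q₀ : Laurent d := ∑ e ∈ E, Finsupp.single e 1 with hQ₀
  have hQ₀a : ∀ m', Q₀ m' = if m' ∈ E then 1 else 0 := by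
    intro m'
    rw [hQ₀, Finsupp.finsetSum_apply]
    simp [Finsupp.single_apply]
  have hfun₀ : ∀ y, laurentFun Q₀ y = ((∑ e ∈ E, realMonomial e y : ℝ) : ℂ) := by
    intro y
    rw [hQ₀, laurentFun_sum]
    simp [laurentFun_single]
  have hdecE : ∀ e ∈ E, DecayExponent ξ ζ e := fun e he =>
    decayExponent_of_mem_interior ((hEmem e).1 he).1
  have hsupp₀ : ∀ e ∈ Q₀.support, e ∈ E := by
    intro e he
    by_contra h
    rw [Finsupp.mem_support_iff, hQ₀a, if_neg h] at he
    exact he rfl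
  have h0 : weightₗ ξ b ζ Q₀ ∈ positiveWeights ξ b ζ := by
    refine (mem_positiveWeights_iff ξ ζ hb hρ _).2 ⟨Q₀, rfl, fun e he => hdecE e (hsupp₀ e he), ?_,
      fun y _ => ?_⟩
    · obtain ⟨e, he⟩ := hEne
      intro h
      have := hQ₀a e
      rw [h, if_pos he] at this
      simp at this
    · rw [hfun₀]
      exact_mod_cast Finset.sum_nonneg fun e he => realMonomial_nonneg (hEeven e he) y
  have h1 : weightₗ ξ b ζ (Q₀ + Finsupp.single m 1) ∈ positiveWeights ξ b ζ := by
    refine (mem_positiveWeights_iff ξ ζ hb hρ _).2 ⟨_, rfl, fun e he => ?_, ?_, fun y hy => ?_⟩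
    · rcases Finset.mem_union.1 (Finsupp.support_add he) with h | h
      · exact hdecE e (hsupp₀ e h)
      · rw [Finset.mem_singleton.1 (Finsupp.support_single_subset h)]
        exact decayExponent_of_mem_interior (convexHull_evenInteriorPoints_subset ξ ζ hm)
    · intro h
      -- The coefficient at `m` is `2` or `1`, according to whether `m` is itself among the even
      -- points.
      have := DFunLike.congr_fun h m
      rw [Finsupp.add_apply, hQ₀a, Finsupp.single_eq_same] at this
      split_ifs at this <;> norm_num at this
    · rw [laurentFun_add, hfun₀, laurentFun_single, one_mul]
      have : 0 ≤ ∑ e ∈ E, realMonomial e y + realMonomial m y := by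
        obtain ⟨e, he, hle⟩ := exists_abs_realMonomial_le hm hy
        have h2 := Finset.single_le_sum (f := fun e => realMonomial e y)
          (fun e he => realMonomial_nonneg (hEeven e he) y) ((hEmem e).2 he)
        have h3 := neg_abs_le (realMonomial m y)
        linarith
      exact_mod_cast this
  have e : hullWeight ξ ζ b ⟨m, hm⟩ =
      weightₗ ξ b ζ (Q₀ + Finsupp.single m 1) - weightₗ ξ b ζ Q₀ := by
    rw [map_add, add_sub_cancel_left]
    rfl
  rw [e]
  exact Submodule.sub_mem _ (Submodule.subset_span h1) (Submodule.subset_span h0)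

theorem rank_span_positiveWeights (hb : ∀ i, |(b i).re| < 1 / 2)
    (hρ : FlavorsSelfConjugate ξ b) :
    Module.rank ℝ (Submodule.span ℝ (positiveWeights ξ b ζ)) =
      Cardinal.mk (hullIntegerPoints ξ ζ) := by
  have h : Submodule.span ℝ (positiveWeights ξ b ζ) =
      Submodule.span ℝ (range (hullWeight ξ ζ b)) := by
    refine le_antisymm (span_positiveWeights_le ξ ζ hb hρ) (Submodule.span_le.2 ?_)
    rintro _ ⟨m, rfl⟩
    exact hullWeight_mem_span ξ ζ hb hρ m
  have hli := linearIndependent_hullWeight ξ ζ hb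
  rw [h, rank_span hli, Cardinal.mk_range_eq _ hli.injective]

end Weights

end Cone

end AbelianCoulomb

end

theorem proposition2p7 {d n : ℕ} (ξ : Fin n → Fin d → ℤ) (b : Fin n → ℂ) (ζ : Fin d → ℝ)
    (hb : ∀ i, |(b i).re| < 1 / 2) (hρ : AbelianCoulomb.FlavorsSelfConjugate ξ b) :
    (∀ Q : MvPolynomial (Fin d) ℂ,
      AbelianCoulomb.ExpDecay (AbelianCoulomb.weight ξ b ζ (AbelianCoulomb.polyFun Q)) →
      (AbelianCoulomb.IsPositiveTrace ξ b ζ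
          (AbelianCoulomb.integralTrace
            (AbelianCoulomb.weight ξ b ζ (AbelianCoulomb.polyFun Q))) ↔
        Q ≠ 0 ∧ ∀ y : Fin d → ℝ, 0 ≤ AbelianCoulomb.polyFun Q y)) ∧
    (∀ Q : AbelianCoulomb.Laurent d,
      AbelianCoulomb.ExpDecay (AbelianCoulomb.weight ξ b ζ (AbelianCoulomb.laurentFun Q)) →
      (AbelianCoulomb.IsPositiveTrace ξ b ζ
          (AbelianCoulomb.integralTrace
            (AbelianCoulomb.weight ξ b ζ (AbelianCoulomb.laurentFun Q))) ↔
        Q ≠ 0 ∧ ∀ y : Fin d → ℝ, (∀ k, y k ≠ 0) → 0 ≤ AbelianCoulomb.laurentFun Q y)) ∧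
    (AbelianCoulomb.hullIntegerPoints ξ ζ).Finite ∧
    ∃ K : ConvexCone ℝ ((Fin d → ℝ) → ℂ),
      (K : Set ((Fin d → ℝ) → ℂ)) = AbelianCoulomb.positiveWeights ξ b ζ ∧
      Module.rank ℝ (Submodule.span ℝ (K : Set ((Fin d → ℝ) → ℂ))) =
        Cardinal.mk (AbelianCoulomb.hullIntegerPoints ξ ζ) := by
  refine ⟨fun Q hdec => ?_, fun Q hdec => ?_, AbelianCoulomb.finite_hullIntegerPoints ξ ζ,
    AbelianCoulomb.positiveCone ξ ζ hb hρ, rfl,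
    AbelianCoulomb.rank_span_positiveWeights ξ ζ hb hρ⟩
  · rw [← AbelianCoulomb.laurentFun_toLaurent] at hdec
    have h := AbelianCoulomb.isPositiveTrace_iff hb hρ
      (AbelianCoulomb.decayExponent_of_expDecay hb hdec)
    rwa [AbelianCoulomb.laurentFun_toLaurent, AbelianCoulomb.toLaurent_ne_zero_iff,
      AbelianCoulomb.polyFun_nonneg_iff] at h
  · exact AbelianCoulomb.isPositiveTrace_iff hb hρ
      (AbelianCoulomb.decayExponent_of_expDecay hb hdec)
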